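/- Let $\mathbf T^2=(\mathbf R/\mathbf Z)^2$ be the two-dimensional torus of total area $1$. All functions are real-valued, $H^{-1}(\mathbf T^2)$ is the dual of $H^1(\mathbf T^2)$ with its dual norm, $\langle\cdot,\cdot\rangle$ is the duality pairing, and the mass of $\rho_*\in H^{-1}(\mathbf T^2)$ is $\int_{\mathbf T^2}\rho_*:=\langle\rho_*,1\rangle$. For $\delta>0$ and $\rho_*\in H^{-1}(\mathbf T^2)$, a weak solution of the Poisson–Boltzmann equation $$-\delta^2\Delta\phi=e^{-\phi}-\rho_*\qquad(\ast)$$ is a $\phi\in H^1(\mathbf T^2)$ such that, for every $\psi\in H^1(\mathbf T^2)$, $e^{-\phi}\psi$ is integrable and $$\delta^2\int_{\mathbf T^2}\nabla\phi\cdot\nabla\psi=\int_{\mathbf T^2}e^{-\phi}\psi-\langle\rho_*,\psi\rangle .$$ 1. For any $\rho_*\in H^{-1}(\mathbf T^2)$ with $\int_{\mathbf T^2}\rho_*=1$ and any $\delta>0$, Equation $(\ast)$ has a unique weak solution $\phi\in H^1(\mathbf T^2)$, and $\int_{\mathbf T^2}e^{-\phi}=1$. 2. There exists a constant $K>0$ such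 that, for any such $\rho_*$ and any $\delta>0$, the corresponding solution satisfies $$\delta^2\|\nabla\phi\|_{L^2(\mathbf T^2)}^2+\Big|\int_{\mathbf T^2}\phi\Big|\le\frac{K}{\delta^2}\,\|\rho_*-1\|_{H^{-1}(\mathbf T^2)}^2 .$$ 3. If in addition $\rho_*\in L^p(\mathbf T^2)$ for some $p\in[1,+\infty]$, then $$\|e^{-\phi}\|_{L^p(\mathbf T^2)}\le\|\rho_*\|_{L^p(\mathbf T^2)} .$$ 4. For any $p\in(1,+\infty)$ one has $L^p(\mathbf T^2)\subset H^{-1}(\mathbf T^2)$, and there exists $K_p>0$ such that, for any $\rho_*\in L^p(\mathbf T^2)$ with $\int_{\mathbf T^2}\rho_*=1$ and any $\delta>0$, the solution $\phi$ of $(\ast)$ has weak second derivatives in $L^p(\mathbf T^2)$ and $$\|\nabla^2\phi\|_{L^p(\mathbf T^2)}\le\frac{K_p}{\delta^2}\|\rho_*\|_{L^p(\mathbf T^2)},\qquad \|\phi\|_{L^\infty(\mathbf T^2)}\le\frac{K_p}{\delta^2}\|\rho_*\|_{L^p(\mathbf T^2)} .$$ -/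

import Mathlib

open MeasureTheory
open scoped ENNReal ContDiff

noncomputable section

namespace PoissonBoltzmann

/-- The two-dimensional torus `(ℝ/ℤ)²`; `volume` is the product Lebesgue measure, of total mass `1`. -/
abbrev T2 : Type := UnitAddTorus (Fin 2)

/-- The canonical projection `ℝ² → 𝕋²`. -/
def proj (x : Fin 2 → ℝ) : T2 := fun i => (x i : UnitAddCircle)

/-- `f : 𝕋² → ℝ` is smooth when its periodic lift to `ℝ²` is `C^∞`. -/
def IsSmooth (f : T2 → ℝ) : Prop := ContDiff ℝ ∞ (fun x : Fin 2 → ℝ => f (proj x))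

/-- The (classical) partial derivative `∂ᵢ f` of a function on the torus. -/
def pderiv (i : Fin 2) (f : T2 → ℝ) (x : T2) : ℝ :=
  deriv (fun t : ℝ => f (x + Pi.single i (t : UnitAddCircle))) 0

/-! ### Basic facts on smooth functions -/

theorem isOpenQuotientMap_proj : IsOpenQuotientMap proj :=
  IsOpenQuotientMap.piMap (fun _ : Fin 2 =>
    (QuotientAddGroup.isOpenQuotientMap_mk : IsOpenQuotientMap ((↑) : ℝ → UnitAddCircle)))

theorem IsSmooth.continuous {f : T2 → ℝ} (hf : IsSmooth f) : Continuous f :=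
  isOpenQuotientMap_proj.isQuotientMap.continuous_iff.2 (ContDiff.continuous hf)

theorem proj_add_single (x : Fin 2 → ℝ) (i : Fin 2) (t : ℝ) :
    proj x + Pi.single i (t : UnitAddCircle) = proj (x + t • Pi.single i (1 : ℝ)) := by
  funext j
  by_cases h : j = i
  · subst h; simp [proj]
  · simp [proj, h]

theorem IsSmooth.hasDerivAt {f : T2 → ℝ} (hf : IsSmooth f) (i : Fin 2) (x : T2) (t : ℝ) :
    HasDerivAt (fun s : ℝ => f (x + Pi.single i (s : UnitAddCircle)))
      (pderiv i f (x + Pi.single i (t : UnitAddCircle))) t := by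
  obtain ⟨y, rfl⟩ := isOpenQuotientMap_proj.surjective x
  have hd : Differentiable ℝ (fun s : ℝ => f (proj y + Pi.single i (s : UnitAddCircle))) := by
    simp_rw [proj_add_single]
    exact (ContDiff.differentiable hf (by simp)).comp (f := fun s : ℝ => y + s • Pi.single i (1 : ℝ))
      (by fun_prop)
  have h := (hd t).hasDerivAt
  have : (fun s : ℝ => f (proj y + Pi.single i (t : UnitAddCircle)
      + Pi.single i (s : UnitAddCircle)))
      = fun s : ℝ => (fun s : ℝ => f (proj y + Pi.single i (s : UnitAddCircle))) (t + s) := by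
    funext s
    simp only [add_assoc, ← Pi.single_add, AddCircle.coe_add]
  have h3 : pderiv i f (proj y + Pi.single i (t : UnitAddCircle))
      = deriv (fun s : ℝ => f (proj y + Pi.single i (s : UnitAddCircle))) t := by
    unfold PoissonBoltzmann.pderiv
    rw [this]
    have h4 := deriv_comp_const_add (fun s : ℝ => f (proj y + Pi.single i (s : UnitAddCircle))) t 0
    rw [add_zero] at h4
    exact h4
  rw [h3]
  exact h

theorem IsSmooth.pderiv {f : T2 → ℝ} (hf : IsSmooth f) (i : Fin 2) : IsSmooth (pderiv i f) := by
  have h : (fun x : Fin 2 → ℝ => PoissonBoltzmann.pderiv i f (proj x))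
      = fun x => fderiv ℝ (fun x : Fin 2 → ℝ => f (proj x)) x (Pi.single i 1) := by
    funext x
    rw [← ((ContDiff.differentiable hf (by simp)) x).lineDeriv_eq_fderiv]
    simp only [PoissonBoltzmann.pderiv, lineDeriv, proj_add_single]
  unfold IsSmooth
  rw [h]
  exact (ContDiff.fderiv_right hf (by simp)).clm_apply contDiff_const

theorem isSmooth_const (c : ℝ) : IsSmooth (fun _ => c) := contDiff_const

theorem IsSmooth.mul {f g : T2 → ℝ} (hf : IsSmooth f) (hg : IsSmooth g) :
    IsSmooth (fun x => f x * g x) := ContDiff.mul hf hg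

theorem pderiv_mul {f g : T2 → ℝ} (hf : IsSmooth f) (hg : IsSmooth g) (i : Fin 2) (x : T2) :
    pderiv i (fun x => f x * g x) x = pderiv i f x * g x + f x * pderiv i g x := by
  have h1 := hf.hasDerivAt i x 0
  have h2 := hg.hasDerivAt i x 0
  have h := (h1.fun_mul h2).deriv
  simp only [AddCircle.coe_zero, Pi.single_zero, add_zero] at h
  exact h

theorem memLp_of_continuous {f : T2 → ℝ} (hf : Continuous f) (p : ℝ≥0∞) : MemLp f p volume := by
  obtain ⟨C, hC⟩ := isCompact_univ.exists_bound_of_continuousOn hf.continuousOn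
  exact MemLp.of_bound hf.aestronglyMeasurable C (Filter.Eventually.of_forall fun x => hC x trivial)

/-- The torus has total mass `1`. -/
instance isProbabilityMeasure_volume : IsProbabilityMeasure (volume : Measure T2) := by
  have : IsProbabilityMeasure (volume : Measure UnitAddCircle) := ⟨UnitAddCircle.measure_univ⟩
  exact inferInstanceAs (IsProbabilityMeasure (Measure.pi fun _ : Fin 2 =>
    (volume : Measure UnitAddCircle)))

theorem hasDerivAt_integral_of_bounded (F F' : ℝ → T2 → ℝ) (C : ℝ)
    (h3 : ∀ t, AEStronglyMeasurable (F t) volume) (h1 : Integrable (F 0) volume)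
    (h2 : AEStronglyMeasurable (F' 0) volume)
    (h4 : ∀ᵐ x : T2, ∀ t ∈ (Set.univ : Set ℝ), ‖F' t x‖ ≤ C)
    (h5 : ∀ᵐ x : T2, ∀ t ∈ (Set.univ : Set ℝ), HasDerivAt (fun s => F s x) (F' t x) t) :
    HasDerivAt (fun t => ∫ x, F t x) (∫ x, F' 0 x) 0 :=
  (hasDerivAt_integral_of_dominated_loc_of_deriv_le (bound := fun _ => C)
    Filter.univ_mem (Filter.Eventually.of_forall h3) h1 h2 h4 (integrable_const C) h5).2

theorem integral_pderiv {f : T2 → ℝ} (hf : IsSmooth f) (i : Fin 2) : ∫ x, pderiv i f x = 0 := by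
  obtain ⟨C, hC⟩ := isCompact_univ.exists_bound_of_continuousOn (hf.pderiv i).continuous.continuousOn
  have hc : ∀ (g : T2 → ℝ), Continuous g → ∀ t : ℝ,
      Continuous (fun x : T2 => g (x + Pi.single i (t : UnitAddCircle))) := fun g hg t =>
    hg.comp (by fun_prop)
  have h1 : ∀ (g : T2 → ℝ) (t : ℝ),
      ∫ x : T2, g (x + Pi.single i (t : UnitAddCircle)) = ∫ x, g x := fun g t =>
    integral_add_right_eq_self (μ := (volume : Measure T2)) g _
  obtain ⟨F, hF⟩ : ∃ F : ℝ → T2 → ℝ, ∀ t, F t = fun x => f (x + Pi.single i (t : UnitAddCircle)) :=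
    ⟨_, fun _ => rfl⟩
  obtain ⟨F', hF'⟩ : ∃ F' : ℝ → T2 → ℝ, ∀ t, F' t =
    fun x => pderiv i f (x + Pi.single i (t : UnitAddCircle)) := ⟨_, fun _ => rfl⟩
  have key := hasDerivAt_integral_of_bounded F F' C
    (fun t => by rw [hF]; exact (hc f hf.continuous t).aestronglyMeasurable)
    (by rw [hF]; exact (memLp_of_continuous (hc f hf.continuous 0) 1).integrable le_rfl)
    (by rw [hF']; exact (hc _ (hf.pderiv i).continuous 0).aestronglyMeasurable)
    (Filter.Eventually.of_forall fun x t _ => by rw [hF']; exact hC _ (Set.mem_univ _))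
    (Filter.Eventually.of_forall fun x t _ => by
      simp only [hF, hF']; exact hf.hasDerivAt i x t)
  simp only [hF, hF', h1] at key
  exact key.unique (hasDerivAt_const (0 : ℝ) _)

theorem integral_mul_pderiv {f g : T2 → ℝ} (hf : IsSmooth f) (hg : IsSmooth g) (i : Fin 2) :
    ∫ x, f x * pderiv i g x = -∫ x, pderiv i f x * g x := by
  have h := integral_pderiv (hf.mul hg) i
  simp_rw [pderiv_mul hf hg] at h
  rw [integral_add] at h
  · linarith
  · exact (memLp_of_continuous ((hf.pderiv i).continuous.mul hg.continuous) 1).integrable le_rfl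
  · exact (memLp_of_continuous (hf.continuous.mul (hg.pderiv i).continuous) 1).integrable le_rfl

theorem integrable_mul_smooth {f g : T2 → ℝ} (hf : MemLp f 2 volume) (hg : IsSmooth g) :
    Integrable (fun x => f x * g x) :=
  hf.integrable_mul (memLp_of_continuous hg.continuous 2)

/-! ### Sobolev spaces -/

/-- The plane `ℝ²` with its Euclidean norm, in which gradients take their values. -/
abbrev Plane : Type := EuclideanSpace ℝ (Fin 2)

/-- `g` is the `i`-th weak partial derivative of `f` on the torus. -/
def IsWeakPartial (i : Fin 2) (f g : T2 → ℝ) : Prop :=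
  ∀ η : T2 → ℝ, IsSmooth η → ∫ x, f x * pderiv i η x = -∫ x, g x * η x

theorem memLp_coord {G : T2 → Plane} {p : ℝ≥0∞} (hG : MemLp G p volume) (i : Fin 2) :
    MemLp (fun x => G x i) p volume :=
  ContinuousLinearMap.comp_memLp' (EuclideanSpace.proj i : Plane →L[ℝ] ℝ) hG

/-- `H¹(𝕋²)` (real-valued), as the space of pairs `(u, ∇u)` where `u ∈ L²`, and `∇u ∈ L²` is the
weak gradient of `u`. It inherits the Hilbert norm `‖u‖² = ‖u‖²_{L²} + ‖∇u‖²_{L²}`. -/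
def sobolevH1 :
    Submodule ℝ (WithLp 2 (Lp ℝ 2 (volume : Measure T2) × Lp Plane 2 (volume : Measure T2))) where
  carrier := {u | ∀ i, IsWeakPartial i u.fst (fun x => u.snd x i)}
  zero_mem' := by
    intro i η hη
    have h1 : ∫ x, (0 : Lp ℝ 2 (volume : Measure T2)) x * pderiv i η x = 0 := by
      rw [integral_eq_zero_of_ae]
      filter_upwards [Lp.coeFn_zero ℝ 2 (volume : Measure T2)] with x hx
      rw [hx]; simp
    have h2 : ∫ x, (0 : Lp Plane 2 (volume : Measure T2)) x i * η x = 0 := by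
      rw [integral_eq_zero_of_ae]
      filter_upwards [Lp.coeFn_zero Plane 2 (volume : Measure T2)] with x hx
      rw [hx]; simp
    exact h1.trans (by rw [← neg_zero]; exact congrArg Neg.neg h2.symm)
  add_mem' := by
    intro u v hu hv i η hη
    have h1 : ∫ x, (u + v).fst x * pderiv i η x
        = ∫ x, (u.fst x * pderiv i η x + v.fst x * pderiv i η x) := by
      apply integral_congr_ae
      filter_upwards [Lp.coeFn_add u.fst v.fst] with x hx
      rw [WithLp.add_fst, hx, Pi.add_apply, add_mul]
    have h2 : ∫ x, (u + v).snd x i * η x = ∫ x, (u.snd x i * η x + v.snd x i * η x) := by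
      apply integral_congr_ae
      filter_upwards [Lp.coeFn_add u.snd v.snd] with x hx
      rw [WithLp.add_snd, hx, Pi.add_apply, PiLp.add_apply, add_mul]
    rw [h1, h2, integral_add (integrable_mul_smooth (Lp.memLp _) (hη.pderiv i))
      (integrable_mul_smooth (Lp.memLp _) (hη.pderiv i)),
      integral_add (integrable_mul_smooth (memLp_coord (Lp.memLp _) i) hη)
      (integrable_mul_smooth (memLp_coord (Lp.memLp _) i) hη), hu i η hη, hv i η hη]
    ring
  smul_mem' := by
    intro c u hu i η hη
    have h1 : ∫ x, (c • u).fst x * pderiv i η x = ∫ x, c * (u.fst x * pderiv i η x) := by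
      apply integral_congr_ae
      filter_upwards [Lp.coeFn_smul c u.fst] with x hx
      rw [WithLp.smul_fst, hx, Pi.smul_apply, smul_eq_mul, mul_assoc]
    have h2 : ∫ x, (c • u).snd x i * η x = ∫ x, c * (u.snd x i * η x) := by
      apply integral_congr_ae
      filter_upwards [Lp.coeFn_smul c u.snd] with x hx
      rw [WithLp.smul_snd, hx, Pi.smul_apply, PiLp.smul_apply, smul_eq_mul, mul_assoc]
    rw [h1, h2, integral_const_mul, integral_const_mul, hu i η hη]
    ring

/-- The Hilbert space `H¹(𝕋²)`. -/
abbrev H1 : Type := sobolevH1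

/-- The underlying `L²` function of an element of `H¹`. -/
def H1.fn (u : H1) : Lp ℝ 2 (volume : Measure T2) := u.1.fst

/-- The weak gradient of an element of `H¹`. -/
def H1.grad (u : H1) : Lp Plane 2 (volume : Measure T2) := u.1.snd

theorem memLp_gradient {f : T2 → ℝ} (hf : IsSmooth f) :
    MemLp (fun x => (WithLp.toLp 2 (fun i => pderiv i f x) : Plane)) 2 volume := by
  have hc : Continuous (fun x => (WithLp.toLp 2 (fun i => pderiv i f x) : Plane)) :=
    (PiLp.continuous_toLp 2 _).comp (continuous_pi fun i => (hf.pderiv i).continuous)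
  obtain ⟨C, hC⟩ := isCompact_univ.exists_bound_of_continuousOn hc.continuousOn
  exact MemLp.of_bound hc.aestronglyMeasurable C (Filter.Eventually.of_forall fun x => hC x trivial)

/-- A smooth function, as an element of `H¹`. -/
def H1.ofSmooth (f : T2 → ℝ) (hf : IsSmooth f) : H1 :=
  ⟨WithLp.toLp 2 ((memLp_of_continuous hf.continuous 2).toLp f, (memLp_gradient hf).toLp _), by
    intro i η hη
    have h1 : ∫ x, (memLp_of_continuous hf.continuous 2).toLp f x * pderiv i η x
        = ∫ x, f x * pderiv i η x := by
      apply integral_congr_ae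
      filter_upwards [(memLp_of_continuous hf.continuous 2).coeFn_toLp] with x hx
      rw [hx]
    have h2 : ∫ x, (memLp_gradient hf).toLp _ x i * η x = ∫ x, pderiv i f x * η x := by
      apply integral_congr_ae
      filter_upwards [(memLp_gradient hf).coeFn_toLp] with x hx
      rw [hx]
    exact h1.trans ((integral_mul_pderiv hf hη i).trans (congrArg Neg.neg h2.symm))⟩

/-- `H⁻¹(𝕋²)`: the topological dual of `H¹(𝕋²)` with its dual norm. -/
abbrev Hneg1 : Type := StrongDual ℝ H1

/-- The total mass `∫ ρ` of `ρ ∈ H⁻¹`: the duality pairing of `ρ` with the constant function `1`. -/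
def Hneg1.mass (ρ : Hneg1) : ℝ := ρ (H1.ofSmooth (fun _ => 1) (isSmooth_const 1))

/-- The constant density `1`, as an element of `H⁻¹`: the functional `u ↦ ∫ u`. -/
def Hneg1.one : Hneg1 :=
  LinearMap.mkContinuous
    { toFun := fun u : H1 => ∫ x, u.fn x
      map_add' := by
        intro u v
        rw [← integral_add ((Lp.memLp u.fn).integrable one_le_two)
          ((Lp.memLp v.fn).integrable one_le_two)]
        exact integral_congr_ae (Lp.coeFn_add u.fn v.fn)
      map_smul' := by
        intro c u
        simp only [RingHom.id_apply, smul_eq_mul]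
        rw [← integral_const_mul]
        exact integral_congr_ae (Lp.coeFn_smul c u.fn) } 1 (by
    intro u
    have h1 : ‖∫ x, u.fn x‖ ≤ ‖u.fn‖ := by
      rw [Lp.norm_def]
      refine (norm_integral_le_lintegral_norm _).trans ?_
      refine ENNReal.toReal_mono (Lp.memLp u.fn).eLpNorm_ne_top ?_
      refine le_trans (le_of_eq ?_) (eLpNorm_le_eLpNorm_of_exponent_le (p := 1)
        one_le_two (Lp.memLp u.fn).aestronglyMeasurable)
      rw [eLpNorm_one_eq_lintegral_enorm]
      simp_rw [ofReal_norm]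
    have h2 : ‖u.fn‖ ≤ ‖u‖ := WithLp.norm_fst_le _ u.1
    simpa using h1.trans h2)

/-- `ρ ∈ H⁻¹` is (as a distribution) the function `r`. -/
def Hneg1.IsRepresentedBy (ρ : Hneg1) (r : T2 → ℝ) : Prop :=
  ∀ (η : T2 → ℝ) (hη : IsSmooth η), ρ (H1.ofSmooth η hη) = ∫ x, r x * η x

/-! ### The Poisson–Boltzmann equation -/

/-- `φ ∈ H¹` is a weak solution of `-δ² Δφ = e^{-φ} - ρ`, for `ρ ∈ H⁻¹`: for all `ψ ∈ H¹` the
product `e^{-φ} ψ` is integrable and `δ² ∫ ∇φ·∇ψ = ∫ e^{-φ} ψ - ⟨ρ, ψ⟩`. -/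
def IsWeakSolution (δ : ℝ) (ρ : Hneg1) (φ : H1) : Prop :=
  ∀ ψ : H1, Integrable (fun x => Real.exp (-φ.fn x) * ψ.fn x) ∧
    δ ^ 2 * ∫ x, inner ℝ (φ.grad x) (ψ.grad x) = (∫ x, Real.exp (-φ.fn x) * ψ.fn x) - ρ ψ

/-- `2 × 2` matrices with the Frobenius norm, in which Hessians take their values. -/
abbrev Mat2 : Type := EuclideanSpace ℝ (Fin 2 × Fin 2)

/-- `H` is the weak Hessian of `f` on the torus: `∫ f ∂ᵢ∂ⱼη = ∫ Hᵢⱼ η` for all smooth `η`. -/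
def IsWeakHessian (f : T2 → ℝ) (H : T2 → Mat2) : Prop :=
  ∀ (i j : Fin 2) (η : T2 → ℝ), IsSmooth η →
    ∫ x, f x * pderiv i (pderiv j η) x = ∫ x, H x (i, j) * η x

end PoissonBoltzmann

end

/-!
The solution is the minimizer over `H¹` of the free energy `δ²/2 ∫ |∇φ|² + ∫ e^{-φ} + ⟨ρ, φ⟩`. As
`ρ` has mass `1`, the Poincaré inequality and Jensen's inequality bound it below by
`|∫ φ| + δ²/2 ‖∇φ‖² - C ‖ρ - 1‖ ‖∇φ‖`; uniform convexity in the gradient makes the gradients of a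
minimizing sequence converge, and Fatou's lemma handles the exponential
(`exists_isMin_freeEnergy`). The Euler–Lagrange equation is first obtained for smooth test
functions. It extends to `H¹` since the nonnegative density `e^{-φ}` then is a functional in `H⁻¹`,
which is bounded on `|η|` as on `η` (`integrable_mul_and_integral_eq`). Uniqueness, the unit mass
and the energy estimate follow from testing with the difference of two solutions, with `1` and with
the solution, by the monotonicity of `e^{-φ}` in `φ`.

For the Lebesgue norms, the test function is the power `q - 1` of the truncated density
`1 / (e^φ + ε)`. It is a decreasing function of `φ`, so that the gradient term has a sign
(`integral_exp_neg_mul_le`), and Hölder's inequality bounds the truncated density in `L^q` by `ρ`.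
The exponent `∞` is a limit of finite ones.

For the second derivatives, `e^{-φ}` is now known to be in `Lᵖ`, and the claims reduce to the
Poisson equation `-Δu = g` with `g ∈ Lᵖ` of mean zero (`exists_poisson_solution`), that is to the
Calderón–Zygmund inequality on the torus. It is proved here for real trigonometric polynomials, as
follows. A real trigonometric polynomial and its Hilbert transform in a direction `θ` are the real
and the imaginary part of a trigonometric polynomial with frequencies in a half plane. Translation
along `iθ` contracts such a polynomial to its mean, so its distribution satisfies a mean value
inequality for subharmonic functions of the plane (`le_integral_of_subharmonic`). For functions
comparing `|z|ᵖ` with `|Re z|ᵖ` this gives the `Lᵖ` bound of the directional Hilbert transforms. The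
Riesz transforms are averages of these over all directions, and second derivatives are products of
two Riesz transforms of the Laplacian. The sup norm of a mean-zero function on a two-dimensional
torus is bounded by the `L¹` norms of its second derivatives. Density of trigonometric polynomials
in `Lᵖ` and in `H¹` concludes. The Poincaré inequality used above is the case `p = 2`.
-/

noncomputable section

namespace PoissonBoltzmann

/-! ### Real trigonometric polynomials -/

/-- Frequencies of characters of the torus. -/
abbrev Freq : Type := Fin 2 → ℤ

/-- The phase `k · y` of the frequency `k` at the point `y` of the plane. -/
def phase (k : Freq) (y : Fin 2 → ℝ) : ℝ := ∑ i, (k i : ℝ) * y i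

theorem mFourier_proj (k : Freq) (y : Fin 2 → ℝ) :
    UnitAddTorus.mFourier k (proj y) = Complex.exp (2 * Real.pi * phase k y * Complex.I) := by
  simp only [UnitAddTorus.mFourier, proj, ContinuousMap.coe_mk, fourier_coe_apply, phase,
    Fin.prod_univ_two, Fin.sum_univ_two, ← Complex.exp_add]
  congr 1
  push_cast
  ring

theorem mFourier_add_right (k : Freq) (x y : T2) :
    UnitAddTorus.mFourier k (x + y) = UnitAddTorus.mFourier k x * UnitAddTorus.mFourier k y := by
  simp [UnitAddTorus.mFourier, Fin.prod_univ_two, fourier_apply, smul_add, AddCircle.toCircle_add]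
  ring

/-- The real-linear map `a ↦ Re (a eₖ)`. -/
def realChar (k : Freq) : ℂ →ₗ[ℝ] C(T2, ℝ) where
  toFun a := ⟨fun x => (a * UnitAddTorus.mFourier k x).re,
    Complex.continuous_re.comp (continuous_const.mul (UnitAddTorus.mFourier k).continuous)⟩
  map_add' a b := by ext x; simp [add_mul]
  map_smul' r a := by ext x; simp [mul_sub, mul_assoc]

/-- The trigonometric polynomial `Re ∑ₖ cₖ eₖ`. The coefficients need not be Hermitian
symmetric: taking the real part makes every finitely supported family admissible. -/
def trig : (Freq →₀ ℂ) →ₗ[ℝ] C(T2, ℝ) := Finsupp.lsum ℝ realChar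

theorem trig_single (k : Freq) (a : ℂ) (x : T2) :
    trig (Finsupp.single k a) x = (a * UnitAddTorus.mFourier k x).re := by
  rw [trig, Finsupp.lsum_single]
  rfl

theorem trig_apply (c : Freq →₀ ℂ) (x : T2) :
    trig c x = (∑ k ∈ c.support, c k * UnitAddTorus.mFourier k x).re := by
  simp [trig, realChar, Finsupp.sum, ContinuousMap.sum_apply]

/-- The Fourier multiplier with symbol `m`, acting on coefficients. -/
def mult (m : Freq → ℂ) : (Freq →₀ ℂ) →ₗ[ℝ] (Freq →₀ ℂ) where
  toFun c := Finsupp.onFinset c.support (fun k => m k * c k) fun k hk => by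
    rw [Finsupp.mem_support_iff]
    exact right_ne_zero_of_mul hk
  map_add' c d := by ext k; simp [mul_add]
  map_smul' r c := by ext k; simp; ring

theorem mult_apply (m : Freq → ℂ) (c : Freq →₀ ℂ) (k : Freq) : mult m c k = m k * c k := rfl

theorem mult_single (m : Freq → ℂ) (k : Freq) (a : ℂ) :
    mult m (Finsupp.single k a) = Finsupp.single k (m k * a) := by
  ext j
  rw [mult_apply]
  by_cases h : k = j
  · subst h; simp
  · simp [h]

theorem mult_mult (m n : Freq → ℂ) (c : Freq →₀ ℂ) : mult m (mult n c) = mult (m * n) c := by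
  ext k
  simp [mult_apply, mul_assoc]

/-- The symbol `2πi kᵢ` of the partial derivative `∂ᵢ`. -/
def derivSymbol (i : Fin 2) (k : Freq) : ℂ := 2 * Real.pi * Complex.I * k i

theorem trig_isSmooth (c : Freq →₀ ℂ) : IsSmooth (trig c) := by
  induction c using Finsupp.induction_linear with
  | zero => rw [map_zero]; exact isSmooth_const 0
  | add f g hf hg =>
    rw [map_add]
    exact ContDiff.add hf hg
  | single k a =>
    unfold IsSmooth
    simp only [trig_single, mFourier_proj, phase, Fin.sum_univ_two]
    have : ContDiff ℝ ∞ fun y : Fin 2 → ℝ => a * Complex.exp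
        (2 * Real.pi * (((k 0 : ℝ) * y 0 + (k 1 : ℝ) * y 1 : ℝ) : ℂ) * Complex.I) := by
      refine contDiff_const.mul (ContDiff.cexp ?_)
      refine (contDiff_const.mul (Complex.ofRealCLM.contDiff.comp ?_)).mul contDiff_const
      exact (contDiff_const.mul (contDiff_apply ℝ ℝ 0)).add
        (contDiff_const.mul (contDiff_apply ℝ ℝ 1))
    exact Complex.reCLM.contDiff.comp this

theorem phase_single (k : Freq) (i : Fin 2) (t : ℝ) :
    phase k (t • Pi.single i (1 : ℝ)) = k i * t := by
  simp [phase, Pi.single_apply]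

theorem pderiv_add {f g : T2 → ℝ} (hf : IsSmooth f) (hg : IsSmooth g) (i : Fin 2) :
    pderiv i (f + g) = pderiv i f + pderiv i g := by
  funext x
  have h1 := hf.hasDerivAt i x 0
  have h2 := hg.hasDerivAt i x 0
  have h := (h1.add h2).deriv
  simp only [AddCircle.coe_zero, Pi.single_zero, add_zero] at h
  exact h

theorem pderiv_trig (i : Fin 2) (c : Freq →₀ ℂ) :
    pderiv i (trig c) = trig (mult (derivSymbol i) c) := by
  induction c using Finsupp.induction_linear with
  | zero => funext x; simp [pderiv]
  | add f g hf hg =>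
    rw [map_add, map_add, map_add, ContinuousMap.coe_add, ContinuousMap.coe_add, ← hf, ← hg]
    exact pderiv_add (trig_isSmooth f) (trig_isSmooth g) i
  | single k a =>
    funext x
    rw [mult_single, trig_single]
    unfold pderiv
    obtain ⟨y, rfl⟩ := isOpenQuotientMap_proj.surjective x
    have h0 : ∀ t : ℝ, trig (Finsupp.single k a) (proj y + Pi.single i (t : UnitAddCircle))
        = (a * UnitAddTorus.mFourier k (proj y) * Complex.exp (derivSymbol i k * t)).re := by
      intro t
      have : (Pi.single i (t : UnitAddCircle) : T2) = proj (t • Pi.single i (1 : ℝ)) := by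
        have := proj_add_single 0 i t
        rw [zero_add] at this
        rw [← this]
        have h00 : proj 0 = 0 := by funext j; simp [proj]
        rw [h00, zero_add]
      rw [trig_single, mFourier_add_right, this, mFourier_proj k (t • _), phase_single, derivSymbol,
        mul_assoc a]
      congr 4
      push_cast
      ring
    simp only [h0]
    have h1 : HasDerivAt (fun t : ℝ => a * UnitAddTorus.mFourier k (proj y) *
        Complex.exp (derivSymbol i k * t))
        (a * UnitAddTorus.mFourier k (proj y) * (Complex.exp (derivSymbol i k * (0 : ℝ))
          * (derivSymbol i k * 1))) 0 :=
      (((Complex.ofRealCLM.hasDerivAt (x := (0 : ℝ))).const_mul (derivSymbol i k)).cexp).const_mul _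
    have h2 := (Complex.reCLM.hasFDerivAt.comp_hasDerivAt (0 : ℝ) h1).deriv
    refine h2.trans ?_
    simp only [Complex.ofReal_zero, mul_zero, Complex.exp_zero, Complex.reCLM_apply]
    congr 1
    ring

/-! ### Pairing of Lebesgue functions with bounded ones -/

theorem integral_norm_le_eLpNorm {E : Type*} [NormedAddCommGroup E] {p : ℝ≥0∞} (hp : 1 ≤ p)
    {f : T2 → E} (hf : MemLp f p volume) : ∫ x, ‖f x‖ ≤ (eLpNorm f p volume).toReal := by
  rw [integral_norm_eq_lintegral_enorm hf.aestronglyMeasurable, ← eLpNorm_one_eq_lintegral_enorm]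
  exact ENNReal.toReal_mono hf.eLpNorm_ne_top
    (eLpNorm_le_eLpNorm_of_exponent_le hp hf.aestronglyMeasurable)

theorem integrable_mul_continuous {p : ℝ≥0∞} (hp : 1 ≤ p) {f : T2 → ℝ} (hf : MemLp f p volume)
    {h : T2 → ℝ} (hh : Continuous h) : Integrable (fun x => f x * h x) := by
  obtain ⟨C, hC⟩ := isCompact_univ.exists_bound_of_continuousOn hh.continuousOn
  exact (hf.integrable hp).mul_bdd (c := C) hh.aestronglyMeasurable
    (Filter.Eventually.of_forall fun x => hC x trivial)

/-- The continuous linear functional `f ↦ ∫ f h` on `Lᵖ`, for a continuous `h`. -/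
def pairing (p : ℝ≥0∞) [Fact (1 ≤ p)] (h : C(T2, ℝ)) : Lp ℝ p (volume : Measure T2) →L[ℝ] ℝ :=
  LinearMap.mkContinuous
    { toFun := fun f => ∫ x, f x * h x
      map_add' := by
        intro u v
        rw [← integral_add (integrable_mul_continuous Fact.out (Lp.memLp u) h.continuous)
          (integrable_mul_continuous Fact.out (Lp.memLp v) h.continuous)]
        apply integral_congr_ae
        filter_upwards [Lp.coeFn_add u v] with x hx
        rw [hx, Pi.add_apply, add_mul]
      map_smul' := by
        intro c u
        simp only [RingHom.id_apply, smul_eq_mul]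
        rw [← integral_const_mul]
        apply integral_congr_ae
        filter_upwards [Lp.coeFn_smul c u] with x hx
        rw [hx, Pi.smul_apply, smul_eq_mul, mul_assoc] } ‖h‖ (by
    intro u
    simp only [LinearMap.coe_mk, AddHom.coe_mk]
    have h1 : ‖∫ x, u x * h x‖ ≤ ∫ x, ‖u x‖ * ‖h‖ := by
      refine norm_integral_le_of_norm_le (((Lp.memLp u).integrable Fact.out).norm.mul_const _)
        (Filter.Eventually.of_forall fun x => ?_)
      rw [norm_mul]
      exact mul_le_mul_of_nonneg_left (h.norm_coe_le_norm x) (norm_nonneg _)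
    rw [integral_mul_const] at h1
    rw [mul_comm]
    refine h1.trans (mul_le_mul_of_nonneg_right ?_ (norm_nonneg _))
    rw [Lp.norm_def]
    exact integral_norm_le_eLpNorm Fact.out (Lp.memLp u))

theorem pairing_apply (p : ℝ≥0∞) [Fact (1 ≤ p)] (h : C(T2, ℝ)) (f : Lp ℝ p (volume : Measure T2)) :
    pairing p h f = ∫ x, f x * h x := rfl

/-- The `j`-th component of a vector-valued `Lᵖ` function. -/
def compLp {ι : Type} [Fintype ι] (p : ℝ≥0∞) [Fact (1 ≤ p)] (j : ι) :
    Lp (EuclideanSpace ℝ ι) p (volume : Measure T2) →L[ℝ] Lp ℝ p (volume : Measure T2) :=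
  (EuclideanSpace.proj j : EuclideanSpace ℝ ι →L[ℝ] ℝ).compLpL p volume

theorem coeFn_compLp {ι : Type} [Fintype ι] (p : ℝ≥0∞) [Fact (1 ≤ p)] (j : ι)
    (f : Lp (EuclideanSpace ℝ ι) p (volume : Measure T2)) :
    compLp p j f =ᵐ[volume] fun x => f x j :=
  ContinuousLinearMap.coeFn_compLp _ f

theorem pairing_compLp {ι : Type} [Fintype ι] (p : ℝ≥0∞) [Fact (1 ≤ p)] (j : ι) (h : C(T2, ℝ))
    (f : Lp (EuclideanSpace ℝ ι) p (volume : Measure T2)) :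
    pairing p h (compLp p j f) = ∫ x, f x j * h x := by
  rw [pairing_apply]
  apply integral_congr_ae
  filter_upwards [coeFn_compLp p j f] with x hx
  rw [hx]

/-! ### Completeness of `H¹` -/

/-- The map `u ↦ u` from `H¹` to `L²`. -/
def fnL : H1 →L[ℝ] Lp ℝ 2 (volume : Measure T2) :=
  (WithLp.fstL 2 ℝ _ _).comp sobolevH1.subtypeL

/-- The map `u ↦ ∇u` from `H¹` to `L²`. -/
def gradL : H1 →L[ℝ] Lp Plane 2 (volume : Measure T2) :=
  (WithLp.sndL 2 ℝ _ _).comp sobolevH1.subtypeL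

theorem fnL_apply (u : H1) : fnL u = u.fn := rfl
theorem gradL_apply (u : H1) : gradL u = u.grad := rfl

theorem isClosed_sobolevH1 : IsClosed (sobolevH1 : Set (WithLp 2
    (Lp ℝ 2 (volume : Measure T2) × Lp Plane 2 (volume : Measure T2)))) := by
  have : (sobolevH1 : Set (WithLp 2
      (Lp ℝ 2 (volume : Measure T2) × Lp Plane 2 (volume : Measure T2)))) =
      ⋂ (i : Fin 2) (η : T2 → ℝ) (hη : IsSmooth η),
      {u | pairing 2 ⟨pderiv i η, (hη.pderiv i).continuous⟩ u.fst
        = - pairing 2 ⟨η, hη.continuous⟩ (compLp 2 i u.snd)} := by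
    ext u
    simp only [Set.mem_iInter, Set.mem_ofPred_eq]
    exact forall_congr' fun i => forall_congr' fun η => forall_congr' fun hη => by
      rw [pairing_compLp]; rfl
  rw [this]
  refine isClosed_iInter fun i => isClosed_iInter fun η => isClosed_iInter fun hη => ?_
  refine isClosed_eq ?_ ?_
  · exact (pairing 2 _).continuous.comp (WithLp.fstL 2 ℝ _ _).continuous
  · exact ((pairing 2 _).continuous.comp
      ((compLp 2 i).continuous.comp (WithLp.sndL 2 ℝ _ _).continuous)).neg

instance completeSpace_H1 : CompleteSpace H1 := isClosed_sobolevH1.completeSpace_coe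

/-! ### Density of trigonometric polynomials -/

/-- Uniform density, by taking real parts in the density of complex trigonometric polynomials. -/
theorem denseRange_trig : DenseRange trig := by
  intro h
  rw [Metric.mem_closure_iff]
  intro ε hε
  let hc : C(T2, ℂ) := ⟨fun x => (h x : ℂ), Complex.continuous_ofReal.comp h.continuous⟩
  have hmem : hc ∈ (Submodule.span ℂ
      (Set.range <| UnitAddTorus.mFourier (d := Fin 2))).topologicalClosure := by
    rw [UnitAddTorus.span_mFourier_closure_eq_top]; trivial
  obtain ⟨P, hP, hd⟩ := Metric.mem_closure_iff.1 hmem ε hε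
  obtain ⟨c, rfl⟩ := (Finsupp.mem_span_range_iff_exists_finsupp).1 hP
  refine ⟨_, ⟨c, rfl⟩, lt_of_le_of_lt ?_ hd⟩
  rw [dist_eq_norm, dist_eq_norm, ContinuousMap.norm_le _ (norm_nonneg _)]
  intro x
  refine le_trans ?_ (ContinuousMap.norm_coe_le_norm _ x)
  refine le_trans (le_of_eq ?_) (Complex.abs_re_le_norm _)
  rw [Real.norm_eq_abs]
  congr 1
  simp [trig_apply, hc, Finsupp.sum, ContinuousMap.sum_apply]

/-- A trigonometric polynomial as an element of `Lᵖ`. -/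
def trigLp (p : ℝ≥0∞) [Fact (1 ≤ p)] : (Freq →₀ ℂ) →ₗ[ℝ] Lp ℝ p (volume : Measure T2) :=
  (ContinuousMap.toLp p volume ℝ).toLinearMap.comp trig

theorem trigLp_apply (p : ℝ≥0∞) [Fact (1 ≤ p)] (c : Freq →₀ ℂ) :
    trigLp p c = ContinuousMap.toLp p volume ℝ (trig c) := rfl

theorem coeFn_trigLp (p : ℝ≥0∞) [Fact (1 ≤ p)] (c : Freq →₀ ℂ) :
    trigLp p c =ᵐ[volume] trig c := ContinuousMap.coeFn_toLp volume (trig c)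

theorem denseRange_trigLp {p : ℝ≥0∞} [Fact (1 ≤ p)] (hp : p ≠ ⊤) : DenseRange (trigLp p) :=
  (ContinuousMap.toLp_denseRange ℝ (volume : Measure T2) ℝ hp).comp denseRange_trig
    (ContinuousMap.toLp p volume ℝ).continuous

/-- The squared modulus `|k|²` of a frequency. -/
def freqSq (k : Freq) : ℝ := (k 0 : ℝ) ^ 2 + (k 1 : ℝ) ^ 2

theorem freqSq_pos {k : Freq} (hk : k ≠ 0) : 0 < freqSq k := by
  unfold freqSq
  by_contra h
  apply hk
  have h0 : (k 0 : ℝ) = 0 := by nlinarith [sq_nonneg (k 0 : ℝ), sq_nonneg (k 1 : ℝ)]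
  have h1 : (k 1 : ℝ) = 0 := by nlinarith [sq_nonneg (k 0 : ℝ), sq_nonneg (k 1 : ℝ)]
  funext i
  fin_cases i
  · exact_mod_cast h0
  · exact_mod_cast h1

/-- The symbol of the projection onto mean-zero functions. -/
def meanZeroSymbol (k : Freq) : ℂ := if k = 0 then 0 else 1

/-- The symbol `1 / (4π²|k|²)` of `(-Δ)⁻¹` on mean-zero functions; its value at `0` is `0`. -/
def invLapSymbol (k : Freq) : ℂ := (4 * Real.pi ^ 2 * freqSq k : ℝ)⁻¹

theorem derivSymbol_sq_mul_invLapSymbol :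
    derivSymbol 0 * (derivSymbol 0 * invLapSymbol) + derivSymbol 1 * (derivSymbol 1 * invLapSymbol)
      = -meanZeroSymbol := by
  funext k
  simp only [Pi.add_apply, Pi.mul_apply, Pi.neg_apply, derivSymbol, invLapSymbol, meanZeroSymbol]
  split_ifs with hk
  · subst hk; simp
  · have h : (freqSq k : ℂ) ≠ 0 := by exact_mod_cast (freqSq_pos hk).ne'
    have hpi : (Real.pi : ℂ) ≠ 0 := by exact_mod_cast Real.pi_ne_zero
    have h2 : (freqSq k : ℂ) = (k 0 : ℂ) ^ 2 + (k 1 : ℂ) ^ 2 := by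
      simp [freqSq]
    push_cast
    field_simp
    rw [h2, Complex.I_sq]
    ring

theorem mult_add (m n : Freq → ℂ) (c : Freq →₀ ℂ) : mult (m + n) c = mult m c + mult n c := by
  ext k; simp [mult_apply, add_mul]

theorem mult_neg (m : Freq → ℂ) (c : Freq →₀ ℂ) : mult (-m) c = -mult m c := by
  ext k; simp [mult_apply]

/-- A mean-zero trigonometric polynomial is a Laplacian, hence has zero integral. -/
theorem integral_trig_meanZero (c : Freq →₀ ℂ) : ∫ x, trig (mult meanZeroSymbol c) x = 0 := by
  have h0 := integral_pderiv (trig_isSmooth (mult (derivSymbol 0 * invLapSymbol) c)) 0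
  have h1 := integral_pderiv (trig_isSmooth (mult (derivSymbol 1 * invLapSymbol) c)) 1
  rw [pderiv_trig, mult_mult] at h0 h1
  have h : trig (mult meanZeroSymbol c) =
      -(trig (mult (derivSymbol 0 * (derivSymbol 0 * invLapSymbol)) c)
        + trig (mult (derivSymbol 1 * (derivSymbol 1 * invLapSymbol)) c)) := by
    rw [← map_add, ← mult_add, derivSymbol_sq_mul_invLapSymbol, mult_neg, map_neg, neg_neg]
  have hi : ∀ d, Integrable (trig d) volume := fun d =>
    (memLp_of_continuous (trig d).continuous 1).integrable le_rfl
  rw [h]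
  simp only [ContinuousMap.neg_apply, ContinuousMap.add_apply]
  rw [integral_neg, integral_add (hi _) (hi _), h0, h1]
  simp

theorem trig_meanZero (c : Freq →₀ ℂ) :
    trig (mult meanZeroSymbol c) = trig c - ContinuousMap.const T2 (∫ x, trig c x) := by
  have h1 : c = mult meanZeroSymbol c + Finsupp.single 0 (c 0) := by
    ext k
    by_cases hk : k = 0
    · subst hk; simp [mult_apply, meanZeroSymbol]
    · simp [mult_apply, meanZeroSymbol, hk]
  have h2 : ∀ x, trig c x = trig (mult meanZeroSymbol c) x + (c 0).re := by
    intro x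
    conv_lhs => rw [h1]
    rw [map_add, ContinuousMap.add_apply, trig_single, UnitAddTorus.mFourier_zero]
    simp
  have h3 : ∫ x, trig c x = (c 0).re := by
    simp_rw [h2]
    rw [integral_add ((memLp_of_continuous (trig _).continuous 1).integrable le_rfl)
      (integrable_const _), integral_trig_meanZero]
    simp
  ext x
  simp [h3, h2 x]

/-- Mean-zero functions are limits of mean-zero trigonometric polynomials: subtract the mean from
any approximation. -/
theorem mem_closure_trigLp_meanZero {p : ℝ≥0∞} [Fact (1 ≤ p)] (hp : p ≠ ⊤)
    (g : Lp ℝ p (volume : Measure T2)) (hg : ∫ x, g x = 0) :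
    g ∈ closure (Set.range fun c => trigLp p (mult meanZeroSymbol c)) := by
  let Q : Lp ℝ p (volume : Measure T2) → Lp ℝ p (volume : Measure T2) := fun f =>
    f - ContinuousMap.toLp p volume ℝ (ContinuousMap.const T2 (pairing p 1 f))
  have hQ : Continuous Q := by
    refine continuous_id.sub ((ContinuousMap.toLp p volume ℝ).continuous.comp ?_)
    exact ContinuousMap.continuous_const'.comp (pairing p 1).continuous
  have h1 : Q g = g := by
    have : pairing p 1 g = 0 := by simpa [pairing_apply] using hg
    have h0 : ContinuousMap.const T2 (0 : ℝ) = 0 := rfl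
    simp only [Q, this, h0, map_zero, sub_zero]
  have h2 : ∀ c, Q (trigLp p c) = trigLp p (mult meanZeroSymbol c) := by
    intro c
    have : pairing p 1 (trigLp p c) = ∫ x, trig c x := by
      rw [pairing_apply]
      apply integral_congr_ae
      filter_upwards [coeFn_trigLp p c] with x hx
      simp [hx]
    simp only [Q, this]
    simp only [trigLp_apply, trig_meanZero, map_sub]
  rw [← h1]
  refine closure_mono ?_ (image_closure_subset_closure_image hQ
    (Set.mem_image_of_mem Q (denseRange_trigLp hp g)))
  rintro _ ⟨_, ⟨c, rfl⟩, rfl⟩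
  exact ⟨c, (h2 c).symm⟩

theorem eq_zero_of_integral_trig (f : Lp ℝ 2 (volume : Measure T2))
    (h : ∀ c, ∫ x, f x * trig c x = 0) : f = 0 := by
  have h1 : ∀ g : Lp ℝ 2 (volume : Measure T2), inner ℝ f g = 0 := by
    have hc : IsClosed {g : Lp ℝ 2 (volume : Measure T2) | inner ℝ f g = 0} :=
      isClosed_eq (by fun_prop) continuous_const
    intro g
    refine (hc.closure_subset_iff.2 ?_) (denseRange_trigLp (by simp) g)
    rintro _ ⟨c, rfl⟩
    show inner ℝ f _ = 0
    rw [L2.inner_def, ← h c]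
    apply integral_congr_ae
    filter_upwards [coeFn_trigLp 2 c] with x hx
    simp [hx, mul_comm]
  exact inner_self_eq_zero.1 (h1 f)

/-! ### Smooth functions in `H¹` -/

theorem H1.ext_fn_grad {u v : H1} (h1 : u.fn = v.fn) (h2 : u.grad = v.grad) : u = v :=
  Subtype.ext (WithLp.ofLp_injective 2 (Prod.ext h1 h2))

theorem coeFn_fn_ofSmooth {f : T2 → ℝ} (hf : IsSmooth f) :
    (H1.ofSmooth f hf).fn =ᵐ[volume] f := (memLp_of_continuous hf.continuous 2).coeFn_toLp

theorem coeFn_grad_ofSmooth {f : T2 → ℝ} (hf : IsSmooth f) :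
    (H1.ofSmooth f hf).grad =ᵐ[volume] fun x => WithLp.toLp 2 fun i => pderiv i f x :=
  (memLp_gradient hf).coeFn_toLp

theorem coeFn_grad_ofSmooth_apply {f : T2 → ℝ} (hf : IsSmooth f) (i : Fin 2) :
    (fun x => (H1.ofSmooth f hf).grad x i) =ᵐ[volume] pderiv i f := by
  filter_upwards [coeFn_grad_ofSmooth hf] with x hx
  rw [hx]

/-- Trigonometric polynomials as elements of `H¹`. -/
def trigH1 : (Freq →₀ ℂ) →ₗ[ℝ] H1 where
  toFun c := H1.ofSmooth (trig c) (trig_isSmooth c)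
  map_add' c d := by
    apply H1.ext_fn_grad
    · apply Lp.ext
      refine (coeFn_fn_ofSmooth _).trans ?_
      refine Filter.EventuallyEq.trans ?_ (Lp.coeFn_add _ _).symm
      filter_upwards [coeFn_fn_ofSmooth (trig_isSmooth c), coeFn_fn_ofSmooth (trig_isSmooth d)]
        with x h1 h2
      erw [Pi.add_apply, h1, h2, map_add]
      rfl
    · apply Lp.ext
      refine (coeFn_grad_ofSmooth _).trans ?_
      refine Filter.EventuallyEq.trans ?_ (Lp.coeFn_add _ _).symm
      filter_upwards [coeFn_grad_ofSmooth (trig_isSmooth c),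
        coeFn_grad_ofSmooth (trig_isSmooth d)] with x h1 h2
      erw [Pi.add_apply, h1, h2]
      ext i
      change pderiv i (trig (c + d)) x = pderiv i (trig c) x + pderiv i (trig d) x
      rw [pderiv_trig, pderiv_trig, pderiv_trig, map_add, map_add]
      rfl
  map_smul' r c := by
    apply H1.ext_fn_grad
    · apply Lp.ext
      refine (coeFn_fn_ofSmooth _).trans ?_
      refine Filter.EventuallyEq.trans ?_ (Lp.coeFn_smul _ _).symm
      filter_upwards [coeFn_fn_ofSmooth (trig_isSmooth c)] with x h1
      erw [Pi.smul_apply, h1, map_smul]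
      rfl
    · apply Lp.ext
      refine (coeFn_grad_ofSmooth _).trans ?_
      refine Filter.EventuallyEq.trans ?_ (Lp.coeFn_smul _ _).symm
      filter_upwards [coeFn_grad_ofSmooth (trig_isSmooth c)] with x h1
      erw [Pi.smul_apply, h1]
      ext i
      change pderiv i (trig (r • c)) x = r * pderiv i (trig c) x
      rw [pderiv_trig, pderiv_trig, map_smul, map_smul]
      rfl

theorem trigH1_apply (c : Freq →₀ ℂ) : trigH1 c = H1.ofSmooth (trig c) (trig_isSmooth c) := rfl

theorem H1.inner_eq (u v : H1) : inner ℝ u v = inner ℝ u.fn v.fn + inner ℝ u.grad v.grad := rfl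

theorem H1.norm_sq_eq (u : H1) : ‖u‖ ^ 2 = ‖u.fn‖ ^ 2 + ‖u.grad‖ ^ 2 := by
  rw [← real_inner_self_eq_norm_sq, ← real_inner_self_eq_norm_sq, ← real_inner_self_eq_norm_sq,
    H1.inner_eq]

theorem H1.norm_grad_le (u : H1) : ‖u.grad‖ ≤ ‖u‖ := by
  have := u.norm_sq_eq
  exact le_of_sq_le_sq (by nlinarith [sq_nonneg ‖u.fn‖]) (norm_nonneg _)

theorem H1.weakPartial (u : H1) (i : Fin 2) (η : T2 → ℝ) (hη : IsSmooth η) :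
    ∫ x, u.fn x * pderiv i η x = -∫ x, u.grad x i * η x := u.2 i η hη

theorem inner_grad_ofSmooth (u : H1) {η : T2 → ℝ} (hη : IsSmooth η) :
    inner ℝ u.grad (H1.ofSmooth η hη).grad
      = (∫ x, u.grad x 0 * pderiv 0 η x) + ∫ x, u.grad x 1 * pderiv 1 η x := by
  rw [L2.inner_def, ← integral_add
    (integrable_mul_smooth (memLp_coord (Lp.memLp _) 0) (hη.pderiv 0))
    (integrable_mul_smooth (memLp_coord (Lp.memLp _) 1) (hη.pderiv 1))]
  apply integral_congr_ae
  filter_upwards [coeFn_grad_ofSmooth hη] with x hx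
  rw [hx]
  simp [PiLp.inner_apply, Fin.sum_univ_two, mul_comm]

theorem inner_fn_ofSmooth (u : H1) {η : T2 → ℝ} (hη : IsSmooth η) :
    inner ℝ u.fn (H1.ofSmooth η hη).fn = ∫ x, u.fn x * η x := by
  rw [L2.inner_def]
  apply integral_congr_ae
  filter_upwards [coeFn_fn_ofSmooth hη] with x hx
  simp [hx, mul_comm]

/-- Trigonometric polynomials are dense in `H¹`: an element orthogonal to all of them satisfies
`∫ u (η - Δη) = 0` for every trigonometric polynomial `η`, and `1 - Δ` is onto on these. -/
theorem denseRange_trigH1 : DenseRange trigH1 := by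
  have key : (LinearMap.range trigH1)ᗮ = ⊥ := by
    rw [Submodule.eq_bot_iff]
    intro w hw
    have h1 : ∀ c, ∫ x, w.fn x * trig c x = 0 := by
      intro d
      -- `1 - Δ` is inverted on trigonometric polynomials.
      obtain ⟨c, hc⟩ : ∃ c, d = c - mult (derivSymbol 0 * derivSymbol 0) c
          - mult (derivSymbol 1 * derivSymbol 1) c := by
        refine ⟨mult (fun k => (1 + 4 * Real.pi ^ 2 * freqSq k : ℝ)⁻¹) d, ?_⟩
        ext k
        have hk : ((1 + 4 * Real.pi ^ 2 * freqSq k : ℝ) : ℂ) ≠ 0 := by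
          have : 0 ≤ freqSq k := by unfold freqSq; positivity
          exact_mod_cast (by positivity : (1 + 4 * Real.pi ^ 2 * freqSq k : ℝ) ≠ 0)
        have h2 : (freqSq k : ℂ) = (k 0 : ℂ) ^ 2 + (k 1 : ℂ) ^ 2 := by simp [freqSq]
        simp only [Finsupp.sub_apply, mult_apply, Pi.mul_apply, derivSymbol]
        push_cast at hk ⊢
        field_simp
        rw [Complex.I_sq, h2]
        ring
      have hw' := hw (trigH1 c) ⟨c, rfl⟩
      rw [real_inner_comm, H1.inner_eq, trigH1_apply, inner_fn_ofSmooth, inner_grad_ofSmooth] at hw'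
      have ha := w.weakPartial 0 _ ((trig_isSmooth c).pderiv 0)
      have hb := w.weakPartial 1 _ ((trig_isSmooth c).pderiv 1)
      simp only [pderiv_trig, mult_mult] at ha hb hw'
      have hi : ∀ e, Integrable (fun x => w.fn x * trig e x) := fun e =>
        integrable_mul_smooth (Lp.memLp _) (trig_isSmooth e)
      have hi2 : ∀ e e', Integrable (fun x => w.fn x * trig e x - w.fn x * trig e' x) :=
        fun e e' => (hi e).sub (hi e')
      rw [hc]
      simp only [map_sub, ContinuousMap.sub_apply, mul_sub]
      rw [integral_sub (hi2 _ _) (hi _), integral_sub (hi _) (hi _), ha, hb]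
      linarith
    have h2 : w.fn = 0 := eq_zero_of_integral_trig _ h1
    apply H1.ext_fn_grad h2
    have h3 : ∀ i, compLp 2 i w.grad = 0 := by
      intro i
      apply eq_zero_of_integral_trig
      intro c
      have ha := w.weakPartial i _ (trig_isSmooth c)
      rw [pderiv_trig, h1] at ha
      have := pairing_compLp 2 i (trig c) w.grad
      rw [pairing_apply] at this
      rw [this]
      linarith
    apply Lp.ext
    refine Filter.EventuallyEq.trans ?_ (Lp.coeFn_zero _ _ _).symm
    have h4 : ∀ i, (fun x => w.grad x i) =ᵐ[volume] 0 := fun i =>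
      (coeFn_compLp 2 i w.grad).symm.trans ((h3 i) ▸ Lp.coeFn_zero _ _ _)
    filter_upwards [h4 0, h4 1] with x h0 h1
    ext i
    fin_cases i
    · exact h0
    · exact h1
  have := Submodule.topologicalClosure_eq_top_iff.2 key
  exact Submodule.dense_iff_topologicalClosure_eq_top.2 this

/-! ### Integrals of subharmonic functions of analytic trigonometric polynomials -/

/-- Differentiation under the integral sign, for jointly continuous integrands on the torus. -/
theorem hasDerivAt_integral_of_continuous {F F' : ℝ → T2 → ℝ}
    (hF : Continuous (Function.uncurry F)) (hF' : Continuous (Function.uncurry F'))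
    (h : ∀ t x, HasDerivAt (fun t => F t x) (F' t x) t) (t₀ : ℝ) :
    HasDerivAt (fun t => ∫ x, F t x) (∫ x, F' t₀ x) t₀ := by
  obtain ⟨C, hC⟩ := ((isCompact_closedBall t₀ 1).prod
    (isCompact_univ (X := T2))).exists_bound_of_continuousOn hF'.continuousOn
  have hc : ∀ t, Continuous (F t) := fun t => hF.comp (Continuous.prodMk_right t)
  have hc' : ∀ t, Continuous (F' t) := fun t => hF'.comp (Continuous.prodMk_right t)
  refine (hasDerivAt_integral_of_dominated_loc_of_deriv_le (bound := fun _ => C)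
    (Metric.closedBall_mem_nhds t₀ one_pos)
    (Filter.Eventually.of_forall fun t => (hc t).aestronglyMeasurable)
    ((memLp_of_continuous (hc t₀) 1).integrable le_rfl) (hc' t₀).aestronglyMeasurable
    (Filter.Eventually.of_forall fun x t ht => hC (t, x) ⟨ht, trivial⟩) (integrable_const C)
    (Filter.Eventually.of_forall fun x t _ => h t x)).2

/-- The `n`-th derivative (up to a power of `i`) of `∑ₖ Aₖ(x) exp(i λₖ ζ)` at `ζ = t + is`. -/
def analyticSum {ι : Type} (S : Finset ι) (lam : ι → ℝ) (A : ι → C(T2, ℂ)) (n : ℕ) (t s : ℝ)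
    (x : T2) : ℂ :=
  ∑ k ∈ S, (lam k : ℂ) ^ n * Complex.exp ((t * Complex.I - s) * lam k) * A k x

section analyticSum

variable {ι : Type} (S : Finset ι) (lam : ι → ℝ) (A : ι → C(T2, ℂ))

theorem continuous_analyticSum (n : ℕ) {X : Type} [TopologicalSpace X] {a b : X → ℝ} {c : X → T2}
    (ha : Continuous a) (hb : Continuous b) (hc : Continuous c) :
    Continuous fun q => analyticSum S lam A n (a q) (b q) (c q) := by
  unfold analyticSum
  fun_prop

theorem hasDerivAt_analyticSum_left (n : ℕ) (t s : ℝ) (x : T2) :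
    HasDerivAt (fun t => analyticSum S lam A n t s x)
      (Complex.I * analyticSum S lam A (n + 1) t s x) t := by
  unfold analyticSum
  rw [Finset.mul_sum]
  refine HasDerivAt.fun_sum fun k _ => ?_
  have h1 : HasDerivAt (fun t : ℝ => ((t : ℂ) * Complex.I - s) * lam k) (1 * Complex.I * lam k) t :=
    (((Complex.ofRealCLM.hasDerivAt (x := t)).mul_const Complex.I).sub_const (s : ℂ)).mul_const _
  refine (((h1.cexp).const_mul ((lam k : ℂ) ^ n)).mul_const (A k x)).congr_deriv ?_
  ring

theorem hasDerivAt_analyticSum_right (n : ℕ) (t s : ℝ) (x : T2) :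
    HasDerivAt (fun s => analyticSum S lam A n t s x)
      (-analyticSum S lam A (n + 1) t s x) s := by
  unfold analyticSum
  rw [← Finset.sum_neg_distrib]
  refine HasDerivAt.fun_sum fun k _ => ?_
  have h1 : HasDerivAt (fun s : ℝ => ((t : ℂ) * Complex.I - s) * lam k) (-1 * lam k) s :=
    ((Complex.ofRealCLM.hasDerivAt (x := s)).const_sub _).mul_const _
  refine (((h1.cexp).const_mul ((lam k : ℂ) ^ n)).mul_const (A k x)).congr_deriv ?_
  ring

variable {S lam A}

theorem norm_analyticSum_le (hlam : ∀ k ∈ S, 0 < lam k) (n : ℕ) {s : ℝ} (hs : 0 ≤ s) (x : T2) :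
    ‖analyticSum S lam A n 0 s x‖ ≤ ∑ k ∈ S, lam k ^ n * ‖A k‖ := by
  refine norm_sum_le_of_le _ fun k hk => ?_
  rw [norm_mul, norm_mul, norm_pow, Complex.norm_real, Complex.norm_exp, Real.norm_eq_abs,
    abs_of_pos (hlam k hk)]
  have h1 : Real.exp ((((0 : ℝ) : ℂ) * Complex.I - s) * lam k).re ≤ 1 := by
    rw [Real.exp_le_one_iff]
    simp
    exact mul_nonneg hs (hlam k hk).le
  have h0 := pow_pos (hlam k hk) n
  have h2 := (A k).norm_coe_le_norm x
  nlinarith [mul_le_mul h1 h2 (norm_nonneg _) zero_le_one]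

theorem tendsto_analyticSum (hlam : ∀ k ∈ S, 0 < lam k) (n : ℕ) (x : T2) :
    Filter.Tendsto (fun s => analyticSum S lam A n 0 s x) Filter.atTop (nhds 0) := by
  have : (0 : ℂ) = ∑ k ∈ S, (lam k : ℂ) ^ n * 0 * A k x := by simp
  rw [this]
  refine tendsto_finsetSum _ fun k hk => (Filter.Tendsto.const_mul _ ?_).mul_const _
  rw [tendsto_zero_iff_norm_tendsto_zero]
  simp only [Complex.norm_exp]
  have h2 : ∀ s : ℝ, ((((0 : ℝ) : ℂ) * Complex.I - s) * lam k).re = -(lam k * s) := by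
    intro s; simp; ring
  simp only [h2]
  exact Real.tendsto_exp_neg_atTop_nhds_zero.comp
    (Filter.tendsto_id.const_mul_atTop (hlam k hk))

theorem tendsto_integral_analyticSum (hlam : ∀ k ∈ S, 0 < lam k) {G : ℂ × ℂ → ℝ}
    (hG : Continuous G) :
    Filter.Tendsto (fun s => ∫ x, G (analyticSum S lam A 0 0 s x, analyticSum S lam A 1 0 s x))
      Filter.atTop (nhds (G (0, 0))) := by
  obtain ⟨C, hC⟩ := ((isCompact_closedBall (0 : ℂ) (∑ k ∈ S, lam k ^ 0 * ‖A k‖)).prod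
    (isCompact_closedBall (0 : ℂ) (∑ k ∈ S, lam k ^ 1 * ‖A k‖))).exists_bound_of_continuousOn
    hG.continuousOn
  have h0 : G (0, 0) = ∫ _ : T2, G (0, 0) := by simp
  rw [h0]
  refine tendsto_integral_filter_of_dominated_convergence (fun _ => C) ?_ ?_ (integrable_const _) ?_
  · have hV : ∀ n s, Continuous fun x : T2 => analyticSum S lam A n 0 s x := fun n s =>
      continuous_analyticSum S lam A n continuous_const continuous_const continuous_id
    have hGV : ∀ s, Continuous fun x : T2 =>
        G (analyticSum S lam A 0 0 s x, analyticSum S lam A 1 0 s x) := fun s =>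
      hG.comp ((hV 0 s).prodMk (hV 1 s))
    exact Filter.Eventually.of_forall fun s => (hGV s).aestronglyMeasurable
  · filter_upwards [Filter.eventually_ge_atTop 0] with s hs
    refine Filter.Eventually.of_forall fun x => hC _ ⟨?_, ?_⟩
    · exact mem_closedBall_zero_iff.2 (norm_analyticSum_le hlam 0 hs x)
    · exact mem_closedBall_zero_iff.2 (norm_analyticSum_le hlam 1 hs x)
  · exact Filter.Eventually.of_forall fun x => (hG.tendsto _).comp
      ((tendsto_analyticSum hlam 0 x).prodMk_nhds (tendsto_analyticSum hlam 1 x))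

/-- If `∑ₖ Aₖ` is analytic along a flow of translations, with positive frequencies only, then the
mean of a subharmonic function of it dominates the value at its mean `0`. Indeed
`s ↦ ∫ T(∑ₖ Aₖ exp(-λₖ s))` is convex: its second derivative differs from the integral of a
Laplacian by the derivative of a quantity which the flow leaves constant. It converges as `s → ∞`,
so it is nonincreasing. -/
theorem le_integral_of_subharmonic (hlam : ∀ k ∈ S, 0 < lam k) (y : ℝ → T2)
    (hA : ∀ k ∈ S, ∀ x t, A k (x + y t) = Complex.exp (t * Complex.I * lam k) * A k x)
    {T : ℂ → ℝ} (hT : ContDiff ℝ 2 T)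
    (hsub : ∀ z v, 0 ≤ fderiv ℝ (fderiv ℝ T) z v v
      + fderiv ℝ (fderiv ℝ T) z (Complex.I * v) (Complex.I * v)) :
    T 0 ≤ ∫ x, T (∑ k ∈ S, A k x) := by
  have hd1 : Differentiable ℝ T := hT.differentiable (by norm_num)
  have hT1 : ContDiff ℝ 1 (fderiv ℝ T) := hT.fderiv_right (by norm_num)
  have hd2 : Differentiable ℝ (fderiv ℝ T) := hT1.differentiable (by norm_num)
  have hc1 : Continuous (fderiv ℝ T) := hT1.continuous
  have hc2 : Continuous (fderiv ℝ (fderiv ℝ T)) := hT1.continuous_fderiv (by norm_num)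
  have hVs : ∀ n, Continuous fun q : ℝ × T2 => analyticSum S lam A n 0 q.1 q.2 := fun n =>
    continuous_analyticSum S lam A n continuous_const continuous_fst continuous_snd
  have hVt : ∀ n s, Continuous fun q : ℝ × T2 => analyticSum S lam A n q.1 s q.2 := fun n s =>
    continuous_analyticSum S lam A n continuous_fst continuous_const continuous_snd
  have hVx : ∀ n s, Continuous fun x : T2 => analyticSum S lam A n 0 s x := fun n s =>
    continuous_analyticSum S lam A n continuous_const continuous_const continuous_id
  have hint : ∀ {f : T2 → ℝ}, Continuous f → Integrable f volume := fun hf =>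
    (memLp_of_continuous hf 1).integrable le_rfl
  have hshift : ∀ n t s x, analyticSum S lam A n t s x = analyticSum S lam A n 0 s (x + y t) := by
    intro n t s x
    refine Finset.sum_congr rfl fun k hk => ?_
    rw [hA k hk, ← mul_assoc, mul_assoc _ (Complex.exp _) (Complex.exp _), ← Complex.exp_add]
    congr 3
    push_cast
    ring
  set M1 : ℝ → ℝ := fun s => ∫ x, fderiv ℝ T (analyticSum S lam A 0 0 s x)
    (-analyticSum S lam A 1 0 s x) with hM1
  have hderiv0 : ∀ s, HasDerivAt (fun s => ∫ x, T (analyticSum S lam A 0 0 s x)) (M1 s) s := by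
    intro s
    refine hasDerivAt_integral_of_continuous
      (F := fun s x => T (analyticSum S lam A 0 0 s x))
      (F' := fun s x => fderiv ℝ T (analyticSum S lam A 0 0 s x) (-analyticSum S lam A 1 0 s x))
      (hT.continuous.comp (hVs 0)) ((hc1.comp (hVs 0)).clm_apply (hVs 1).neg) ?_ s
    intro t x
    exact (hd1 _).hasFDerivAt.comp_hasDerivAt t (hasDerivAt_analyticSum_right S lam A 0 0 t x)
  have hderiv1 : ∀ s, HasDerivAt M1 (∫ x, (fderiv ℝ (fderiv ℝ T) (analyticSum S lam A 0 0 s x)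
      (-analyticSum S lam A 1 0 s x) (-analyticSum S lam A 1 0 s x)
      + fderiv ℝ T (analyticSum S lam A 0 0 s x) (analyticSum S lam A 2 0 s x))) s := by
    intro s
    refine hasDerivAt_integral_of_continuous
      (F := fun s x => fderiv ℝ T (analyticSum S lam A 0 0 s x) (-analyticSum S lam A 1 0 s x))
      (F' := fun s x => fderiv ℝ (fderiv ℝ T) (analyticSum S lam A 0 0 s x)
      (-analyticSum S lam A 1 0 s x) (-analyticSum S lam A 1 0 s x)
      + fderiv ℝ T (analyticSum S lam A 0 0 s x) (analyticSum S lam A 2 0 s x))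
      ((hc1.comp (hVs 0)).clm_apply (hVs 1).neg)
      ((((hc2.comp (hVs 0)).clm_apply (hVs 1).neg).clm_apply (hVs 1).neg).add
        ((hc1.comp (hVs 0)).clm_apply (hVs 2))) ?_ s
    intro t x
    have h1 := (hd2 _).hasFDerivAt.comp_hasDerivAt t (hasDerivAt_analyticSum_right S lam A 0 0 t x)
    have h2 := h1.clm_apply (hasDerivAt_analyticSum_right S lam A 1 0 t x).neg
    simpa using h2
  -- The flow preserves the volume, so the integral differentiated here does not depend on `t`.
  have hzero : ∀ s, ∫ x, (fderiv ℝ (fderiv ℝ T) (analyticSum S lam A 0 0 s x)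
      (Complex.I * analyticSum S lam A 1 0 s x) (Complex.I * analyticSum S lam A 1 0 s x)
      - fderiv ℝ T (analyticSum S lam A 0 0 s x) (analyticSum S lam A 2 0 s x)) = 0 := by
    intro s
    have h := hasDerivAt_integral_of_continuous
      (F := fun t x => fderiv ℝ T (analyticSum S lam A 0 t s x)
        (Complex.I * analyticSum S lam A 1 t s x))
      (F' := fun t x => fderiv ℝ (fderiv ℝ T) (analyticSum S lam A 0 t s x)
      (Complex.I * analyticSum S lam A 1 t s x) (Complex.I * analyticSum S lam A 1 t s x)
      - fderiv ℝ T (analyticSum S lam A 0 t s x) (analyticSum S lam A 2 t s x))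
      ((hc1.comp (hVt 0 s)).clm_apply (continuous_const.mul (hVt 1 s)))
      ((((hc2.comp (hVt 0 s)).clm_apply (continuous_const.mul (hVt 1 s))).clm_apply
        (continuous_const.mul (hVt 1 s))).sub ((hc1.comp (hVt 0 s)).clm_apply (hVt 2 s))) (by
        intro t x
        have h1 := (hd2 _).hasFDerivAt.comp_hasDerivAt t
          (hasDerivAt_analyticSum_left S lam A 0 t s x)
        have h2 := h1.clm_apply ((hasDerivAt_analyticSum_left S lam A 1 t s x).const_mul Complex.I)
        have h3 : Complex.I * (Complex.I * analyticSum S lam A (1 + 1) t s x)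
            = -analyticSum S lam A 2 t s x := by
          rw [← mul_assoc, Complex.I_mul_I]; simp
        rw [h3, map_neg, ← sub_eq_add_neg] at h2
        exact h2) 0
    have hconst : ∀ t, ∫ x, fderiv ℝ T (analyticSum S lam A 0 t s x)
        (Complex.I * analyticSum S lam A 1 t s x) = ∫ x, fderiv ℝ T (analyticSum S lam A 0 0 s x)
        (Complex.I * analyticSum S lam A 1 0 s x) := by
      intro t
      simp_rw [hshift _ t]
      exact integral_add_right_eq_self (μ := (volume : Measure T2)) (fun x =>
        fderiv ℝ T (analyticSum S lam A 0 0 s x) (Complex.I * analyticSum S lam A 1 0 s x)) (y t)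
    simp_rw [hconst] at h
    exact h.unique (hasDerivAt_const (0 : ℝ) _)
  -- Adding the vanishing integral `hzero` completes the derivative of `M1` to a Laplacian.
  have hmono : Monotone M1 := by
    refine monotone_of_deriv_nonneg (fun s => (hderiv1 s).differentiableAt) fun s => ?_
    rw [(hderiv1 s).deriv]
    refine le_of_le_of_eq ?_ ((congrArg (_ + ·) (hzero s)).trans (add_zero _))
    rw [← integral_add]
    · refine integral_nonneg fun x => ?_
      have := hsub (analyticSum S lam A 0 0 s x) (analyticSum S lam A 1 0 s x)
      simp only [map_neg, neg_apply, Pi.zero_apply, neg_neg]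
      linarith
    · exact hint ((((hc2.comp (hVx 0 s)).clm_apply (hVx 1 s).neg).clm_apply (hVx 1 s).neg).add
        ((hc1.comp (hVx 0 s)).clm_apply (hVx 2 s)))
    · exact hint ((((hc2.comp (hVx 0 s)).clm_apply (continuous_const.mul (hVx 1 s))).clm_apply
        (continuous_const.mul (hVx 1 s))).sub ((hc1.comp (hVx 0 s)).clm_apply (hVx 2 s)))
  have hlim1 : Filter.Tendsto M1 Filter.atTop (nhds 0) := by
    have := tendsto_integral_analyticSum (A := A) hlam (G := fun q => fderiv ℝ T q.1 (-q.2))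
      ((hc1.comp continuous_fst).clm_apply continuous_snd.neg)
    simpa [hM1] using this
  have hanti : Antitone (fun s => ∫ x, T (analyticSum S lam A 0 0 s x)) := by
    refine antitone_of_deriv_nonpos (fun s => (hderiv0 s).differentiableAt) fun s => ?_
    rw [(hderiv0 s).deriv]
    exact hmono.ge_of_tendsto hlim1 s
  have hlim0 := tendsto_integral_analyticSum (A := A) hlam (G := fun q => T q.1)
      (hT.continuous.comp continuous_fst)
  have := hanti.le_of_tendsto hlim0 0
  simpa [analyticSum] using this

end analyticSum

/-! ### Subharmonic functions of power type -/

/-- The second derivative of `T` in the direction `v` is that of its restriction to a line. -/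
theorem fderiv_fderiv_apply_eq {T : ℂ → ℝ} (hT : ContDiff ℝ 2 T) (z v : ℂ) {h₁ : ℝ → ℝ} {d : ℝ}
    (h : ∀ r : ℝ, HasDerivAt (fun r : ℝ => T (z + r * v)) (h₁ r) r) (h' : HasDerivAt h₁ d 0) :
    fderiv ℝ (fderiv ℝ T) z v v = d := by
  have hd1 : Differentiable ℝ T := hT.differentiable (by norm_num)
  have hd2 : Differentiable ℝ (fderiv ℝ T) :=
    (hT.fderiv_right (m := 1) (by norm_num)).differentiable (by norm_num)
  have hl : ∀ r : ℝ, HasDerivAt (fun r : ℝ => z + r * v) v r := fun r => by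
    have := ((Complex.ofRealCLM.hasDerivAt (x := r)).mul_const v).const_add z
    simpa using this
  have e : h₁ = fun r : ℝ => fderiv ℝ T (z + r * v) v := by
    funext r
    exact (h r).unique ((hd1 _).hasFDerivAt.comp_hasDerivAt r (hl r))
  rw [e] at h'
  have h2 := ((hd2 _).hasFDerivAt.comp_hasDerivAt (0 : ℝ) (hl 0)).clm_apply
    (hasDerivAt_const (0 : ℝ) v)
  have h3 := h'.unique h2
  simpa using h3.symm

section PowerLine

variable (a b a' b' ε : ℝ)

/-- The quadratic function `r ↦ (a + r a')² + (b + r b')² + ε`. -/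
def quadLine (r : ℝ) : ℝ := (a + r * a') ^ 2 + (b + r * b') ^ 2 + ε

/-- The derivative of `quadLine`. -/
def quadLineDeriv (r : ℝ) : ℝ := 2 * ((a + r * a') * a' + (b + r * b') * b')

variable {ε}

theorem quadLine_pos (hε : 0 < ε) (r : ℝ) : 0 < quadLine a b a' b' ε r := by
  unfold quadLine; positivity

theorem hasDerivAt_quadLine (r : ℝ) :
    HasDerivAt (quadLine a b a' b' ε) (quadLineDeriv a b a' b' r) r := by
  have h1 := (((hasDerivAt_id r).mul_const a').const_add a).pow 2
  have h2 := (((hasDerivAt_id r).mul_const b').const_add b).pow 2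
  refine ((h1.add h2).add_const ε).congr_deriv ?_
  simp [quadLineDeriv]
  ring

theorem hasDerivAt_quadLineDeriv (r : ℝ) :
    HasDerivAt (quadLineDeriv a b a' b') (2 * (a' ^ 2 + b' ^ 2)) r := by
  have h1 := (((hasDerivAt_id r).mul_const a').const_add a).mul_const a'
  have h2 := (((hasDerivAt_id r).mul_const b').const_add b).mul_const b'
  refine ((h1.add h2).const_mul 2).congr_deriv ?_
  ring

theorem hasDerivAt_quadLine_rpow (hε : 0 < ε) (τ r : ℝ) :
    HasDerivAt (fun r => quadLine a b a' b' ε r ^ τ)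
      (quadLineDeriv a b a' b' r * τ * quadLine a b a' b' ε r ^ (τ - 1)) r :=
  (hasDerivAt_quadLine a b a' b' r).rpow_const (Or.inl (quadLine_pos a b a' b' hε r).ne')

theorem hasDerivAt_quadLine_rpow_deriv (hε : 0 < ε) (τ r : ℝ) :
    HasDerivAt (fun r => quadLineDeriv a b a' b' r * τ * quadLine a b a' b' ε r ^ (τ - 1))
      (2 * (a' ^ 2 + b' ^ 2) * τ * quadLine a b a' b' ε r ^ (τ - 1) +
        quadLineDeriv a b a' b' r * τ *
        (quadLineDeriv a b a' b' r * (τ - 1) * quadLine a b a' b' ε r ^ (τ - 1 - 1))) r :=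
  ((hasDerivAt_quadLineDeriv a b a' b' r).mul_const τ).fun_mul
    (hasDerivAt_quadLine_rpow a b a' b' hε (τ - 1) r)

end PowerLine

theorem rpow_sub_one_mul {w : ℝ} (hw : 0 < w) (τ : ℝ) : w ^ τ = w ^ (τ - 1) * w := by
  rw [Real.rpow_sub_one hw.ne', div_mul_cancel₀ _ hw.ne']

theorem contDiff_normSq_rpow {ε : ℝ} (hε : 0 < ε) (τ : ℝ) :
    ContDiff ℝ 2 fun z : ℂ => (z.re ^ 2 + z.im ^ 2 + ε) ^ τ := by
  refine ContDiff.rpow_const_of_ne ?_ fun z => by positivity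
  exact ((Complex.reCLM.contDiff.pow 2).add (Complex.imCLM.contDiff.pow 2)).add contDiff_const

theorem contDiff_reSq_rpow {ε : ℝ} (hε : 0 < ε) (τ : ℝ) :
    ContDiff ℝ 2 fun z : ℂ => (z.re ^ 2 + ε) ^ τ := by
  refine ContDiff.rpow_const_of_ne ?_ fun z => by positivity
  exact (Complex.reCLM.contDiff.pow 2).add contDiff_const

/-- For exponents `2τ ∈ (1, 2]`, the function comparing `|Re z|^{2τ}` with `|z|^{2τ}`. -/
def lowPower (ε τ : ℝ) (z : ℂ) : ℝ :=
  2 / (2 * τ - 1) * (z.re ^ 2 + ε) ^ τ - (z.re ^ 2 + z.im ^ 2 + ε) ^ τ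

/-- For exponents `2τ ≥ 2`, the function comparing `|Re z|² |z|^{2τ-2}` with `|z|^{2τ}`. -/
def highPower (ε τ : ℝ) (z : ℂ) : ℝ :=
  2 * τ ^ 2 * (z.re ^ 2 * (z.re ^ 2 + z.im ^ 2 + ε) ^ (τ - 1)) - (z.re ^ 2 + z.im ^ 2 + ε) ^ τ

theorem contDiff_lowPower {ε : ℝ} (hε : 0 < ε) (τ : ℝ) : ContDiff ℝ 2 (lowPower ε τ) :=
  (contDiff_const.mul (contDiff_reSq_rpow hε τ)).sub (contDiff_normSq_rpow hε τ)

theorem contDiff_highPower {ε : ℝ} (hε : 0 < ε) (τ : ℝ) : ContDiff ℝ 2 (highPower ε τ) :=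
  (contDiff_const.mul ((Complex.reCLM.contDiff.pow 2).mul (contDiff_normSq_rpow hε (τ - 1)))).sub
    (contDiff_normSq_rpow hε τ)

theorem fderiv_fderiv_lowPower {ε : ℝ} (hε : 0 < ε) (τ : ℝ) (z v : ℂ) :
    fderiv ℝ (fderiv ℝ (lowPower ε τ)) z v v =
      2 / (2 * τ - 1) * (2 * v.re ^ 2 * τ * (z.re ^ 2 + ε) ^ (τ - 1) +
        2 * (z.re * v.re) * τ * (2 * (z.re * v.re) * (τ - 1) * (z.re ^ 2 + ε) ^ (τ - 1 - 1)))
      - (2 * (v.re ^ 2 + v.im ^ 2) * τ * (z.re ^ 2 + z.im ^ 2 + ε) ^ (τ - 1) +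
        2 * (z.re * v.re + z.im * v.im) * τ * (2 * (z.re * v.re + z.im * v.im) * (τ - 1) *
          (z.re ^ 2 + z.im ^ 2 + ε) ^ (τ - 1 - 1))) := by
  have h1 := hasDerivAt_quadLine_rpow z.re 0 v.re 0 hε τ
  have h2 := hasDerivAt_quadLine_rpow z.re z.im v.re v.im hε τ
  have h1' := hasDerivAt_quadLine_rpow_deriv z.re 0 v.re 0 hε τ 0
  have h2' := hasDerivAt_quadLine_rpow_deriv z.re z.im v.re v.im hε τ 0
  have key := fderiv_fderiv_apply_eq (contDiff_lowPower hε τ) z v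
    (fun r => (((h1 r).const_mul (2 / (2 * τ - 1))).sub (h2 r)).congr_of_eventuallyEq
      (Filter.Eventually.of_forall fun r => by simp [lowPower, quadLine]))
    ((h1'.const_mul (2 / (2 * τ - 1))).sub h2')
  rw [key]
  simp [quadLine, quadLineDeriv]

theorem fderiv_fderiv_highPower {ε : ℝ} (hε : 0 < ε) (τ : ℝ) (z v : ℂ) :
    fderiv ℝ (fderiv ℝ (highPower ε τ)) z v v =
      2 * τ ^ 2 * (2 * v.re ^ 2 * (z.re ^ 2 + z.im ^ 2 + ε) ^ (τ - 1)
        + 2 * (2 * (z.re * v.re) * (2 * (z.re * v.re + z.im * v.im) * (τ - 1) *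
          (z.re ^ 2 + z.im ^ 2 + ε) ^ (τ - 1 - 1)))
        + z.re ^ 2 * (2 * (v.re ^ 2 + v.im ^ 2) * (τ - 1) *
          (z.re ^ 2 + z.im ^ 2 + ε) ^ (τ - 1 - 1) +
          2 * (z.re * v.re + z.im * v.im) * (τ - 1) * (2 * (z.re * v.re + z.im * v.im) *
          (τ - 1 - 1) * (z.re ^ 2 + z.im ^ 2 + ε) ^ (τ - 1 - 1 - 1))))
      - (2 * (v.re ^ 2 + v.im ^ 2) * τ * (z.re ^ 2 + z.im ^ 2 + ε) ^ (τ - 1) +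
        2 * (z.re * v.re + z.im * v.im) * τ * (2 * (z.re * v.re + z.im * v.im) * (τ - 1) *
          (z.re ^ 2 + z.im ^ 2 + ε) ^ (τ - 1 - 1))) := by
  have hu : ∀ r : ℝ, HasDerivAt (fun r : ℝ => (z.re + r * v.re) ^ 2)
      (quadLineDeriv z.re 0 v.re 0 r) r := fun r =>
    (hasDerivAt_quadLine z.re 0 v.re 0 (ε := 0) r).congr_of_eventuallyEq
      (Filter.Eventually.of_forall fun r => by simp [quadLine])
  have hu' := hasDerivAt_quadLineDeriv z.re 0 v.re 0 0
  have h1 := hasDerivAt_quadLine_rpow z.re z.im v.re v.im hε (τ - 1)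
  have h2 := hasDerivAt_quadLine_rpow z.re z.im v.re v.im hε τ
  have h1' := hasDerivAt_quadLine_rpow_deriv z.re z.im v.re v.im hε (τ - 1) 0
  have h2' := hasDerivAt_quadLine_rpow_deriv z.re z.im v.re v.im hε τ 0
  have key := fderiv_fderiv_apply_eq (contDiff_highPower hε τ) z v
    (fun r => ((((hu r).fun_mul (h1 r)).const_mul (2 * τ ^ 2)).sub (h2 r)).congr_of_eventuallyEq
      (Filter.Eventually.of_forall fun r => by simp [highPower, quadLine]))
    ((((hu'.fun_mul (h1 0)).add ((hu 0).fun_mul h1')).const_mul (2 * τ ^ 2)).sub h2')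
  rw [key]
  simp only [quadLine, quadLineDeriv, zero_mul, mul_zero, add_zero, zero_pow two_ne_zero]
  ring

/-- The Laplacian is computed along the orthogonal directions `v` and `iv`. That of the first term
dominates since `(a² + ε)^{τ-1} ≥ (a² + b² + ε)^{τ-1}` for `τ ≤ 1`. -/
theorem lowPower_subharmonic {ε τ : ℝ} (hε : 0 < ε) (h1 : 1 / 2 < τ) (h2 : τ ≤ 1) (z v : ℂ) :
    0 ≤ fderiv ℝ (fderiv ℝ (lowPower ε τ)) z v v
      + fderiv ℝ (fderiv ℝ (lowPower ε τ)) z (Complex.I * v) (Complex.I * v) := by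
  rw [fderiv_fderiv_lowPower hε, fderiv_fderiv_lowPower hε]
  simp only [Complex.I_mul_re, Complex.I_mul_im]
  obtain ⟨a, ha⟩ : ∃ a, z.re = a := ⟨_, rfl⟩
  obtain ⟨b, hb⟩ : ∃ b, z.im = b := ⟨_, rfl⟩
  obtain ⟨x, hx⟩ : ∃ x, v.re = x := ⟨_, rfl⟩
  obtain ⟨y, hy⟩ : ∃ y, v.im = y := ⟨_, rfl⟩
  simp only [ha, hb, hx, hy]
  have hY : 0 < a ^ 2 + ε := by positivity
  have hW : 0 < a ^ 2 + b ^ 2 + ε := by positivity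
  have hP : 0 < (a ^ 2 + ε) ^ (τ - 1 - 1) := Real.rpow_pos_of_pos hY _
  have hQ : 0 < (a ^ 2 + b ^ 2 + ε) ^ (τ - 1 - 1) := Real.rpow_pos_of_pos hW _
  have hle : (a ^ 2 + b ^ 2 + ε) ^ (τ - 1) ≤ (a ^ 2 + ε) ^ (τ - 1) :=
    Real.rpow_le_rpow_of_nonpos hY (by nlinarith [sq_nonneg b]) (by linarith)
  rw [rpow_sub_one_mul hY (τ - 1), rpow_sub_one_mul hW (τ - 1)] at *
  set P := (a ^ 2 + ε) ^ (τ - 1 - 1)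
  set Q := (a ^ 2 + b ^ 2 + ε) ^ (τ - 1 - 1)
  have hC : 0 < 2 * τ - 1 := by linarith
  have hN : 0 ≤ x ^ 2 + y ^ 2 := by positivity
  have e : ∀ C : ℝ, C * (2 * x ^ 2 * τ * (P * (a ^ 2 + ε)) +
        2 * (a * x) * τ * (2 * (a * x) * (τ - 1) * P)) -
      (2 * (x ^ 2 + y ^ 2) * τ * (Q * (a ^ 2 + b ^ 2 + ε)) +
        2 * (a * x + b * y) * τ * (2 * (a * x + b * y) * (τ - 1) * Q)) +
    (C * (2 * (-y) ^ 2 * τ * (P * (a ^ 2 + ε)) +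
          2 * (a * -y) * τ * (2 * (a * -y) * (τ - 1) * P)) -
      (2 * ((-y) ^ 2 + x ^ 2) * τ * (Q * (a ^ 2 + b ^ 2 + ε)) +
        2 * (a * -y + b * x) * τ * (2 * (a * -y + b * x) * (τ - 1) * Q)))
      = (x ^ 2 + y ^ 2) * (2 * τ) * (C * ((2 * τ - 1) * (P * (a ^ 2 + ε)) + 2 * (1 - τ) * P * ε)
        - 2 * (Q * (a ^ 2 + b ^ 2 + ε)) + 2 * (1 - τ) * Q * (a ^ 2 + b ^ 2)) := by
    intro C; ring
  rw [e]
  refine mul_nonneg (by positivity) ?_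
  have e2 : 2 / (2 * τ - 1) * ((2 * τ - 1) * (P * (a ^ 2 + ε)) + 2 * (1 - τ) * P * ε)
      = 2 * (P * (a ^ 2 + ε)) + 2 / (2 * τ - 1) * (2 * (1 - τ) * P * ε) := by
    field_simp
  rw [e2]
  have h3 : 0 ≤ 2 / (2 * τ - 1) * (2 * (1 - τ) * P * ε) := by
    have : 0 ≤ 1 - τ := by linarith
    positivity
  have h4 : 0 ≤ 2 * (1 - τ) * Q * (a ^ 2 + b ^ 2) := by
    have : 0 ≤ 1 - τ := by linarith
    positivity
  linarith

/-- The constant `2τ²` in `highPower` makes the Laplacian a sum of nonnegative terms. -/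
theorem highPower_subharmonic {ε τ : ℝ} (hε : 0 < ε) (h1 : 1 ≤ τ) (z v : ℂ) :
    0 ≤ fderiv ℝ (fderiv ℝ (highPower ε τ)) z v v
      + fderiv ℝ (fderiv ℝ (highPower ε τ)) z (Complex.I * v) (Complex.I * v) := by
  rw [fderiv_fderiv_highPower hε, fderiv_fderiv_highPower hε]
  simp only [Complex.I_mul_re, Complex.I_mul_im]
  obtain ⟨a, ha⟩ : ∃ a, z.re = a := ⟨_, rfl⟩
  obtain ⟨b, hb⟩ : ∃ b, z.im = b := ⟨_, rfl⟩
  obtain ⟨x, hx⟩ : ∃ x, v.re = x := ⟨_, rfl⟩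
  obtain ⟨y, hy⟩ : ∃ y, v.im = y := ⟨_, rfl⟩
  simp only [ha, hb, hx, hy]
  have hW : 0 < a ^ 2 + b ^ 2 + ε := by positivity
  have hQ : 0 < (a ^ 2 + b ^ 2 + ε) ^ (τ - 1 - 1 - 1) := Real.rpow_pos_of_pos hW _
  rw [rpow_sub_one_mul hW (τ - 1), rpow_sub_one_mul hW (τ - 1 - 1)]
  set Q := (a ^ 2 + b ^ 2 + ε) ^ (τ - 1 - 1 - 1)
  obtain ⟨σ, hσ, hσ0⟩ : ∃ σ, τ = σ + 1 ∧ 0 ≤ σ := ⟨τ - 1, by ring, by linarith⟩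
  subst hσ
  rw [← sub_nonneg, sub_zero]
  have e : 0 ≤ (x ^ 2 + y ^ 2) * Q * (2 * (σ + 1) ^ 2 * (8 * σ * a ^ 2 * (a ^ 2 + b ^ 2 + ε)
      + 4 * σ * a ^ 2 * (ε + σ * (a ^ 2 + b ^ 2)))
      + 4 * (σ + 1) * σ * ε * (a ^ 2 + b ^ 2 + ε)) := by positivity
  refine e.trans (le_of_eq ?_)
  ring

/-! ### Directional Hilbert transforms -/

/-- The sign of a real number, with the value `-1` at `0`. -/
def halfSign (t : ℝ) : ℝ := if 0 < t then 1 else -1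

/-- The symbol `-i sgn (k · θ)` of the Hilbert transform in the direction `θ`. -/
def hilbertSymbol (θ : Fin 2 → ℝ) (k : Freq) : ℂ := -Complex.I * halfSign (phase k θ)

/-- The terms of `f + i H_θ f`, for `f = Re ∑ cₖ eₖ`: those with `k · θ < 0` are conjugated, which
moves their frequency to the half-plane `k · θ > 0`. -/
def analyticTerm (c : Freq →₀ ℂ) (θ : Fin 2 → ℝ) (k : Freq) : C(T2, ℂ) :=
  if 0 < phase k θ then c k • UnitAddTorus.mFourier k else star (c k • UnitAddTorus.mFourier k)

theorem sum_analyticTerm (c : Freq →₀ ℂ) (θ : Fin 2 → ℝ) (x : T2) :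
    ∑ k ∈ c.support, analyticTerm c θ k x
      = ⟨trig c x, trig (mult (hilbertSymbol θ) c) x⟩ := by
  have h : ∀ d : Freq →₀ ℂ, d.support ⊆ c.support → trig d x
      = ∑ k ∈ c.support, (d k * UnitAddTorus.mFourier k x).re := by
    intro d hd
    rw [trig_apply, Complex.re_sum]
    refine Finset.sum_subset hd fun k _ hk => ?_
    rw [Finsupp.notMem_support_iff.1 hk]
    simp
  apply Complex.ext
  · rw [Complex.re_sum, h c subset_rfl]
    refine Finset.sum_congr rfl fun k _ => ?_
    unfold analyticTerm
    split_ifs <;> simp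
  · rw [Complex.im_sum]
    refine Eq.trans ?_ (h (mult (hilbertSymbol θ) c) fun k hk => Finsupp.mem_support_iff.2
      (right_ne_zero_of_mul (Finsupp.mem_support_iff.1 hk))).symm
    refine Finset.sum_congr rfl fun k _ => ?_
    rw [mult_apply]
    unfold analyticTerm hilbertSymbol halfSign
    split_ifs
    · simp
    · simp
      ring

theorem analyticTerm_add (c : Freq →₀ ℂ) (θ : Fin 2 → ℝ) (k : Freq) (x : T2) (t : ℝ) :
    analyticTerm c θ k (x + proj (t • θ))
      = Complex.exp (t * Complex.I * (2 * Real.pi * |phase k θ| : ℝ)) * analyticTerm c θ k x := by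
  have hp : phase k (t • θ) = t * phase k θ := by
    simp [phase, Fin.sum_univ_two]; ring
  unfold analyticTerm
  split_ifs with h
  · rw [abs_of_pos h, ContinuousMap.smul_apply, ContinuousMap.smul_apply, mFourier_add_right,
      mFourier_proj k (t • θ), hp]
    simp only [smul_eq_mul]
    push_cast
    have e : 2 * (Real.pi : ℂ) * (t * phase k θ) * Complex.I
      = t * Complex.I * (2 * Real.pi * phase k θ) := by ring
    rw [e]
    ring
  · rw [abs_of_nonpos (not_lt.1 h), ContinuousMap.star_apply, ContinuousMap.star_apply,
      ContinuousMap.smul_apply, ContinuousMap.smul_apply, mFourier_add_right,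
      mFourier_proj k (t • θ), hp]
    simp only [smul_eq_mul, star_mul', Complex.star_def, ← Complex.exp_conj, map_mul,
      Complex.conj_I, Complex.conj_ofReal, Complex.conj_ofNat]
    push_cast
    have e : 2 * (Real.pi : ℂ) * (t * phase k θ) * -Complex.I
      = t * Complex.I * (2 * Real.pi * -phase k θ) := by ring
    rw [e]
    ring

/-- The mean value inequality for `f + i H_θ f`, where `f` has no frequency orthogonal to `θ`. -/
theorem le_integral_trig_of_subharmonic (c : Freq →₀ ℂ) (θ : Fin 2 → ℝ)
    (hθ : ∀ k ∈ c.support, phase k θ ≠ 0) {T : ℂ → ℝ} (hT : ContDiff ℝ 2 T)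
    (hsub : ∀ z v, 0 ≤ fderiv ℝ (fderiv ℝ T) z v v
      + fderiv ℝ (fderiv ℝ T) z (Complex.I * v) (Complex.I * v)) :
    T 0 ≤ ∫ x, T ⟨trig c x, trig (mult (hilbertSymbol θ) c) x⟩ := by
  have := le_integral_of_subharmonic (S := c.support) (lam := fun k => 2 * Real.pi * |phase k θ|)
    (A := analyticTerm c θ) (fun k hk => by have := abs_pos.2 (hθ k hk); positivity)
    (fun t => proj (t • θ)) (fun k _ x t => analyticTerm_add c θ k x t) hT hsub
  simpa only [sum_analyticTerm] using this

theorem le_of_forall_le_add_rpow {A B D τ : ℝ} (hτ : 0 < τ)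
    (h : ∀ ε : ℝ, 0 < ε → A ≤ B + D * ε ^ τ) : A ≤ B := by
  have hl : Filter.Tendsto (fun ε : ℝ => B + D * ε ^ τ) (nhdsWithin 0 (Set.Ioi 0)) (nhds B) := by
    have h1 : Filter.Tendsto (fun ε : ℝ => ε ^ τ) (nhds 0) (nhds (0 ^ τ)) :=
      (Real.continuousAt_rpow_const 0 τ (Or.inr hτ.le)).tendsto
    rw [Real.zero_rpow hτ.ne'] at h1
    simpa using ((h1.const_mul D).const_add B).mono_left nhdsWithin_le_nhds
  exact ge_of_tendsto hl (by filter_upwards [self_mem_nhdsWithin] with ε hε using h ε hε)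

/-- The bound of `H_θ` on `L^{2τ}` for exponents `2τ ∈ (1, 2]`, with `|f|^{2τ}` written as
`(f²)^τ`. -/
theorem integral_hilbert_le_of_le_one {τ : ℝ} (h1 : 1 / 2 < τ) (h2 : τ ≤ 1) (c : Freq →₀ ℂ)
    (θ : Fin 2 → ℝ) (hθ : ∀ k ∈ c.support, phase k θ ≠ 0) :
    ∫ x, (trig (mult (hilbertSymbol θ) c) x ^ 2) ^ τ
      ≤ 2 / (2 * τ - 1) * ∫ x, (trig c x ^ 2) ^ τ := by
  set g := trig (mult (hilbertSymbol θ) c) with hg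
  set f := trig c with hf
  have hτ : 0 < τ := by linarith
  have hC : 0 < 2 * τ - 1 := by linarith
  have hC1 : 1 ≤ 2 / (2 * τ - 1) := by rw [le_div_iff₀ hC]; linarith
  set C := 2 / (2 * τ - 1) with hCdef
  have hint : ∀ {f : T2 → ℝ}, Continuous f → Integrable f volume := fun hf =>
    (memLp_of_continuous hf 1).integrable le_rfl
  have hpow : ∀ {h : T2 → ℝ}, Continuous h → Continuous fun x => h x ^ τ := fun hh =>
    hh.rpow_const fun x => Or.inr hτ.le
  refine le_of_forall_le_add_rpow (D := C) hτ fun ε hε => ?_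
  have key := le_integral_trig_of_subharmonic c θ hθ (contDiff_lowPower hε τ)
    (lowPower_subharmonic hε h1 h2)
  have h0 : 0 ≤ lowPower ε τ 0 := by
    have : 0 ≤ ε ^ τ := by positivity
    simp only [lowPower, Complex.zero_re, Complex.zero_im, ne_eq, OfNat.ofNat_ne_zero,
      not_false_eq_true, zero_pow, zero_add]
    nlinarith
  have h3 : ∫ x, (g x ^ 2) ^ τ ≤ ∫ x, (C * (f x ^ 2) ^ τ + C * ε ^ τ
      - lowPower ε τ ⟨f x, g x⟩) := by
    refine integral_mono (hint (hpow (by fun_prop))) (hint ?_) fun x => ?_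
    · refine ((continuous_const.mul (hpow (by fun_prop))).add continuous_const).sub ?_
      refine (contDiff_lowPower hε τ).continuous.comp ?_
      exact Complex.equivRealProdCLM.symm.continuous.comp (f.continuous.prodMk g.continuous)
    · simp only [lowPower]
      have i1 : (f x ^ 2 + ε) ^ τ ≤ (f x ^ 2) ^ τ + ε ^ τ :=
        Real.rpow_add_le_add_rpow (sq_nonneg _) hε.le hτ.le h2
      have i2 : (g x ^ 2) ^ τ ≤ (f x ^ 2 + g x ^ 2 + ε) ^ τ :=
        Real.rpow_le_rpow (sq_nonneg _) (by nlinarith [sq_nonneg (f x)]) hτ.le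
      nlinarith
  have hlow : Continuous fun x => lowPower ε τ ⟨f x, g x⟩ :=
    (contDiff_lowPower hε τ).continuous.comp
      (Complex.equivRealProdCLM.symm.continuous.comp (f.continuous.prodMk g.continuous))
  have hfτ : Continuous fun x => C * (f x ^ 2) ^ τ := continuous_const.mul (hpow (by fun_prop))
  have hfε : Continuous fun x => C * (f x ^ 2) ^ τ + C * ε ^ τ := hfτ.add continuous_const
  rw [integral_sub (hint hfε) (hint hlow),
    integral_add (hint hfτ) (integrable_const _), integral_const_mul] at h3
  simp only [integral_const, probReal_univ, one_smul] at h3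
  linarith

/-- The bound of `H_θ` on `L^{2τ}` for exponents `2τ ≥ 2`. As `highPower` compares `|f|² w^{τ-1}`
with `w^τ` for `w = |f|² + |H_θ f|² + ε`, the first term is split by Young's inequality. -/
theorem integral_hilbert_le_of_one_le {τ : ℝ} (h1 : 1 ≤ τ) (c : Freq →₀ ℂ)
    (θ : Fin 2 → ℝ) (hθ : ∀ k ∈ c.support, phase k θ ≠ 0) :
    ∫ x, (trig (mult (hilbertSymbol θ) c) x ^ 2) ^ τ
      ≤ (2 * τ ^ 2) ^ τ * ∫ x, (trig c x ^ 2) ^ τ := by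
  set g := trig (mult (hilbertSymbol θ) c) with hg
  set f := trig c with hf
  have hτ : 0 < τ := by linarith
  have hint : ∀ {f : T2 → ℝ}, Continuous f → Integrable f volume := fun hf =>
    (memLp_of_continuous hf 1).integrable le_rfl
  have hpow : ∀ {h : T2 → ℝ}, Continuous h → Continuous fun x => h x ^ τ := fun hh =>
    hh.rpow_const fun x => Or.inr hτ.le
  refine le_of_forall_le_add_rpow (D := τ) hτ fun ε hε => ?_
  have key := le_integral_trig_of_subharmonic c θ hθ (contDiff_highPower hε τ)
    (highPower_subharmonic hε h1)
  have h0 : -ε ^ τ ≤ highPower ε τ 0 := by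
    simp [highPower]
  have hhigh : Continuous fun x => τ * highPower ε τ ⟨f x, g x⟩ :=
    continuous_const.mul ((contDiff_highPower hε τ).continuous.comp
      (Complex.equivRealProdCLM.symm.continuous.comp (f.continuous.prodMk g.continuous)))
  have hfτ : Continuous fun x => (2 * τ ^ 2) ^ τ * (f x ^ 2) ^ τ :=
    continuous_const.mul (hpow (by fun_prop))
  have h3 : ∫ x, (g x ^ 2) ^ τ ≤ ∫ x, ((2 * τ ^ 2) ^ τ * (f x ^ 2) ^ τ
      - τ * highPower ε τ ⟨f x, g x⟩) := by
    refine integral_mono (hint (hpow (by fun_prop))) (hint (hfτ.sub hhigh)) fun x => ?_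
    simp only [highPower]
    have hw : 0 < f x ^ 2 + g x ^ 2 + ε := by positivity
    have i2 : (g x ^ 2) ^ τ ≤ (f x ^ 2 + g x ^ 2 + ε) ^ τ :=
      Real.rpow_le_rpow (sq_nonneg _) (by nlinarith [sq_nonneg (f x)]) hτ.le
    set w := f x ^ 2 + g x ^ 2 + ε with hwdef
    -- Young's inequality, with exponents `τ` and `τ / (τ - 1)`
    have young := Real.geom_mean_le_arith_mean2_weighted (w₁ := 1 / τ) (w₂ := 1 - 1 / τ)
      (p₁ := (2 * τ ^ 2 * f x ^ 2) ^ τ) (p₂ := w ^ τ) (by positivity)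
      (by rw [sub_nonneg, div_le_one hτ]; exact h1) (by positivity) (by positivity) (by ring)
    rw [← Real.rpow_mul (by positivity), ← Real.rpow_mul hw.le, mul_one_div_cancel hτ.ne',
      Real.rpow_one, Real.mul_rpow (by positivity) (sq_nonneg _)] at young
    have e1 : τ * (1 - 1 / τ) = τ - 1 := by field_simp
    rw [e1] at young
    have young' := mul_le_mul_of_nonneg_left young hτ.le
    have e2 : τ * (1 / τ * ((2 * τ ^ 2) ^ τ * (f x ^ 2) ^ τ) + (1 - 1 / τ) * w ^ τ)
        = (2 * τ ^ 2) ^ τ * (f x ^ 2) ^ τ + (τ - 1) * w ^ τ := by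
      field_simp
    rw [e2] at young'
    linarith
  rw [integral_sub (hint hfτ) (hint hhigh), integral_const_mul, integral_const_mul] at h3
  nlinarith

theorem norm_trigLp_rpow {p : ℝ≥0∞} [Fact (1 ≤ p)] (hp : p ≠ ⊤) (c : Freq →₀ ℂ) :
    ‖trigLp p c‖ ^ p.toReal = ∫ x, (trig c x ^ 2) ^ (p.toReal / 2) := by
  have h1 : (1 : ℝ≥0∞) ≤ p := Fact.out
  have hp0 : p ≠ 0 := (zero_lt_one.trans_le h1).ne'
  have hq : 0 < p.toReal := ENNReal.toReal_pos hp0 hp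
  have e1 : ‖trigLp p c‖ = (∫ x, ‖trig c x‖ ^ p.toReal) ^ p.toReal⁻¹ := by
    rw [Lp.norm_def, eLpNorm_congr_ae (coeFn_trigLp p c),
      (memLp_of_continuous (trig c).continuous p).eLpNorm_eq_integral_rpow_norm hp0 hp,
      ENNReal.toReal_ofReal]
    exact Real.rpow_nonneg (integral_nonneg fun x => by positivity) _
  rw [e1, ← Real.rpow_mul (integral_nonneg fun x => by positivity), inv_mul_cancel₀ hq.ne',
    Real.rpow_one]
  refine integral_congr_ae (Filter.Eventually.of_forall fun x => ?_)
  simp only []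
  rw [← sq_abs, ← Real.rpow_natCast, ← Real.rpow_mul (abs_nonneg _), Real.norm_eq_abs]
  congr 1
  push_cast
  ring

/-- **M. Riesz' theorem** for the Hilbert transforms in all directions `θ` that are not orthogonal
to a frequency of the polynomial; the constant does not depend on `θ`. -/
theorem exists_norm_hilbert_le {p : ℝ≥0∞} [Fact (1 ≤ p)] (h1 : 1 < p) (hp : p ≠ ⊤) :
    ∃ C : ℝ, 0 < C ∧ ∀ (c : Freq →₀ ℂ) (θ : Fin 2 → ℝ), (∀ k ∈ c.support, phase k θ ≠ 0) →
      ‖trigLp p (mult (hilbertSymbol θ) c)‖ ≤ C * ‖trigLp p c‖ := by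
  have hq : 1 < p.toReal := by
    rw [← ENNReal.toReal_one]; exact ENNReal.toReal_strict_mono hp h1
  have hq0 : 0 < p.toReal := by linarith
  obtain ⟨D, hD, h⟩ : ∃ D : ℝ, 0 < D ∧ ∀ (c : Freq →₀ ℂ) (θ : Fin 2 → ℝ),
      (∀ k ∈ c.support, phase k θ ≠ 0) →
      ∫ x, (trig (mult (hilbertSymbol θ) c) x ^ 2) ^ (p.toReal / 2)
        ≤ D * ∫ x, (trig c x ^ 2) ^ (p.toReal / 2) := by
    rcases le_total (p.toReal / 2) 1 with h2 | h2
    · exact ⟨2 / (2 * (p.toReal / 2) - 1), div_pos two_pos (by linarith), fun c θ hθ =>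
        integral_hilbert_le_of_le_one (by linarith) h2 c θ hθ⟩
    · exact ⟨(2 * (p.toReal / 2) ^ 2) ^ (p.toReal / 2), by positivity, fun c θ hθ =>
        integral_hilbert_le_of_one_le h2 c θ hθ⟩
  refine ⟨D ^ p.toReal⁻¹, by positivity, fun c θ hθ => ?_⟩
  have := h c θ hθ
  rw [← norm_trigLp_rpow hp, ← norm_trigLp_rpow hp] at this
  refine (Real.rpow_le_rpow_iff (norm_nonneg _) (by positivity) hq0).1 (this.trans (le_of_eq ?_))
  rw [Real.mul_rpow (by positivity) (norm_nonneg _), ← Real.rpow_mul hD.le,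
    inv_mul_cancel₀ hq0.ne', Real.rpow_one]

/-! ### Riesz transforms by the method of rotations -/

theorem measurable_halfSign : Measurable halfSign :=
  Measurable.ite measurableSet_Ioi measurable_const measurable_const

theorem abs_halfSign (t : ℝ) : |halfSign t| = 1 := by
  unfold halfSign; split_ifs <;> simp

theorem halfSign_mul {r : ℝ} (hr : 0 < r) (t : ℝ) : halfSign (r * t) = halfSign t := by
  unfold halfSign
  simp only [mul_pos_iff_of_pos_left hr]

/-- The unit vector of argument `α`. -/
def unitVec (α : ℝ) : Fin 2 → ℝ := ![Real.cos α, Real.sin α]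

theorem continuous_unitVec (j : Fin 2) : Continuous fun α => unitVec α j := by
  fin_cases j
  · exact Real.continuous_cos
  · exact Real.continuous_sin

theorem abs_unitVec_le (α : ℝ) (j : Fin 2) : |unitVec α j| ≤ 1 := by
  fin_cases j
  · exact Real.abs_cos_le_one α
  · exact Real.abs_sin_le_one α

theorem continuous_phase_unitVec (k : Freq) : Continuous fun α => phase k (unitVec α) := by
  unfold phase
  exact continuous_finsetSum _ fun i _ => continuous_const.mul (continuous_unitVec i)

/-- Polar coordinates of a frequency. -/
theorem exists_phase_unitVec (k : Freq) : ∃ β : ℝ, (∀ j, (k j : ℝ) = √(freqSq k) * unitVec β j) ∧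
    ∀ α, phase k (unitVec α) = √(freqSq k) * Real.cos (α - β) := by
  let z : ℂ := ⟨k 0, k 1⟩
  have hz : ‖z‖ = √(freqSq k) := by
    rw [Complex.norm_eq_sqrt_sq_add_sq]; rfl
  have h0 : (k 0 : ℝ) = √(freqSq k) * Real.cos z.arg := by
    rw [← hz, Complex.norm_mul_cos_arg]
  have h1 : (k 1 : ℝ) = √(freqSq k) * Real.sin z.arg := by
    rw [← hz, Complex.norm_mul_sin_arg]
  refine ⟨z.arg, fun j => ?_, fun α => ?_⟩
  · fin_cases j
    · exact h0
    · exact h1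
  · simp only [phase, Fin.sum_univ_two, unitVec, Matrix.cons_val_zero, Matrix.cons_val_one]
    rw [Real.cos_sub]
    linear_combination Real.cos α * h0 + Real.sin α * h1

theorem intervalIntegrable_unitVec_mul {f : ℝ → ℝ} (hf : Continuous f) (j : Fin 2) (a b : ℝ) :
    IntervalIntegrable (fun α => unitVec α j * halfSign (f α)) volume a b := by
  have h1 : IntervalIntegrable (fun _ : ℝ => (1 : ℝ)) volume a b := by simp
  refine h1.mono_fun ?_ (Filter.Eventually.of_forall fun α => ?_)
  · exact ((continuous_unitVec j).measurable.mul
      (measurable_halfSign.comp hf.measurable)).aestronglyMeasurable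
  · simp only [norm_mul, Real.norm_eq_abs, abs_halfSign, mul_one, abs_one]
    exact abs_unitVec_le α j

/-- The circle is split into the half circles where `cos (α - β)` is positive and negative. -/
theorem integral_unitVec_mul_halfSign (β : ℝ) (j : Fin 2) :
    ∫ α in (0 : ℝ)..2 * Real.pi, unitVec α j * halfSign (Real.cos (α - β)) = 4 * unitVec β j := by
  have hc : Continuous fun α => Real.cos (α - β) := by fun_prop
  have hper : Function.Periodic (fun α => unitVec α j * halfSign (Real.cos (α - β)))
      (2 * Real.pi) := by
    intro α
    have h1 : unitVec (α + 2 * Real.pi) = unitVec α := by simp [unitVec]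
    have h2 : Real.cos (α + 2 * Real.pi - β) = Real.cos (α - β) := by
      rw [show α + 2 * Real.pi - β = α - β + 2 * Real.pi by ring, Real.cos_add_two_pi]
    simp only [h1, h2]
  have hpi := Real.pi_pos
  have h := hper.intervalIntegral_add_eq 0 (β - Real.pi / 2)
  rw [zero_add] at h
  rw [h, ← intervalIntegral.integral_add_adjacent_intervals (b := β + Real.pi / 2)
    (intervalIntegrable_unitVec_mul hc j _ _) (intervalIntegrable_unitVec_mul hc j _ _)]
  have e1 : ∫ α in (β - Real.pi / 2)..(β + Real.pi / 2), unitVec α j * halfSign (Real.cos (α - β))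
      = ∫ α in (β - Real.pi / 2)..(β + Real.pi / 2), unitVec α j := by
    refine intervalIntegral.integral_congr_Ioo_of_le (by linarith) fun α hα => ?_
    have : 0 < Real.cos (α - β) :=
      Real.cos_pos_of_mem_Ioo ⟨by linarith [hα.1], by linarith [hα.2]⟩
    simp [halfSign, this]
  have e2 : ∫ α in (β + Real.pi / 2)..(β - Real.pi / 2 + 2 * Real.pi),
      unitVec α j * halfSign (Real.cos (α - β))
      = ∫ α in (β + Real.pi / 2)..(β - Real.pi / 2 + 2 * Real.pi), -unitVec α j := by
    refine intervalIntegral.integral_congr_Ioo_of_le (by linarith) fun α hα => ?_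
    have : Real.cos (α - β) ≤ 0 :=
      Real.cos_nonpos_of_pi_div_two_le_of_le (by linarith [hα.1]) (by linarith [hα.2])
    simp [halfSign, not_lt.2 this]
  rw [e1, e2, intervalIntegral.integral_neg]
  have s1 : Real.sin (β - Real.pi / 2 + 2 * Real.pi) = -Real.cos β := by
    rw [Real.sin_add_two_pi, Real.sin_sub_pi_div_two]
  have s2 : Real.cos (β - Real.pi / 2 + 2 * Real.pi) = Real.sin β := by
    rw [Real.cos_add_two_pi, Real.cos_sub_pi_div_two]
  fin_cases j
  · change (∫ α in _..(_ : ℝ), Real.cos α) + -∫ α in _..(_ : ℝ), Real.cos α = 4 * Real.cos β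
    rw [integral_cos, integral_cos, s1, Real.sin_add_pi_div_two, Real.sin_sub_pi_div_two]
    ring
  · change (∫ α in _..(_ : ℝ), Real.sin α) + -∫ α in _..(_ : ℝ), Real.sin α = 4 * Real.sin β
    rw [integral_sin, integral_sin, s2, Real.cos_add_pi_div_two, Real.cos_sub_pi_div_two]
    ring

/-- The symbol `-i kⱼ / |k|` of the `j`-th Riesz transform. -/
def rieszSymbol (j : Fin 2) (k : Freq) : ℂ := -Complex.I * (k j / √(freqSq k) : ℝ)

theorem integral_unitVec_mul_halfSign_phase {k : Freq} (hk : k ≠ 0) (j : Fin 2) :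
    ∫ α in (0 : ℝ)..2 * Real.pi, unitVec α j * halfSign (phase k (unitVec α))
      = 4 * (k j / √(freqSq k)) := by
  obtain ⟨β, h1, h2⟩ := exists_phase_unitVec k
  have hr : 0 < √(freqSq k) := Real.sqrt_pos.2 (freqSq_pos hk)
  simp_rw [h2, halfSign_mul hr]
  rw [integral_unitVec_mul_halfSign, h1 j, mul_div_cancel_left₀ _ hr.ne']

theorem ae_phase_ne_zero {k : Freq} (hk : k ≠ 0) : ∀ᵐ α : ℝ, phase k (unitVec α) ≠ 0 := by
  obtain ⟨β, -, h2⟩ := exists_phase_unitVec k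
  have hr : √(freqSq k) ≠ 0 := (Real.sqrt_pos.2 (freqSq_pos hk)).ne'
  have hcount : (Set.range fun n : ℤ => (2 * n + 1) * Real.pi / 2 + β).Countable :=
    Set.countable_range _
  filter_upwards [hcount.ae_notMem volume] with α hα h
  rw [h2, mul_eq_zero, or_iff_right hr] at h
  obtain ⟨n, hn⟩ := Real.cos_eq_zero_iff.1 h
  exact hα ⟨n, by simp only []; linarith⟩

theorem mult_eq_sum (m : Freq → ℂ) (c : Freq →₀ ℂ) :
    mult m c = ∑ k ∈ c.support, Finsupp.single k (m k * c k) := by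
  ext j
  rw [mult_apply, Finsupp.finsetSum_apply]
  by_cases hj : j ∈ c.support
  · rw [Finset.sum_eq_single_of_mem j hj fun k _ hk => by simp [hk]]
    simp
  · rw [Finsupp.notMem_support_iff.1 hj, mul_zero, Finset.sum_eq_zero]
    intro k hk
    have : k ≠ j := fun h => hj (h ▸ hk)
    simp [this]

/-- The Riesz transforms are bounded on `Lᵖ`, as averages of directional Hilbert transforms:
`4 k / |k| = ∫ θ sgn (k · θ) dθ` over the unit circle. -/
theorem exists_norm_riesz_le {p : ℝ≥0∞} [Fact (1 ≤ p)] (h1 : 1 < p) (hp : p ≠ ⊤) :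
    ∃ C : ℝ, 0 < C ∧ ∀ (c : Freq →₀ ℂ) (j : Fin 2), c 0 = 0 →
      ‖trigLp p (mult (rieszSymbol j) c)‖ ≤ C * ‖trigLp p c‖ := by
  obtain ⟨C, hC, h⟩ := exists_norm_hilbert_le h1 hp
  refine ⟨C * (2 * Real.pi), by positivity, fun c j hc => ?_⟩
  have hk0 : ∀ k ∈ c.support, k ≠ 0 := fun k hk h0 => by
    rw [Finsupp.mem_support_iff, h0] at hk; exact hk hc
  let v : Freq → Lp ℝ p (volume : Measure T2) := fun k =>
    trigLp p (Finsupp.single k (-Complex.I * c k))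
  have hv : ∀ (r : ℝ) (k : Freq), trigLp p (Finsupp.single k (-Complex.I * r * c k)) = r • v k := by
    intro r k
    rw [← map_smul, Finsupp.smul_single]
    congr 2
    rw [Complex.real_smul]
    ring
  have e1 : ∀ α, trigLp p (mult (hilbertSymbol (unitVec α)) c)
      = ∑ k ∈ c.support, halfSign (phase k (unitVec α)) • v k := by
    intro α
    rw [mult_eq_sum, map_sum]
    exact Finset.sum_congr rfl fun k _ => hv _ k
  have e2 : trigLp p (mult (rieszSymbol j) c)
      = ∑ k ∈ c.support, (k j / √(freqSq k) : ℝ) • v k := by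
    rw [mult_eq_sum, map_sum]
    exact Finset.sum_congr rfl fun k _ => hv _ k
  -- The integral over the directions, with values in `Lᵖ`.
  have e3 : (4 : ℝ) • trigLp p (mult (rieszSymbol j) c)
      = ∫ α in (0 : ℝ)..2 * Real.pi,
        unitVec α j • trigLp p (mult (hilbertSymbol (unitVec α)) c) := by
    simp_rw [e1, Finset.smul_sum, smul_smul]
    rw [intervalIntegral.integral_finsetSum]
    · rw [e2, Finset.smul_sum]
      refine Finset.sum_congr rfl fun k hk => ?_
      rw [intervalIntegral.integral_smul_const, integral_unitVec_mul_halfSign_phase (hk0 k hk),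
        smul_smul]
    · intro k _
      have := intervalIntegrable_unitVec_mul (continuous_phase_unitVec k) j 0 (2 * Real.pi)
      exact ⟨this.1.smul_const _, this.2.smul_const _⟩
  have hae : ∀ᵐ α : ℝ, ∀ k ∈ c.support, phase k (unitVec α) ≠ 0 :=
    (Finset.eventually_all _).2 fun k hk => ae_phase_ne_zero (hk0 k hk)
  have h4 := intervalIntegral.norm_integral_le_of_norm_le_const_ae (a := 0) (b := 2 * Real.pi)
    (f := fun α => unitVec α j • trigLp p (mult (hilbertSymbol (unitVec α)) c))
    (C := C * ‖trigLp p c‖) (by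
      filter_upwards [hae] with α hα _
      rw [norm_smul, Real.norm_eq_abs]
      have := h c (unitVec α) hα
      nlinarith [abs_unitVec_le α j, norm_nonneg (trigLp p (mult (hilbertSymbol (unitVec α)) c))])
  rw [← e3, norm_smul, sub_zero, abs_of_pos Real.two_pi_pos] at h4
  have h5 : ‖(4 : ℝ)‖ = 4 := by norm_num
  rw [h5] at h4
  nlinarith [norm_nonneg (trigLp p (mult (rieszSymbol j) c))]

/-- Second derivatives of `(-Δ)⁻¹` are products of two Riesz transforms; both sides vanish at
`0`. -/
theorem deriv_deriv_invLap (i j : Fin 2) :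
    derivSymbol i * (derivSymbol j * invLapSymbol) = rieszSymbol i * rieszSymbol j := by
  funext k
  simp only [Pi.mul_apply, derivSymbol, invLapSymbol, rieszSymbol]
  have hs : (√(freqSq k) : ℂ) * (√(freqSq k) : ℂ) = freqSq k := by
    rw [← Complex.ofReal_mul, Real.mul_self_sqrt]
    unfold freqSq; positivity
  have hpi : (Real.pi : ℂ) ≠ 0 := by exact_mod_cast Real.pi_ne_zero
  by_cases hk : k = 0
  · subst hk; simp
  · have h : (freqSq k : ℂ) ≠ 0 := by exact_mod_cast (freqSq_pos hk).ne'
    have h' : (√(freqSq k) : ℂ) ≠ 0 := by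
      intro h0; rw [h0] at hs; exact h (by rw [← hs, zero_mul])
    push_cast
    rw [← hs]
    field_simp
    ring

/-- **The Calderón–Zygmund inequality** for trigonometric polynomials. -/
theorem exists_norm_hessian_le {p : ℝ≥0∞} [Fact (1 ≤ p)] (h1 : 1 < p) (hp : p ≠ ⊤) :
    ∃ C : ℝ, 0 < C ∧ ∀ (c : Freq →₀ ℂ) (i j : Fin 2), c 0 = 0 →
      ‖trigLp p (mult (derivSymbol i * (derivSymbol j * invLapSymbol)) c)‖
        ≤ C * ‖trigLp p c‖ := by
  obtain ⟨C, hC, h⟩ := exists_norm_riesz_le h1 hp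
  refine ⟨C * C, by positivity, fun c i j hc => ?_⟩
  rw [deriv_deriv_invLap, ← mult_mult]
  refine (h _ i (by rw [mult_apply, hc, mul_zero])).trans ?_
  rw [mul_assoc]
  exact mul_le_mul_of_nonneg_left (h c j hc) hC.le

/-! ### A uniform bound by second derivatives -/

instance isProbabilityMeasure_circle : IsProbabilityMeasure (volume : Measure UnitAddCircle) :=
  ⟨UnitAddCircle.measure_univ⟩

/-- The mean of `g` along the closed line through `x` in the direction of the `i`-th axis. -/
def lineMean (i : Fin 2) (g : T2 → ℝ) (x : T2) : ℝ := ∫ z : UnitAddCircle, g (x + Pi.single i z)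

theorem continuous_add_single (i : Fin 2) :
    Continuous fun q : T2 × UnitAddCircle => q.1 + (Pi.single i q.2 : T2) := by
  refine continuous_fst.add (continuous_pi fun j => ?_)
  by_cases h : j = i
  · subst h; simpa using continuous_snd
  · simpa [Pi.single_apply, h] using continuous_const

theorem continuous_lineMean (i : Fin 2) {g : T2 → ℝ} (hg : Continuous g) :
    Continuous (lineMean i g) := by
  have h : Continuous (Function.uncurry fun (x : T2) (z : UnitAddCircle) =>
      g (x + Pi.single i z)) := hg.comp (continuous_add_single i)
  have := continuous_parametric_integral_of_continuous (μ := (volume : Measure UnitAddCircle)) h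
    isCompact_univ
  rw [Measure.restrict_univ] at this
  exact this

theorem integrable_line (i : Fin 2) {g : T2 → ℝ} (hg : Continuous g) (x : T2) :
    Integrable fun z : UnitAddCircle => g (x + Pi.single i z) :=
  (hg.comp ((continuous_add_single i).comp
    (Continuous.prodMk_right x))).integrable_of_hasCompactSupport
    (HasCompactSupport.of_compactSpace _)

theorem integrable_of_continuous {g : T2 → ℝ} (hg : Continuous g) : Integrable g volume :=
  (memLp_of_continuous hg 1).integrable le_rfl

theorem lineMean_mono (i : Fin 2) {g h : T2 → ℝ} (hg : Continuous g) (hh : Continuous h)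
    (hgh : ∀ x, g x ≤ h x) (x : T2) : lineMean i g x ≤ lineMean i h x :=
  integral_mono (integrable_line i hg x) (integrable_line i hh x) fun _ => hgh _

theorem lineMean_add (i : Fin 2) {g h : T2 → ℝ} (hg : Continuous g) (hh : Continuous h) (x : T2) :
    lineMean i (fun x => g x + h x) x = lineMean i g x + lineMean i h x :=
  integral_add (integrable_line i hg x) (integrable_line i hh x)

theorem integral_lineMean (i : Fin 2) {g : T2 → ℝ} (hg : Continuous g) :
    ∫ x, lineMean i g x = ∫ x, g x := by
  have hc : Continuous (Function.uncurry fun (x : T2) (z : UnitAddCircle) =>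
      g (x + Pi.single i z)) := hg.comp (continuous_add_single i)
  refine (integral_integral_swap_of_hasCompactSupport hc
    (HasCompactSupport.of_compactSpace _)).trans ?_
  have : ∀ z : UnitAddCircle, ∫ x : T2, g (x + Pi.single i z) = ∫ x, g x := fun z =>
    integral_add_right_eq_self (μ := (volume : Measure T2)) g _
  simp_rw [this]
  simp

theorem lineMean_lineMean {g : T2 → ℝ} (hg : Continuous g) (x : T2) :
    lineMean 0 (lineMean 1 g) x = ∫ x, g x := by
  have h1 : ∫ y, g y = ∫ y, g (x + y) :=
    (integral_add_left_eq_self (μ := (volume : Measure T2)) g x).symm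
  have e := (volume_preserving_finTwoArrow UnitAddCircle).symm
  rw [h1, ← e.integral_comp', Measure.volume_eq_prod, integral_prod]
  · refine integral_congr_ae (Filter.Eventually.of_forall fun z => ?_)
    refine integral_congr_ae (Filter.Eventually.of_forall fun w => ?_)
    simp only [add_assoc]
    congr 2
    funext j
    fin_cases j
    · simp
    · simp
  · have hc : Continuous fun q : UnitAddCircle × UnitAddCircle =>
        g (x + MeasurableEquiv.finTwoArrow.symm q) := by
      refine hg.comp (continuous_const.add (continuous_pi fun j => ?_))
      fin_cases j
      · exact continuous_fst
      · exact continuous_snd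
    exact hc.integrable_of_hasCompactSupport (HasCompactSupport.of_compactSpace _)

/-- The fundamental theorem of calculus along a closed line. -/
theorem abs_sub_le_lineMean {v : T2 → ℝ} (hv : IsSmooth v) (i : Fin 2) (x : T2)
    (z : UnitAddCircle) :
    |v (x + Pi.single i z) - v x| ≤ lineMean i (fun y => |pderiv i v y|) x := by
  obtain ⟨s, hs, rfl⟩ : ∃ s ∈ Set.Ico (0 : ℝ) (0 + 1), (s : UnitAddCircle) = z := by
    have := AddCircle.coe_image_Ico_eq (1 : ℝ) 0
    have hz : z ∈ ((↑) : ℝ → UnitAddCircle) '' Set.Ico (0 : ℝ) (0 + 1) := by rw [this]; trivial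
    exact hz
  rw [zero_add] at hs
  have hcont : Continuous fun t : ℝ => pderiv i v (x + Pi.single i (t : UnitAddCircle)) :=
    (hv.pderiv i).continuous.comp ((continuous_add_single i).comp
      ((Continuous.prodMk_right x).comp (AddCircle.continuous_mk' 1)))
  have h1 : ∫ t in (0 : ℝ)..s, pderiv i v (x + Pi.single i (t : UnitAddCircle))
      = v (x + Pi.single i (s : UnitAddCircle)) - v x := by
    rw [intervalIntegral.integral_eq_sub_of_hasDerivAt
      (f := fun t : ℝ => v (x + Pi.single i (t : UnitAddCircle)))
      (fun t _ => hv.hasDerivAt i x t) (hcont.intervalIntegrable _ _)]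
    simp
  have h2 : lineMean i (fun y => |pderiv i v y|) x
      = ∫ t in (0 : ℝ)..1, |pderiv i v (x + Pi.single i (t : UnitAddCircle))| := by
    have := UnitAddCircle.intervalIntegral_preimage 0
      fun z : UnitAddCircle => |pderiv i v (x + Pi.single i z)|
    rw [zero_add] at this
    exact this.symm
  rw [← h1, h2]
  refine (intervalIntegral.abs_integral_le_integral_abs hs.1).trans ?_
  exact intervalIntegral.integral_mono_interval le_rfl hs.1 hs.2.le
    (Filter.Eventually.of_forall fun _ => abs_nonneg _) (hcont.abs.intervalIntegrable _ _)

theorem abs_sub_lineMean_le {v : T2 → ℝ} (hv : IsSmooth v) (i : Fin 2) (x : T2) :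
    |v x - lineMean i v x| ≤ lineMean i (fun y => |pderiv i v y|) x := by
  have h1 : v x - lineMean i v x = ∫ z : UnitAddCircle, (v x - v (x + Pi.single i z)) := by
    rw [integral_sub (integrable_const _) (integrable_line i hv.continuous x)]
    simp [lineMean]
  have h2 := norm_integral_le_of_norm_le_const (μ := (volume : Measure UnitAddCircle))
    (f := fun z => v x - v (x + Pi.single i z))
    (C := lineMean i (fun y => |pderiv i v y|) x) (Filter.Eventually.of_forall fun z => by
      rw [Real.norm_eq_abs, abs_sub_comm]; exact abs_sub_le_lineMean hv i x z)
  rw [← h1] at h2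
  simpa using h2

theorem lineMean_pderiv {v : T2 → ℝ} (hv : IsSmooth v) (i : Fin 2) (x : T2) :
    lineMean i (pderiv i v) x = 0 := by
  have h2 := UnitAddCircle.intervalIntegral_preimage 0
      fun z : UnitAddCircle => pderiv i v (x + Pi.single i z)
  have hcont : Continuous fun t : ℝ => pderiv i v (x + Pi.single i (t : UnitAddCircle)) :=
    (hv.pderiv i).continuous.comp ((continuous_add_single i).comp
      ((Continuous.prodMk_right x).comp (AddCircle.continuous_mk' 1)))
  unfold lineMean
  rw [← h2, zero_add, intervalIntegral.integral_eq_sub_of_hasDerivAt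
      (f := fun t : ℝ => v (x + Pi.single i (t : UnitAddCircle)))
      (fun t _ => hv.hasDerivAt i x t) (hcont.intervalIntegrable _ _)]
  have : ((1 : ℝ) : UnitAddCircle) = 0 := AddCircle.coe_period 1
  simp [this]

/-- Poincaré's inequality in `L¹` on lines, on which a derivative has mean zero. -/
theorem integral_abs_pderiv_le {v : T2 → ℝ} (hv : IsSmooth v) (i : Fin 2) :
    ∫ x, |pderiv i v x| ≤ ∫ x, |pderiv i (pderiv i v) x| := by
  have hc := ((hv.pderiv i).pderiv i).continuous.abs
  rw [← integral_lineMean i hc]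
  refine integral_mono (integrable_of_continuous (hv.pderiv i).continuous.abs)
    (integrable_of_continuous (continuous_lineMean i hc)) fun x => ?_
  have := abs_sub_lineMean_le (hv.pderiv i) i x
  rwa [lineMean_pderiv hv, sub_zero] at this

theorem integral_abs_le_of_integral_eq_zero {v : T2 → ℝ} (hv : IsSmooth v) (h0 : ∫ x, v x = 0) :
    ∫ x, |v x| ≤ (∫ x, |pderiv 0 v x|) + ∫ x, |pderiv 1 v x| := by
  have hc0 := (hv.pderiv 0).continuous.abs
  have hc1 := (hv.pderiv 1).continuous.abs
  have hm := continuous_lineMean 1 hv.continuous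
  have h : ∀ x, |v x| ≤ lineMean 0 (fun y => |pderiv 0 v y|) x + ∫ x, |pderiv 1 v x| := by
    intro x
    have h1 := abs_sub_lineMean_le hv 0 x
    have h2 : |lineMean 0 v x| ≤ ∫ x, |pderiv 1 v x| := by
      have e : lineMean 0 v x = ∫ z : UnitAddCircle,
          (v (x + Pi.single 0 z) - lineMean 1 v (x + Pi.single 0 z)) := by
        rw [integral_sub (integrable_line 0 hv.continuous x) (integrable_line 0 hm x)]
        have : ∫ z : UnitAddCircle, lineMean 1 v (x + Pi.single 0 z) = 0 := by
          rw [← h0]; exact lineMean_lineMean hv.continuous x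
        rw [this, sub_zero]; rfl
      rw [e, ← lineMean_lineMean hc1 x]
      refine (abs_integral_le_integral_abs).trans ?_
      refine integral_mono ((integrable_line 0 (hv.continuous.sub hm) x).abs)
        (integrable_line 0 (continuous_lineMean 1 hc1) x) fun z => ?_
      exact abs_sub_lineMean_le hv 1 _
    have h3 := abs_add_le (v x - lineMean 0 v x) (lineMean 0 v x)
    rw [sub_add_cancel] at h3
    linarith
  have hcl := continuous_lineMean 0 hc0
  calc ∫ x, |v x| ≤ ∫ x, (lineMean 0 (fun y => |pderiv 0 v y|) x + ∫ x, |pderiv 1 v x|) :=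
        integral_mono (integrable_of_continuous hv.continuous.abs)
          (integrable_of_continuous (hcl.add continuous_const)) h
    _ = _ := by
        rw [integral_add (integrable_of_continuous hcl) (integrable_const _),
          integral_lineMean 0 hc0]
        simp

theorem abs_le_lineMean {v : T2 → ℝ} (hv : IsSmooth v) (i : Fin 2) (x : T2) :
    |v x| ≤ lineMean i (fun y => |v y| + |pderiv i v y|) x := by
  rw [lineMean_add i hv.continuous.abs (hv.pderiv i).continuous.abs]
  have h1 := abs_sub_lineMean_le hv i x
  have h2 : |lineMean i v x| ≤ lineMean i (fun y => |v y|) x := abs_integral_le_integral_abs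
  have h3 := abs_add_le (v x - lineMean i v x) (lineMean i v x)
  rw [sub_add_cancel] at h3
  linarith

theorem abs_le_integral_of_isSmooth {u : T2 → ℝ} (hu : IsSmooth u) (x : T2) :
    |u x| ≤ (∫ y, |u y|) + (∫ y, |pderiv 1 u y|) + (∫ y, |pderiv 0 u y|)
      + ∫ y, |pderiv 1 (pderiv 0 u) y| := by
  have c0 := hu.continuous.abs
  have c1 := (hu.pderiv 1).continuous.abs
  have c2 := (hu.pderiv 0).continuous.abs
  have c3 := ((hu.pderiv 0).pderiv 1).continuous.abs
  have c01 : Continuous fun y => |u y| + |pderiv 1 u y| := c0.add c1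
  have c23 : Continuous fun y => |pderiv 0 u y| + |pderiv 1 (pderiv 0 u) y| := c2.add c3
  have h1 := abs_le_lineMean hu 0 x
  have h2 := lineMean_mono 0 (c0.add c2)
    ((continuous_lineMean 1 c01).add (continuous_lineMean 1 c23))
    (fun y => add_le_add (abs_le_lineMean hu 1 y) (abs_le_lineMean (hu.pderiv 0) 1 y)) x
  have h3 : lineMean 0 (fun y => lineMean 1 (fun y => |u y| + |pderiv 1 u y|) y
      + lineMean 1 (fun y => |pderiv 0 u y| + |pderiv 1 (pderiv 0 u) y|) y) x
      = (∫ y, |u y|) + (∫ y, |pderiv 1 u y|) + (∫ y, |pderiv 0 u y|)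
      + ∫ y, |pderiv 1 (pderiv 0 u) y| := by
    rw [lineMean_add 0 (continuous_lineMean 1 c01) (continuous_lineMean 1 c23),
      lineMean_lineMean c01, lineMean_lineMean c23,
      integral_add (integrable_of_continuous c0) (integrable_of_continuous c1),
      integral_add (integrable_of_continuous c2) (integrable_of_continuous c3)]
    ring
  exact h1.trans (h2.trans (le_of_eq h3))

/-- In dimension two, `W^{2,1}` embeds into `L^∞`. -/
theorem abs_le_integral_hessian {u : T2 → ℝ} (hu : IsSmooth u) (h0 : ∫ x, u x = 0) (x : T2) :
    |u x| ≤ 2 * (∫ y, |pderiv 0 (pderiv 0 u) y|) + 2 * (∫ y, |pderiv 1 (pderiv 1 u) y|)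
      + ∫ y, |pderiv 1 (pderiv 0 u) y| := by
  have h1 := abs_le_integral_of_isSmooth hu x
  have h2 := integral_abs_le_of_integral_eq_zero hu h0
  have h3 := integral_abs_pderiv_le hu 0
  have h4 := integral_abs_pderiv_le hu 1
  linarith

/-! ### The Poisson equation with an `Lᵖ` right-hand side -/

/-- Extension by continuity of an estimate `‖A v‖ ≤ K ‖B v‖` to a limit of the `B v`, keeping track
of approximations. -/
theorem exists_tendsto_of_norm_le {V X Y : Type*} [AddCommGroup V] [Module ℝ V]
    [NormedAddCommGroup X] [NormedSpace ℝ X] [NormedAddCommGroup Y] [NormedSpace ℝ Y]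
    [CompleteSpace Y] (A : V →ₗ[ℝ] Y) (B : V →ₗ[ℝ] X) {K : ℝ}
    (h : ∀ v, ‖A v‖ ≤ K * ‖B v‖) {g : X} (hg : g ∈ closure (Set.range B)) :
    ∃ (c : ℕ → V) (y : Y), Filter.Tendsto (fun n => B (c n)) Filter.atTop (nhds g) ∧
      Filter.Tendsto (fun n => A (c n)) Filter.atTop (nhds y) ∧ ‖y‖ ≤ K * ‖g‖ := by
  obtain ⟨x, hx, hlim⟩ := mem_closure_iff_seq_limit.1 hg
  choose c hc using hx
  have hB : Filter.Tendsto (fun n => B (c n)) Filter.atTop (nhds g) := by simpa only [hc] using hlim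
  have hdist : ∀ m n, dist (A (c m)) (A (c n)) ≤ K * dist (B (c m)) (B (c n)) := fun m n => by
    rw [dist_eq_norm, dist_eq_norm, ← map_sub, ← map_sub]; exact h _
  have hcau : CauchySeq fun n => A (c n) := by
    have hd := hB.cauchySeq
    rw [Metric.cauchySeq_iff'] at hd ⊢
    intro ε hε
    obtain ⟨N, hN⟩ := hd (ε / (|K| + 1)) (by positivity)
    refine ⟨N, fun n hn => ?_⟩
    have h1 := hN n hn
    rw [lt_div_iff₀ (by positivity)] at h1
    have h2 := hdist n N
    have h3 : K * dist (B (c n)) (B (c N)) ≤ |K| * dist (B (c n)) (B (c N)) :=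
      mul_le_mul_of_nonneg_right (le_abs_self K) dist_nonneg
    have h4 : 0 ≤ dist (B (c n)) (B (c N)) := dist_nonneg
    linarith
  obtain ⟨y, hy⟩ := cauchySeq_tendsto_of_complete hcau
  exact ⟨c, y, hB, hy, le_of_tendsto_of_tendsto' hy.norm (hB.norm.const_mul K) fun n => h _⟩

/-- The matrix-valued function with the single entry `f` at place `ij`. -/
def entryLp (p : ℝ≥0∞) [Fact (1 ≤ p)] (ij : Fin 2 × Fin 2) :
    Lp ℝ p (volume : Measure T2) →L[ℝ] Lp Mat2 p (volume : Measure T2) :=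
  (ContinuousLinearMap.toSpanSingleton ℝ (EuclideanSpace.single ij (1 : ℝ) : Mat2)).compLpL p volume

theorem norm_entryLp_le (p : ℝ≥0∞) [Fact (1 ≤ p)] (ij : Fin 2 × Fin 2)
    (f : Lp ℝ p (volume : Measure T2)) : ‖entryLp p ij f‖ ≤ ‖f‖ := by
  refine (ContinuousLinearMap.norm_compLp_le _ f).trans ?_
  rw [ContinuousLinearMap.norm_toSpanSingleton]
  simp

theorem compLp_entryLp (p : ℝ≥0∞) [Fact (1 ≤ p)] (ij kl : Fin 2 × Fin 2)
    (f : Lp ℝ p (volume : Measure T2)) :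
    compLp p kl (entryLp p ij f) = if kl = ij then f else 0 := by
  apply Lp.ext
  have h1 := coeFn_compLp p kl (entryLp p ij f)
  have h2 : entryLp p ij f =ᵐ[volume] fun x => f x • (EuclideanSpace.single ij (1 : ℝ) : Mat2) :=
    ContinuousLinearMap.coeFn_compLp _ f
  split_ifs with h
  · filter_upwards [h1, h2] with x hx1 hx2
    rw [hx1, hx2]
    simp [h]
  · filter_upwards [h1, h2, Lp.coeFn_zero ℝ p (volume : Measure T2)] with x hx1 hx2 hx3
    rw [hx1, hx2, hx3]
    simp [h]

/-- The Hessian of the solution of `-Δu = f`, for a trigonometric polynomial `f`. -/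
def hessLp (p : ℝ≥0∞) [Fact (1 ≤ p)] : (Freq →₀ ℂ) →ₗ[ℝ] Lp Mat2 p (volume : Measure T2) :=
  ∑ ij : Fin 2 × Fin 2, (entryLp p ij).toLinearMap ∘ₗ trigLp p ∘ₗ
    mult (derivSymbol ij.1 * (derivSymbol ij.2 * invLapSymbol))

theorem hessLp_apply (p : ℝ≥0∞) [Fact (1 ≤ p)] (c : Freq →₀ ℂ) :
    hessLp p c = ∑ ij : Fin 2 × Fin 2,
      entryLp p ij (trigLp p (mult (derivSymbol ij.1 * (derivSymbol ij.2 * invLapSymbol)) c)) := by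
  simp only [hessLp, LinearMap.sum_apply]
  rfl

theorem compLp_hessLp (p : ℝ≥0∞) [Fact (1 ≤ p)] (c : Freq →₀ ℂ) (i j : Fin 2) :
    compLp p (i, j) (hessLp p c)
      = trigLp p (mult (derivSymbol i * (derivSymbol j * invLapSymbol)) c) := by
  rw [hessLp_apply, map_sum]
  simp_rw [compLp_entryLp]
  simp

theorem pairing_trigLp (p : ℝ≥0∞) [Fact (1 ≤ p)] (h : C(T2, ℝ)) (c : Freq →₀ ℂ) :
    pairing p h (trigLp p c) = ∫ x, trig c x * h x := by
  rw [pairing_apply]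
  apply integral_congr_ae
  filter_upwards [coeFn_trigLp p c] with x hx
  rw [hx]

theorem integral_abs_trig_le (p : ℝ≥0∞) [Fact (1 ≤ p)] (c : Freq →₀ ℂ) :
    ∫ x, |trig c x| ≤ ‖trigLp p c‖ := by
  have h := integral_norm_le_eLpNorm Fact.out (Lp.memLp (trigLp p c))
  rw [← Lp.norm_def] at h
  refine le_trans (le_of_eq ?_) h
  apply integral_congr_ae
  filter_upwards [coeFn_trigLp p c] with x hx
  rw [hx, Real.norm_eq_abs]

theorem integral_trig_mul_pderiv_pderiv (c : Freq →₀ ℂ) {η : T2 → ℝ} (hη : IsSmooth η)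
    (i j : Fin 2) : ∫ x, trig c x * pderiv i (pderiv j η) x
      = ∫ x, trig (mult (derivSymbol i * derivSymbol j) c) x * η x := by
  rw [integral_mul_pderiv (trig_isSmooth c) (hη.pderiv j), pderiv_trig,
    integral_mul_pderiv (trig_isSmooth _) hη, pderiv_trig, mult_mult, neg_neg, mul_comm]

theorem mult_meanZero_idem (c : Freq →₀ ℂ) :
    mult meanZeroSymbol (mult meanZeroSymbol c) = mult meanZeroSymbol c := by
  ext k
  simp only [mult_apply, meanZeroSymbol]
  split_ifs <;> simp

theorem mult_meanZero_zero (c : Freq →₀ ℂ) : mult meanZeroSymbol c 0 = 0 := by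
  simp [mult_apply, meanZeroSymbol]

theorem mult_invLap_eq_meanZero (b : Freq →₀ ℂ) :
    mult invLapSymbol b = mult meanZeroSymbol (mult invLapSymbol b) := by
  ext k
  simp only [mult_apply, meanZeroSymbol]
  split_ifs with hk
  · subst hk; simp [invLapSymbol, freqSq]
  · simp

/-- On trigonometric polynomials `invLapSymbol` solves the Poisson equation in the weak sense. -/
theorem inner_grad_invLap (c : Freq →₀ ℂ) {η : T2 → ℝ} (hη : IsSmooth η) :
    inner ℝ (trigH1 (mult invLapSymbol (mult meanZeroSymbol c))).grad (H1.ofSmooth η hη).grad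
      = ∫ x, trig (mult meanZeroSymbol c) x * η x := by
  set b := mult meanZeroSymbol c with hb
  have hi : ∀ i, ∫ x, (trigH1 (mult invLapSymbol b)).grad x i * pderiv i η x
      = -∫ x, trig (mult (derivSymbol i * (derivSymbol i * invLapSymbol)) b) x * η x := by
    intro i
    have h1 : ∫ x, (trigH1 (mult invLapSymbol b)).grad x i * pderiv i η x
        = ∫ x, pderiv i (trig (mult invLapSymbol b)) x * pderiv i η x := by
      apply integral_congr_ae
      filter_upwards [coeFn_grad_ofSmooth_apply (trig_isSmooth (mult invLapSymbol b)) i] with x hx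
      rw [trigH1_apply, hx]
    rw [h1, pderiv_trig, integral_mul_pderiv (trig_isSmooth _) hη, pderiv_trig, mult_mult,
      mult_mult, mul_assoc]
  rw [inner_grad_ofSmooth, hi, hi, ← neg_add]
  have hint : ∀ d, Integrable fun x => trig d x * η x := fun d =>
    integrable_of_continuous ((trig d).continuous.mul hη.continuous)
  rw [← integral_add (hint _) (hint _), ← integral_neg]
  refine integral_congr_ae (Filter.Eventually.of_forall fun x => ?_)
  have e : trig (mult (derivSymbol 0 * (derivSymbol 0 * invLapSymbol)) b) x
      + trig (mult (derivSymbol 1 * (derivSymbol 1 * invLapSymbol)) b) x = - trig b x := by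
    rw [← ContinuousMap.add_apply, ← map_add, ← mult_add, derivSymbol_sq_mul_invLapSymbol, mult_neg,
      hb, mult_meanZero_idem, map_neg, ContinuousMap.neg_apply]
  simp only []
  rw [← add_mul, e]
  ring

theorem norm_fn_trigH1_le (c : Freq →₀ ℂ) : ‖(trigH1 c).fn‖ ≤ ‖trig c‖ := by
  have := Lp.norm_le_of_ae_bound (f := (trigH1 c).fn) (norm_nonneg (trig c)) (by
    filter_upwards [coeFn_fn_ofSmooth (trig_isSmooth c)] with x hx
    rw [trigH1_apply, hx]
    exact (trig c).norm_coe_le_norm x)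
  simpa [measureUnivNNReal] using this

/-- The a priori estimates for `-Δu = f` with a mean-zero trigonometric polynomial `f`. -/
theorem exists_apriori {p : ℝ≥0∞} [Fact (1 ≤ p)] (h1 : 1 < p) (hp : p ≠ ⊤) :
    ∃ K : ℝ, 0 < K ∧ ∀ c : Freq →₀ ℂ,
      ‖trig (mult invLapSymbol (mult meanZeroSymbol c))‖ ≤ K * ‖trigLp p (mult meanZeroSymbol c)‖ ∧
      ‖trigH1 (mult invLapSymbol (mult meanZeroSymbol c))‖
        ≤ K * ‖trigLp p (mult meanZeroSymbol c)‖ ∧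
      ‖hessLp p (mult meanZeroSymbol c)‖ ≤ K * ‖trigLp p (mult meanZeroSymbol c)‖ := by
  obtain ⟨C, hC, h⟩ := exists_norm_hessian_le h1 hp
  refine ⟨5 * C + 1, by positivity, fun c => ?_⟩
  have hb0 := mult_meanZero_zero c
  have hinner := @inner_grad_invLap c
  set b := mult meanZeroSymbol c
  set G := ‖trigLp p b‖
  have hG : 0 ≤ G := norm_nonneg _
  have hsup : ‖trig (mult invLapSymbol b)‖ ≤ 5 * C * G := by
    rw [ContinuousMap.norm_le _ (by positivity)]
    intro x
    have h2 := abs_le_integral_hessian (trig_isSmooth (mult invLapSymbol b)) (by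
      rw [mult_invLap_eq_meanZero]; exact integral_trig_meanZero _) x
    simp only [pderiv_trig, mult_mult] at h2
    have h3 : ∀ i j, ∫ y, |trig (mult (derivSymbol i * (derivSymbol j * invLapSymbol)) b) y|
        ≤ C * G := fun i j => (integral_abs_trig_le p _).trans (h b i j hb0)
    have := h3 0 0
    have := h3 1 1
    have := h3 1 0
    rw [Real.norm_eq_abs]
    linarith
  refine ⟨hsup.trans (by nlinarith), ?_, ?_⟩
  · have hgrad : ‖(trigH1 (mult invLapSymbol b)).grad‖ ^ 2 ≤ 5 * C * G * G := by
      rw [← real_inner_self_eq_norm_sq]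
      have e := hinner (trig_isSmooth (mult invLapSymbol b))
      rw [← trigH1_apply] at e
      rw [e]
      have h3 : ∫ x, trig b x * trig (mult invLapSymbol b) x
          ≤ ∫ x, (5 * C * G) * |trig b x| := by
        refine integral_mono (integrable_of_continuous (by fun_prop))
          (integrable_of_continuous (by fun_prop)) fun x => ?_
        refine (le_abs_self _).trans ?_
        simp only []
        rw [abs_mul, mul_comm]
        refine mul_le_mul_of_nonneg_right ?_ (abs_nonneg _)
        exact ((trig (mult invLapSymbol b)).norm_coe_le_norm x).trans hsup
      rw [integral_const_mul] at h3
      exact h3.trans (mul_le_mul_of_nonneg_left (integral_abs_trig_le p b) (by positivity))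
    have hfn := (norm_fn_trigH1_le (mult invLapSymbol b)).trans hsup
    have hsq := H1.norm_sq_eq (trigH1 (mult invLapSymbol b))
    refine le_of_sq_le_sq ?_ (by positivity)
    have : ‖(trigH1 (mult invLapSymbol b)).fn‖ ^ 2 ≤ (5 * C * G) ^ 2 :=
      pow_le_pow_left₀ (norm_nonneg _) hfn 2
    nlinarith [mul_nonneg hC.le (mul_nonneg hG hG), mul_nonneg hG hG]
  · rw [hessLp_apply]
    refine (norm_sum_le _ _).trans ((Finset.sum_le_sum (g := fun _ => C * G) fun ij _ =>
      (norm_entryLp_le p ij _).trans (h b _ _ hb0)).trans ?_)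
    simp only [Finset.sum_const, Finset.card_univ, Fintype.card_prod, Fintype.card_fin,
      nsmul_eq_mul]
    push_cast
    nlinarith

/-- Solution of `-ΔU = g` for `g ∈ Lᵖ` of mean zero. It is continuous, with a weak Hessian in `Lᵖ`,
and belongs to `H¹`, also for `p < 2`; all these norms are bounded by that of `g`. -/
theorem exists_poisson_solution {p : ℝ≥0∞} [Fact (1 ≤ p)] (h1 : 1 < p) (hp : p ≠ ⊤) :
    ∃ K : ℝ, 0 < K ∧ ∀ g : Lp ℝ p (volume : Measure T2), ∫ x, g x = 0 →
      ∃ (u : C(T2, ℝ)) (U : H1) (H : Lp Mat2 p (volume : Measure T2)),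
        U.fn =ᵐ[volume] u ∧ ‖u‖ ≤ K * ‖g‖ ∧ ‖U‖ ≤ K * ‖g‖ ∧ ‖H‖ ≤ K * ‖g‖ ∧
        IsWeakHessian u H ∧ ∀ (η : T2 → ℝ) (hη : IsSmooth η),
          inner ℝ U.grad (H1.ofSmooth η hη).grad = ∫ x, g x * η x := by
  obtain ⟨K, hK, hbd⟩ := exists_apriori h1 hp
  refine ⟨K, hK, fun g hg => ?_⟩
  let A : (Freq →₀ ℂ) →ₗ[ℝ] C(T2, ℝ) × H1 × Lp Mat2 p (volume : Measure T2) :=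
    ((trig ∘ₗ mult invLapSymbol).prod ((trigH1 ∘ₗ mult invLapSymbol).prod (hessLp p))) ∘ₗ
      mult meanZeroSymbol
  obtain ⟨c, ⟨u, U, H⟩, hB, hA, hn⟩ := exists_tendsto_of_norm_le A
    (trigLp p ∘ₗ mult meanZeroSymbol) (K := K)
    (fun c => by
      obtain ⟨a1, a2, a3⟩ := hbd c
      exact norm_prod_le_iff.2 ⟨a1, norm_prod_le_iff.2 ⟨a2, a3⟩⟩)
    (mem_closure_trigLp_meanZero hp g hg)
  obtain ⟨n1, n2⟩ := norm_prod_le_iff.1 hn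
  obtain ⟨n2, n3⟩ := norm_prod_le_iff.1 n2
  have t1 : Filter.Tendsto (fun n => trig (mult invLapSymbol (mult meanZeroSymbol (c n))))
      Filter.atTop (nhds u) := (continuous_fst.tendsto _).comp hA
  have t23 := (continuous_snd.tendsto _).comp hA
  have t2 : Filter.Tendsto (fun n => trigH1 (mult invLapSymbol (mult meanZeroSymbol (c n))))
      Filter.atTop (nhds U) := (continuous_fst.tendsto _).comp t23
  have t3 : Filter.Tendsto (fun n => hessLp p (mult meanZeroSymbol (c n)))
      Filter.atTop (nhds H) := (continuous_snd.tendsto _).comp t23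
  have hB' : Filter.Tendsto (fun n => trigLp p (mult meanZeroSymbol (c n)))
      Filter.atTop (nhds g) := hB
  refine ⟨u, U, H, ?_, n1, n2, n3, ?_, ?_⟩
  · have e : U.fn = ContinuousMap.toLp 2 volume ℝ u := by
      refine tendsto_nhds_unique ((fnL.continuous.tendsto U).comp t2) ?_
      exact ((ContinuousMap.toLp 2 (volume : Measure T2) ℝ).continuous.tendsto u).comp t1
    rw [e]
    exact ContinuousMap.coeFn_toLp volume u
  · intro i j η hη
    have hd : IsSmooth (pderiv i (pderiv j η)) := (hη.pderiv j).pderiv i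
    have s1 := ((pairing p ⟨_, hd.continuous⟩).continuous.tendsto _).comp
      (((ContinuousMap.toLp p (volume : Measure T2) ℝ).continuous.tendsto u).comp t1)
    have s2 := ((pairing p ⟨η, hη.continuous⟩).continuous.tendsto _).comp
      (((compLp p (i, j)).continuous.tendsto H).comp t3)
    have e := tendsto_nhds_unique s1 (s2.congr fun n => by
      simp only [Function.comp_apply]
      rw [compLp_hessLp, pairing_trigLp, ← trigLp_apply, pairing_trigLp]
      refine Eq.trans ?_ (integral_trig_mul_pderiv_pderiv _ hη i j).symm
      rw [mult_mult _ invLapSymbol, mul_assoc]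
      rfl)
    rw [pairing_compLp, pairing_apply] at e
    refine Eq.trans ?_ e
    apply integral_congr_ae
    filter_upwards [ContinuousMap.coeFn_toLp (p := p) (𝕜 := ℝ) volume u] with x hx
    rw [hx]
    rfl
  · intro η hη
    have s1 : Filter.Tendsto (fun n => inner ℝ (gradL (trigH1 (mult invLapSymbol
        (mult meanZeroSymbol (c n))))) (H1.ofSmooth η hη).grad) Filter.atTop
        (nhds (inner ℝ (gradL U) (H1.ofSmooth η hη).grad)) :=
      ((gradL.continuous.tendsto U).comp t2).inner tendsto_const_nhds
    have s2 := ((pairing p ⟨η, hη.continuous⟩).continuous.tendsto _).comp hB'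
    refine tendsto_nhds_unique s1 (s2.congr fun n => ?_)
    simp only [Function.comp_apply]
    rw [pairing_trigLp, gradL_apply, inner_grad_invLap]
    rfl

/-! ### Density arguments and the Poincaré inequality in `H¹` -/

/-- Identities between continuous functions on `H¹` can be checked on smooth functions. -/
theorem H1.eq_of_eq_on_smooth {F G : H1 → ℝ} (hF : Continuous F) (hG : Continuous G)
    (h : ∀ (η : T2 → ℝ) (hη : IsSmooth η), F (H1.ofSmooth η hη) = G (H1.ofSmooth η hη)) (u : H1) :
    F u = G u :=
  congrFun (denseRange_trigH1.equalizer hF hG (funext fun c => h _ (trig_isSmooth c))) u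

theorem H1.coeFn_add (u v : H1) : (u + v).fn =ᵐ[volume] fun x => u.fn x + v.fn x :=
  Lp.coeFn_add u.fn v.fn

theorem H1.coeFn_sub (u v : H1) : (u - v).fn =ᵐ[volume] fun x => u.fn x - v.fn x :=
  Lp.coeFn_sub u.fn v.fn

theorem H1.coeFn_smul (r : ℝ) (u : H1) : (r • u).fn =ᵐ[volume] fun x => r * u.fn x :=
  Lp.coeFn_smul r u.fn

theorem H1.grad_add (u v : H1) : (u + v).grad = u.grad + v.grad := rfl
theorem H1.grad_sub (u v : H1) : (u - v).grad = u.grad - v.grad := rfl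
theorem H1.grad_smul (r : ℝ) (u : H1) : (r • u).grad = r • u.grad := rfl

theorem Hneg1.one_apply (u : H1) : Hneg1.one u = ∫ x, u.fn x := rfl

theorem inner_grad_eq_integral (u v : H1) :
    ∫ x, inner ℝ (u.grad x) (v.grad x) = inner ℝ u.grad v.grad := (L2.inner_def _ _).symm

/-- The constant function `1` as an element of `H¹`. -/
def H1.one : H1 := H1.ofSmooth (fun _ => 1) (isSmooth_const 1)

theorem coeFn_one : H1.one.fn =ᵐ[volume] fun _ => 1 := coeFn_fn_ofSmooth _

theorem grad_one : H1.one.grad = 0 := by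
  apply Lp.ext
  filter_upwards [coeFn_grad_ofSmooth (isSmooth_const 1),
    Lp.coeFn_zero Plane 2 (volume : Measure T2)] with x h1 h2
  rw [h2]
  refine h1.trans ?_
  ext i
  simp [pderiv]

theorem Hneg1.one_one : Hneg1.one H1.one = 1 := by
  rw [Hneg1.one_apply, integral_congr_ae coeFn_one]
  simp

/-- The Poincaré inequality, by testing the Poisson equation `-ΔU = u` with `u` itself. -/
theorem exists_poincare : ∃ K : ℝ, 0 < K ∧ ∀ u : H1, ∫ x, u.fn x = 0 → ‖u.fn‖ ≤ K * ‖u.grad‖ := by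
  obtain ⟨K, hK, h⟩ := exists_poisson_solution (p := 2) (by norm_num) (by norm_num)
  refine ⟨K, hK, fun u hu => ?_⟩
  obtain ⟨-, U, -, -, -, hU, -, -, hη⟩ := h u.fn hu
  have key := H1.eq_of_eq_on_smooth (F := fun v => inner ℝ U.grad (gradL v))
    (G := fun v => inner ℝ u.fn (fnL v)) (by fun_prop) (by fun_prop)
    (fun η hs => (hη η hs).trans (inner_fn_ofSmooth u hs).symm) u
  simp only [gradL_apply, fnL_apply] at key
  have h1 : ‖u.fn‖ ^ 2 ≤ K * ‖u.fn‖ * ‖u.grad‖ := by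
    rw [← real_inner_self_eq_norm_sq, ← key]
    refine (real_inner_le_norm _ _).trans ?_
    exact mul_le_mul_of_nonneg_right (U.norm_grad_le.trans hU) (norm_nonneg _)
  rcases (norm_nonneg u.fn).eq_or_lt with h0 | h0
  · rw [← h0]; positivity
  · nlinarith

/-- The Poincaré inequality in `H¹` norm, for functions of any mean. -/
theorem exists_norm_sub_mean_le : ∃ K : ℝ, 0 < K ∧ ∀ u : H1,
    ‖u - (∫ x, u.fn x) • H1.one‖ ≤ K * ‖u.grad‖ := by
  obtain ⟨K, hK, h⟩ := exists_poincare
  refine ⟨K + 1, by positivity, fun u => ?_⟩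
  set v := u - (∫ x, u.fn x) • H1.one with hv
  have h0 : ∫ x, v.fn x = 0 := by
    rw [← Hneg1.one_apply, hv, map_sub, map_smul, Hneg1.one_one, Hneg1.one_apply]
    simp
  have hg : v.grad = u.grad := by
    rw [hv, H1.grad_sub, H1.grad_smul, grad_one, smul_zero, sub_zero]
  have h1 := h v h0
  have h2 := v.norm_sq_eq
  rw [hg] at h1 h2
  refine le_of_sq_le_sq ?_ (by positivity)
  have h3 : ‖v.fn‖ ^ 2 ≤ (K * ‖u.grad‖) ^ 2 := pow_le_pow_left₀ (norm_nonneg _) h1 2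
  nlinarith [mul_nonneg hK.le (sq_nonneg ‖u.grad‖)]

/-- A functional of total mass `1` is controlled, up to the mean, by the gradient. -/
theorem exists_abs_sub_mean_le : ∃ K : ℝ, 0 < K ∧ ∀ (ρ : Hneg1), ρ.mass = 1 → ∀ u : H1,
    |ρ u - ∫ x, u.fn x| ≤ K * ‖ρ - Hneg1.one‖ * ‖u.grad‖ := by
  obtain ⟨K, hK, h⟩ := exists_norm_sub_mean_le
  refine ⟨K, hK, fun ρ hρ u => ?_⟩
  have e : ρ u - ∫ x, u.fn x = (ρ - Hneg1.one) (u - (∫ x, u.fn x) • H1.one) := by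
    have h1 : ρ H1.one = 1 := hρ
    rw [map_sub, map_smul, sub_apply, sub_apply, h1,
      Hneg1.one_one, Hneg1.one_apply]
    simp
  rw [e, ← Real.norm_eq_abs]
  refine ((ρ - Hneg1.one).le_opNorm _).trans ?_
  have := mul_le_mul_of_nonneg_left (h u) (norm_nonneg (ρ - Hneg1.one))
  linarith

theorem exists_seq_tendsto_ae_of_tendsto {p : ℝ≥0∞} [Fact (1 ≤ p)]
    {f : ℕ → Lp ℝ p (volume : Measure T2)} {g : Lp ℝ p (volume : Measure T2)}
    (h : Filter.Tendsto f Filter.atTop (nhds g)) :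
    ∃ ns : ℕ → ℕ, StrictMono ns ∧
      ∀ᵐ x, Filter.Tendsto (fun i => f (ns i) x) Filter.atTop (nhds (g x)) :=
  (tendstoInMeasure_of_tendsto_Lp h).exists_seq_tendsto_ae

/-! ### Extension of the equation from smooth test functions to `H¹` -/

theorem IsSmooth.comp {F : ℝ → ℝ} (hF : ContDiff ℝ ∞ F) {f : T2 → ℝ} (hf : IsSmooth f) :
    IsSmooth fun x => F (f x) := ContDiff.comp hF hf

theorem pderiv_comp {F F' : ℝ → ℝ} (hF : ∀ y, HasDerivAt F (F' y) y) {f : T2 → ℝ}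
    (hf : IsSmooth f) (i : Fin 2) (x : T2) :
    pderiv i (fun x => F (f x)) x = F' (f x) * pderiv i f x := by
  have h1 := hf.hasDerivAt i x 0
  have h := ((hF _).comp (0 : ℝ) h1).deriv
  simp only [AddCircle.coe_zero, Pi.single_zero, add_zero] at h
  exact h

theorem norm_sq_ofSmooth {f : T2 → ℝ} (hf : IsSmooth f) :
    ‖H1.ofSmooth f hf‖ ^ 2
      = (∫ x, f x ^ 2) + (∫ x, pderiv 0 f x ^ 2) + ∫ x, pderiv 1 f x ^ 2 := by
  rw [H1.norm_sq_eq, ← real_inner_self_eq_norm_sq, ← real_inner_self_eq_norm_sq,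
    inner_fn_ofSmooth, inner_grad_ofSmooth, add_assoc]
  congr 1
  · apply integral_congr_ae
    filter_upwards [coeFn_fn_ofSmooth hf] with x hx
    rw [hx, sq]
  · congr 1
    · apply integral_congr_ae
      filter_upwards [coeFn_grad_ofSmooth_apply hf 0] with x hx
      rw [hx, sq]
    · apply integral_congr_ae
      filter_upwards [coeFn_grad_ofSmooth_apply hf 1] with x hx
      rw [hx, sq]

section Extension

variable {n : T2 → ℝ} (L : Hneg1)

theorem integrable_mul_of_continuous (hn : Integrable n volume) {f : T2 → ℝ} (hf : Continuous f) :
    Integrable (fun x => n x * f x) :=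
  integrable_mul_continuous le_rfl (memLp_one_iff_integrable.2 hn) hf

/-- A nonnegative density in `H⁻¹` is a bounded functional on absolute values: `|η|` is replaced by
the smooth function `√(η² + ε²)`, whose `H¹` norm is controlled by that of `η`. -/
theorem integral_mul_abs_le (hn0 : ∀ x, 0 ≤ n x) (hn : Integrable n volume)
    (hL : ∀ (η : T2 → ℝ) (hη : IsSmooth η), ∫ x, n x * η x = L (H1.ofSmooth η hη))
    {η : T2 → ℝ} (hη : IsSmooth η) :
    ∫ x, |n x * η x| ≤ ‖L‖ * ‖H1.ofSmooth η hη‖ := by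
  refine le_of_forall_le_add_rpow (D := ‖L‖) (τ := 1) one_pos fun ε hε => ?_
  rw [Real.rpow_one]
  have hF : ContDiff ℝ ∞ fun y : ℝ => √(y ^ 2 + ε ^ 2) :=
    ContDiff.sqrt (by fun_prop) fun y => by positivity
  have hF' : ∀ y : ℝ, HasDerivAt (fun y : ℝ => √(y ^ 2 + ε ^ 2)) (y / √(y ^ 2 + ε ^ 2)) y := by
    intro y
    have h1 : HasDerivAt (fun y : ℝ => y ^ 2 + ε ^ 2) (2 * y) y := by
      simpa using (hasDerivAt_pow 2 y).add_const (ε ^ 2)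
    refine (h1.sqrt (by positivity)).congr_deriv ?_
    field_simp
  have hs := IsSmooth.comp hF hη
  have h1 : ∫ x, |n x * η x| ≤ ∫ x, n x * √(η x ^ 2 + ε ^ 2) := by
    refine integral_mono (integrable_mul_of_continuous hn hη.continuous).abs
      (integrable_mul_of_continuous hn hs.continuous) fun x => ?_
    simp only []
    rw [abs_mul, abs_of_nonneg (hn0 x)]
    exact mul_le_mul_of_nonneg_left (Real.abs_le_sqrt (by nlinarith [sq_nonneg ε])) (hn0 x)
  have h2 : ‖H1.ofSmooth _ hs‖ ≤ ‖H1.ofSmooth η hη‖ + ε := by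
    refine le_of_sq_le_sq ?_ (by positivity)
    have hd : ∀ i, ∫ x, pderiv i (fun x => √(η x ^ 2 + ε ^ 2)) x ^ 2 ≤ ∫ x, pderiv i η x ^ 2 := by
      intro i
      refine integral_mono (integrable_of_continuous ((hs.pderiv i).continuous.pow 2))
        (integrable_of_continuous ((hη.pderiv i).continuous.pow 2)) fun x => ?_
      simp only []
      rw [pderiv_comp hF' hη, mul_pow, div_pow, Real.sq_sqrt (by positivity)]
      refine mul_le_of_le_one_left (sq_nonneg _) ?_
      rw [div_le_one (by positivity)]
      nlinarith [sq_nonneg ε]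
    have h0 : ∫ x, √(η x ^ 2 + ε ^ 2) ^ 2 = (∫ x, η x ^ 2) + ε ^ 2 := by
      have : ∀ x, √(η x ^ 2 + ε ^ 2) ^ 2 = η x ^ 2 + ε ^ 2 := fun x => Real.sq_sqrt (by positivity)
      simp_rw [this]
      have hc : Continuous fun x => η x ^ 2 := hη.continuous.pow 2
      rw [integral_add (integrable_of_continuous hc) (integrable_const _)]
      simp
    have e1 := norm_sq_ofSmooth hs
    have e2 := norm_sq_ofSmooth hη
    have := hd 0
    have := hd 1
    nlinarith [norm_nonneg (H1.ofSmooth η hη)]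
  calc ∫ x, |n x * η x| ≤ L (H1.ofSmooth _ hs) := by rw [← hL]; exact h1
    _ ≤ ‖L‖ * ‖H1.ofSmooth _ hs‖ := (le_abs_self _).trans (L.le_opNorm _)
    _ ≤ ‖L‖ * (‖H1.ofSmooth η hη‖ + ε) := mul_le_mul_of_nonneg_left h2 (norm_nonneg L)
    _ = _ := by ring

/-- If a nonnegative integrable function represents a functional in `H⁻¹` on smooth functions, it
represents it on all of `H¹`. -/
theorem integrable_mul_and_integral_eq (hn0 : ∀ x, 0 ≤ n x) (hn : Integrable n volume)
    (hL : ∀ (η : T2 → ℝ) (hη : IsSmooth η), ∫ x, n x * η x = L (H1.ofSmooth η hη)) (ψ : H1) :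
    Integrable (fun x => n x * ψ.fn x) ∧ ∫ x, n x * ψ.fn x = L ψ := by
  have hi : ∀ c, Integrable (fun x => n x * trig c x) := fun c =>
    integrable_mul_of_continuous hn (trig c).continuous
  let A : (Freq →₀ ℂ) →ₗ[ℝ] Lp ℝ 1 (volume : Measure T2) :=
    { toFun := fun c => (hi c).toL1 _
      map_add' := fun c d => by
        rw [← Integrable.toL1_add]
        exact (Integrable.toL1_eq_toL1_iff _ _ _ _).2
          (Filter.Eventually.of_forall fun x => by simp [mul_add])
      map_smul' := fun r c => by
        rw [RingHom.id_apply, ← Integrable.toL1_smul]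
        exact (Integrable.toL1_eq_toL1_iff _ _ _ _).2
          (Filter.Eventually.of_forall fun x => by simp; ring) }
  have hA : ∀ c, A c =ᵐ[volume] fun x => n x * trig c x := fun c => (hi c).coeFn_toL1
  have hnorm : ∀ c, ‖A c‖ ≤ ‖L‖ * ‖trigH1 c‖ := fun c => by
    rw [L1.norm_eq_integral_norm]
    refine le_trans (le_of_eq ?_) (integral_mul_abs_le L hn0 hn hL (trig_isSmooth c))
    apply integral_congr_ae
    filter_upwards [hA c] with x hx
    rw [hx, Real.norm_eq_abs]
  obtain ⟨c, y, h1, h2, -⟩ := exists_tendsto_of_norm_le A trigH1 hnorm (denseRange_trigH1 ψ)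
  have h3 : Filter.Tendsto (fun k => fnL (trigH1 (c k))) Filter.atTop (nhds ψ.fn) :=
    (fnL.continuous.tendsto ψ).comp h1
  obtain ⟨ns, hns, h4⟩ := exists_seq_tendsto_ae_of_tendsto h3
  obtain ⟨ms, hms, h5⟩ := exists_seq_tendsto_ae_of_tendsto (h2.comp hns.tendsto_atTop)
  have hy : y =ᵐ[volume] fun x => n x * ψ.fn x := by
    have a1 : ∀ᵐ x, ∀ k, A (c k) x = n x * trig (c k) x := ae_all_iff.2 fun k => hA (c k)
    have a2 : ∀ᵐ x, ∀ k, fnL (trigH1 (c k)) x = trig (c k) x :=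
      ae_all_iff.2 fun k => coeFn_fn_ofSmooth (trig_isSmooth (c k))
    filter_upwards [a1, a2, h4, h5] with x b1 b2 b4 b5
    refine tendsto_nhds_unique b5 ?_
    simp only [Function.comp_apply, b1]
    simp only [b2] at b4
    exact (b4.comp hms.tendsto_atTop).const_mul (n x)
  refine ⟨(L1.integrable_coeFn y).congr hy, ?_⟩
  rw [← integral_congr_ae hy]
  refine tendsto_nhds_unique
    (((continuous_integral (α := T2) (G := ℝ) (μ := volume)).tendsto y).comp h2) ?_
  refine ((L.continuous.tendsto ψ).comp h1).congr fun k => ?_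
  simp only [Function.comp_apply]
  rw [integral_congr_ae (hA (c k)), hL _ (trig_isSmooth (c k))]
  rfl

end Extension

/-! ### Existence by minimization of the free energy -/

theorem aestronglyMeasurable_exp_neg (φ : H1) :
    AEStronglyMeasurable (fun x => Real.exp (-φ.fn x)) volume :=
  Real.continuous_exp.comp_aestronglyMeasurable (Lp.aestronglyMeasurable φ.fn).neg

theorem integrable_fn (φ : H1) : Integrable (fun x => φ.fn x) volume :=
  (Lp.memLp φ.fn).integrable one_le_two

/-- The free energy `δ²/2 ∫ |∇φ|² + ∫ e^{-φ} + ⟨ρ, φ⟩`, whose minimizer is the solution of the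
Poisson–Boltzmann equation; it is meaningful only where `e^{-φ}` is integrable. -/
def freeEnergy (δ : ℝ) (ρ : Hneg1) (φ : H1) : ℝ :=
  δ ^ 2 / 2 * ‖φ.grad‖ ^ 2 + (∫ x, Real.exp (-φ.fn x)) + ρ φ

/-- Jensen's inequality for the exponential. -/
theorem exp_neg_mean_le {φ : H1} (hφ : Integrable fun x => Real.exp (-φ.fn x)) :
    Real.exp (-∫ x, φ.fn x) ≤ ∫ x, Real.exp (-φ.fn x) := by
  set m := ∫ x, φ.fn x with hm
  have hi : Integrable (fun x => φ.fn x - m) volume := (integrable_fn φ).sub (integrable_const m)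
  have h1 : ∫ x, Real.exp (-m) * (1 - (φ.fn x - m)) = Real.exp (-m) := by
    rw [integral_const_mul, integral_sub (integrable_const _) hi,
      integral_sub (integrable_fn φ) (integrable_const _), ← hm]
    simp
  rw [← h1]
  refine integral_mono (((integrable_const _).sub hi).const_mul _) hφ fun x => ?_
  have h2 := Real.add_one_le_exp (-(φ.fn x - m))
  have h3 : Real.exp (-φ.fn x) = Real.exp (-m) * Real.exp (-(φ.fn x - m)) := by
    rw [← Real.exp_add]; ring_nf
  simp only []
  rw [h3]
  exact mul_le_mul_of_nonneg_left (by linarith) (Real.exp_pos _).le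

theorem abs_le_exp_neg_add (m : ℝ) : |m| ≤ Real.exp (-m) + m := by
  rcases le_total 0 m with h | h
  · rw [abs_of_nonneg h]; linarith [Real.exp_pos (-m)]
  · rw [abs_of_nonpos h]
    have h1 := Real.add_one_le_exp (-m / 2)
    have h2 : Real.exp (-m) = Real.exp (-m / 2) ^ 2 := by rw [← Real.exp_nat_mul]; ring_nf
    nlinarith [sq_nonneg (1 + m / 2)]

/-- Coercivity: the mean and the gradient are controlled by the free energy. -/
theorem le_freeEnergy {δ C : ℝ} {ρ : Hneg1}
    (hC : ∀ u : H1, |ρ u - ∫ x, u.fn x| ≤ C * ‖u.grad‖) {φ : H1}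
    (hφ : Integrable fun x => Real.exp (-φ.fn x)) :
    |∫ x, φ.fn x| + (δ ^ 2 / 2 * ‖φ.grad‖ ^ 2 - C * ‖φ.grad‖) ≤ freeEnergy δ ρ φ := by
  have h1 := exp_neg_mean_le hφ
  have h2 := abs_le_exp_neg_add (∫ x, φ.fn x)
  have h3 := (abs_le.1 (hC φ)).1
  unfold freeEnergy
  linarith

theorem le_half_sq_sub {δ : ℝ} (hδ : 0 < δ) (C x : ℝ) :
    -(C ^ 2 / (2 * δ ^ 2)) ≤ δ ^ 2 / 2 * x ^ 2 - C * x := by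
  have : δ ^ 2 / 2 * x ^ 2 - C * x + C ^ 2 / (2 * δ ^ 2) = (δ ^ 2 * x - C) ^ 2 / (2 * δ ^ 2) := by
    field_simp; ring
  have h : 0 ≤ (δ ^ 2 * x - C) ^ 2 / (2 * δ ^ 2) := by positivity
  linarith

/-- The free energy is uniformly convex in the gradient. -/
theorem freeEnergy_midpoint_le (δ : ℝ) (ρ : Hneg1) {φ ψ : H1}
    (hφ : Integrable fun x => Real.exp (-φ.fn x)) (hψ : Integrable fun x => Real.exp (-ψ.fn x)) :
    (Integrable fun x => Real.exp (-((1 / 2 : ℝ) • (φ + ψ)).fn x)) ∧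
    freeEnergy δ ρ ((1 / 2 : ℝ) • (φ + ψ)) + δ ^ 2 / 8 * ‖φ.grad - ψ.grad‖ ^ 2
      ≤ (freeEnergy δ ρ φ + freeEnergy δ ρ ψ) / 2 := by
  have hpt : ∀ᵐ x, Real.exp (-((1 / 2 : ℝ) • (φ + ψ)).fn x)
      ≤ 1 / 2 * (Real.exp (-φ.fn x) + Real.exp (-ψ.fn x)) := by
    filter_upwards [H1.coeFn_smul (1 / 2) (φ + ψ), H1.coeFn_add φ ψ] with x h1 h2
    rw [h1, h2]
    have e : Real.exp (-(1 / 2 * (φ.fn x + ψ.fn x)))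
        = Real.exp (-φ.fn x / 2) * Real.exp (-ψ.fn x / 2) := by
      rw [← Real.exp_add]; ring_nf
    have e1 : Real.exp (-φ.fn x) = Real.exp (-φ.fn x / 2) ^ 2 := by
      rw [← Real.exp_nat_mul]; ring_nf
    have e2 : Real.exp (-ψ.fn x) = Real.exp (-ψ.fn x / 2) ^ 2 := by
      rw [← Real.exp_nat_mul]; ring_nf
    rw [e, e1, e2]
    nlinarith [sq_nonneg (Real.exp (-φ.fn x / 2) - Real.exp (-ψ.fn x / 2))]
  have hi : Integrable fun x => 1 / 2 * (Real.exp (-φ.fn x) + Real.exp (-ψ.fn x)) :=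
    (hφ.add hψ).const_mul _
  have hA : Integrable fun x => Real.exp (-((1 / 2 : ℝ) • (φ + ψ)).fn x) := by
    refine hi.mono' (aestronglyMeasurable_exp_neg _) ?_
    filter_upwards [hpt] with x hx
    rwa [Real.norm_eq_abs, abs_of_pos (Real.exp_pos _)]
  refine ⟨hA, ?_⟩
  have h1 := integral_mono_ae hA hi hpt
  rw [integral_const_mul, integral_add hφ hψ] at h1
  have h2 := parallelogram_law_with_norm ℝ φ.grad ψ.grad
  have h3 : ‖((1 / 2 : ℝ) • (φ + ψ)).grad‖ = 1 / 2 * ‖φ.grad + ψ.grad‖ := by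
    rw [H1.grad_smul, H1.grad_add, norm_smul]; norm_num
  have h4 : ρ ((1 / 2 : ℝ) • (φ + ψ)) = 1 / 2 * (ρ φ + ρ ψ) := by
    rw [map_smul, map_add, smul_eq_mul]
  unfold freeEnergy
  rw [h3, h4]
  have h5 : δ ^ 2 / 8 * (‖φ.grad + ψ.grad‖ ^ 2
      + ‖φ.grad - ψ.grad‖ ^ 2)
      = δ ^ 2 / 8 * (2 * (‖φ.grad‖ ^ 2 + ‖ψ.grad‖ ^ 2)) := by rw [h2]
  nlinarith

/-- Lower semicontinuity of the free energy, from Fatou's lemma. -/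
theorem freeEnergy_le_of_tendsto {δ I : ℝ} {ρ : Hneg1} {f : ℕ → H1} {φ : H1}
    (hf : ∀ k, Integrable fun x => Real.exp (-(f k).fn x))
    (hφ : Filter.Tendsto f Filter.atTop (nhds φ))
    (hI : Filter.Tendsto (fun k => freeEnergy δ ρ (f k)) Filter.atTop (nhds I)) :
    (Integrable fun x => Real.exp (-φ.fn x)) ∧ freeEnergy δ ρ φ ≤ I := by
  have h3 : Filter.Tendsto (fun k => fnL (f k)) Filter.atTop (nhds φ.fn) :=
    (fnL.continuous.tendsto φ).comp hφ
  obtain ⟨ns, hns, h4⟩ := exists_seq_tendsto_ae_of_tendsto h3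
  have hg : Filter.Tendsto (fun k => (f k).grad) Filter.atTop (nhds φ.grad) :=
    (gradL.continuous.tendsto φ).comp hφ
  set J := I - δ ^ 2 / 2 * ‖φ.grad‖ ^ 2 - ρ φ with hJ
  have hlim : Filter.Tendsto (fun k => ∫ x, Real.exp (-(f k).fn x)) Filter.atTop (nhds J) := by
    refine ((hI.sub ((hg.norm.pow 2).const_mul (δ ^ 2 / 2))).sub
      ((ρ.continuous.tendsto φ).comp hφ)).congr fun k => ?_
    simp only [freeEnergy, Function.comp_apply]
    ring
  have hJ0 : 0 ≤ J := ge_of_tendsto' hlim fun k => integral_nonneg fun x => (Real.exp_pos _).le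
  have hlin : ∫⁻ x, ENNReal.ofReal (Real.exp (-φ.fn x)) ≤ ENNReal.ofReal J := by
    have e1 : ∀ᵐ x, Filter.liminf (fun k => ENNReal.ofReal (Real.exp (-(f (ns k)).fn x)))
        Filter.atTop = ENNReal.ofReal (Real.exp (-φ.fn x)) := by
      filter_upwards [h4] with x hx
      refine Filter.Tendsto.liminf_eq ?_
      exact (ENNReal.continuous_ofReal.comp (Real.continuous_exp.comp continuous_neg)).tendsto _
        |>.comp hx
    rw [← lintegral_congr_ae e1]
    refine (lintegral_liminf_le' fun k =>
      (aestronglyMeasurable_exp_neg _).aemeasurable.ennreal_ofReal).trans (le_of_eq ?_)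
    refine Filter.Tendsto.liminf_eq ?_
    refine ((ENNReal.continuous_ofReal.tendsto J).comp
      (hlim.comp hns.tendsto_atTop)).congr fun k => ?_
    exact ofReal_integral_eq_lintegral_ofReal (hf _)
      (Filter.Eventually.of_forall fun x => (Real.exp_pos _).le)
  have hint : Integrable fun x => Real.exp (-φ.fn x) := by
    refine ⟨aestronglyMeasurable_exp_neg _, ?_⟩
    rw [hasFiniteIntegral_iff_ofReal (Filter.Eventually.of_forall fun x => (Real.exp_pos _).le)]
    exact hlin.trans_lt ENNReal.ofReal_lt_top
  refine ⟨hint, ?_⟩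
  rw [← ofReal_integral_eq_lintegral_ofReal hint
    (Filter.Eventually.of_forall fun x => (Real.exp_pos _).le),
    ENNReal.ofReal_le_ofReal_iff hJ0] at hlin
  unfold freeEnergy
  linarith

/-- A minimizing sequence has convergent gradients by uniform convexity, and bounded means by
coercivity, so a subsequence converges in `H¹` by the Poincaré inequality. -/
theorem exists_isMin_freeEnergy {δ : ℝ} (hδ : 0 < δ) {ρ : Hneg1} (hρ : ρ.mass = 1) :
    ∃ φ : H1, (Integrable fun x => Real.exp (-φ.fn x)) ∧
      ∀ ψ : H1, (Integrable fun x => Real.exp (-ψ.fn x)) →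
        freeEnergy δ ρ φ ≤ freeEnergy δ ρ ψ := by
  obtain ⟨K, -, hK⟩ := exists_abs_sub_mean_le
  obtain ⟨K', hK', hP⟩ := exists_norm_sub_mean_le
  have hC := hK ρ hρ
  set C := K * ‖ρ - Hneg1.one‖
  set S := freeEnergy δ ρ '' {φ : H1 | Integrable fun x => Real.exp (-φ.fn x)} with hS
  have hbdd : BddBelow S := by
    refine ⟨-(C ^ 2 / (2 * δ ^ 2)), ?_⟩
    rintro _ ⟨φ, hφ, rfl⟩
    have := le_freeEnergy (δ := δ) hC hφ
    have := le_half_sq_sub hδ C ‖φ.grad‖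
    have := abs_nonneg (∫ x, φ.fn x)
    linarith
  have hne : S.Nonempty := by
    refine ⟨_, H1.one, ?_, rfl⟩
    refine (integrable_const (Real.exp (-1))).congr ?_
    filter_upwards [coeFn_one] with x hx
    rw [hx]
  obtain ⟨E, hanti, hlim, hmem⟩ := exists_seq_tendsto_sInf hne hbdd
  choose f hf hfE using hmem
  have hinf : ∀ ψ : H1, (Integrable fun x => Real.exp (-ψ.fn x)) → sInf S ≤ freeEnergy δ ρ ψ :=
    fun ψ hψ => csInf_le hbdd ⟨ψ, hψ, rfl⟩
  have hgrad : ∀ n m N, N ≤ n → N ≤ m →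
      ‖(f n).grad - (f m).grad‖ ≤ √(8 / δ ^ 2 * (E N - sInf S)) := by
    intro n m N hn hm
    obtain ⟨h1, h2⟩ := freeEnergy_midpoint_le δ ρ (hf n) (hf m)
    have h3 := hinf _ h1
    have h4 := hanti hn
    have h5 := hanti hm
    refine Real.le_sqrt_of_sq_le ?_
    rw [hfE, hfE] at h2
    rw [div_mul_eq_mul_div, le_div_iff₀ (by positivity)]
    nlinarith
  set v : ℕ → H1 := fun k => f k - (∫ x, (f k).fn x) • H1.one with hv
  have hcau : CauchySeq v := by
    refine cauchySeq_of_le_tendsto_0 (fun N => K' * √(8 / δ ^ 2 * (E N - sInf S))) ?_ ?_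
    · intro n m N hn hm
      have e : v n - v m
          = (f n - f m) - (∫ x, (f n - f m).fn x) • H1.one := by
        rw [← Hneg1.one_apply, map_sub, Hneg1.one_apply, Hneg1.one_apply, sub_smul]
        simp only [hv]
        abel
      rw [dist_eq_norm, e]
      refine (hP _).trans (mul_le_mul_of_nonneg_left ?_ hK'.le)
      rw [H1.grad_sub]
      exact hgrad n m N hn hm
    · have h1 : Filter.Tendsto (fun N => E N - sInf S) Filter.atTop (nhds 0) := by
        simpa using hlim.sub_const (sInf S)
      simpa using ((h1.const_mul (8 / δ ^ 2)).sqrt).const_mul K'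
  obtain ⟨w, hw⟩ := cauchySeq_tendsto_of_complete hcau
  have hm : ∀ k, (∫ x, (f k).fn x) ∈ Metric.closedBall (0 : ℝ) (E 0 + C ^ 2 / (2 * δ ^ 2)) := by
    intro k
    rw [mem_closedBall_zero_iff, Real.norm_eq_abs]
    have h1 := le_freeEnergy (δ := δ) hC (hf k)
    have h2 := le_half_sq_sub hδ C ‖(f k).grad‖
    have h3 := hanti (Nat.zero_le k)
    rw [hfE] at h1
    linarith
  obtain ⟨m, -, ks, hks, hmlim⟩ := tendsto_subseq_of_bounded Metric.isBounded_closedBall hm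
  have hconv : Filter.Tendsto (fun k => f (ks k)) Filter.atTop (nhds (w + m • H1.one)) := by
    refine ((hw.comp hks.tendsto_atTop).add (hmlim.smul_const H1.one)).congr fun k => ?_
    simp [hv]
  obtain ⟨h1, h2⟩ := freeEnergy_le_of_tendsto (δ := δ) (ρ := ρ) (fun k => hf (ks k)) hconv
    ((hlim.comp hks.tendsto_atTop).congr fun k => (hfE _).symm)
  exact ⟨_, h1, fun ψ hψ => h2.trans (hinf ψ hψ)⟩

theorem eq_zero_of_forall_nonneg {a D τ : ℝ} (hτ : 0 < τ)
    (h : ∀ t : ℝ, |t| ≤ τ → 0 ≤ t * a + t ^ 2 * D) : a = 0 := by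
  have h1 : HasDerivAt (fun t : ℝ => t * a + t ^ 2 * D) a 0 := by
    refine (((hasDerivAt_id (0 : ℝ)).mul_const a).add
      ((hasDerivAt_pow 2 (0 : ℝ)).mul_const D)).congr_deriv ?_
    simp
  have h2 : IsLocalMin (fun t : ℝ => t * a + t ^ 2 * D) 0 := by
    filter_upwards [Metric.closedBall_mem_nhds (0 : ℝ) hτ] with t ht
    rw [mem_closedBall_zero_iff, Real.norm_eq_abs] at ht
    simpa using h t ht
  exact h2.hasDerivAt_eq_zero h1

theorem exp_neg_le_quadratic {y : ℝ} (hy : |y| ≤ 1) : Real.exp (-y) ≤ 1 - y + y ^ 2 := by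
  have h := Real.abs_exp_sub_one_sub_id_le (x := -y) (by rwa [abs_neg])
  have := (abs_le.1 h).2
  linarith [neg_sq y]

/-- The Euler–Lagrange equation of the free energy. -/
theorem isWeakSolution_of_isMin {δ : ℝ} {ρ : Hneg1} {φ : H1}
    (hφ : Integrable fun x => Real.exp (-φ.fn x))
    (hmin : ∀ ψ : H1, (Integrable fun x => Real.exp (-ψ.fn x)) →
        freeEnergy δ ρ φ ≤ freeEnergy δ ρ ψ) : IsWeakSolution δ ρ φ := by
  have key : ∀ (η : T2 → ℝ) (hη : IsSmooth η), ∫ x, Real.exp (-φ.fn x) * η x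
      = (δ ^ 2 • (innerSL ℝ φ.grad ∘L gradL) + ρ) (H1.ofSmooth η hη) := by
    intro η hη
    obtain ⟨M, hM⟩ := isCompact_univ.exists_bound_of_continuousOn hη.continuous.continuousOn
    have hM' : ∀ x, |η x| ≤ |M| + 1 := fun x => by
      have := hM x trivial
      rw [Real.norm_eq_abs] at this
      linarith [le_abs_self M]
    set v := H1.ofSmooth η hη with hv
    have hi1 : Integrable fun x => Real.exp (-φ.fn x) * η x :=
      integrable_mul_of_continuous hφ hη.continuous
    have hi2 : Integrable fun x => Real.exp (-φ.fn x) * η x ^ 2 :=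
      integrable_mul_of_continuous hφ (hη.continuous.pow 2)
    suffices h : δ ^ 2 * inner ℝ φ.grad v.grad + ρ v - ∫ x, Real.exp (-φ.fn x) * η x = 0 by
      simp only [add_apply, smul_apply, ContinuousLinearMap.comp_apply, innerSL_apply_apply,
        gradL_apply, smul_eq_mul]
      linarith
    refine eq_zero_of_forall_nonneg (τ := (|M| + 1)⁻¹)
      (D := δ ^ 2 / 2 * ‖v.grad‖ ^ 2 + ∫ x, Real.exp (-φ.fn x) * η x ^ 2) (by positivity)
      fun t ht => ?_
    have hb : ∀ x, |t * η x| ≤ 1 := fun x => by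
      rw [abs_mul]
      calc |t| * |η x| ≤ (|M| + 1)⁻¹ * (|M| + 1) :=
            mul_le_mul ht (hM' x) (abs_nonneg _) (by positivity)
        _ = 1 := inv_mul_cancel₀ (by positivity)
    have hpt : ∀ᵐ x, Real.exp (-(φ + t • v).fn x) ≤ Real.exp (-φ.fn x)
        - t * (Real.exp (-φ.fn x) * η x) + t ^ 2 * (Real.exp (-φ.fn x) * η x ^ 2) := by
      filter_upwards [H1.coeFn_add φ (t • v), H1.coeFn_smul t v, coeFn_fn_ofSmooth hη]
        with x h1 h2 h3
      rw [h1, h2, h3, neg_add, Real.exp_add]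
      have := mul_le_mul_of_nonneg_left (exp_neg_le_quadratic (hb x)) (Real.exp_pos (-φ.fn x)).le
      refine this.trans (le_of_eq ?_)
      ring
    have hi : Integrable fun x => Real.exp (-φ.fn x)
        - t * (Real.exp (-φ.fn x) * η x) + t ^ 2 * (Real.exp (-φ.fn x) * η x ^ 2) :=
      (hφ.sub (hi1.const_mul t)).add (hi2.const_mul (t ^ 2))
    have hA : Integrable fun x => Real.exp (-(φ + t • v).fn x) := by
      refine hi.mono' (aestronglyMeasurable_exp_neg _) ?_
      filter_upwards [hpt] with x hx
      rwa [Real.norm_eq_abs, abs_of_pos (Real.exp_pos _)]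
    have h1 := integral_mono_ae hA hi hpt
    have hi3 : Integrable fun x => Real.exp (-φ.fn x) - t * (Real.exp (-φ.fn x) * η x) :=
      hφ.sub (hi1.const_mul t)
    rw [integral_add hi3 (hi2.const_mul (t ^ 2)), integral_sub hφ (hi1.const_mul t),
      integral_const_mul, integral_const_mul] at h1
    have h2 := hmin _ hA
    unfold freeEnergy at h2
    rw [H1.grad_add, H1.grad_smul, norm_add_sq_real, map_add, map_smul, norm_smul, mul_pow,
      Real.norm_eq_abs, sq_abs, inner_smul_right, smul_eq_mul] at h2
    nlinarith
  intro ψ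
  obtain ⟨h1, h2⟩ := integrable_mul_and_integral_eq _ (fun x => (Real.exp_pos _).le) hφ key ψ
  refine ⟨h1, ?_⟩
  rw [h2, inner_grad_eq_integral]
  simp only [add_apply, smul_apply, ContinuousLinearMap.comp_apply, innerSL_apply_apply,
    gradL_apply, smul_eq_mul]
  ring

/-! ### Uniqueness, mass, and the energy estimate -/

theorem IsWeakSolution.integrable_and_integral_eq_one {δ : ℝ} {ρ : Hneg1} (hρ : ρ.mass = 1)
    {φ : H1} (h : IsWeakSolution δ ρ φ) :
    (Integrable fun x => Real.exp (-φ.fn x)) ∧ ∫ x, Real.exp (-φ.fn x) = 1 := by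
  obtain ⟨h1, h2⟩ := h H1.one
  have e : (fun x => Real.exp (-φ.fn x) * H1.one.fn x) =ᵐ[volume]
      fun x => Real.exp (-φ.fn x) := by
    filter_upwards [coeFn_one] with x hx
    rw [hx, mul_one]
  refine ⟨h1.congr e, ?_⟩
  rw [inner_grad_eq_integral, grad_one, inner_zero_right, mul_zero, integral_congr_ae e] at h2
  have h3 : ρ H1.one = 1 := hρ
  linarith

/-- Testing both equations with the difference of the solutions shows that its gradient vanishes,
since `e^{-y}` is decreasing. -/
theorem IsWeakSolution.unique {δ : ℝ} (hδ : 0 < δ) {ρ : Hneg1} (hρ : ρ.mass = 1) {φ ψ : H1}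
    (hφ : IsWeakSolution δ ρ φ) (hψ : IsWeakSolution δ ρ ψ) : φ = ψ := by
  obtain ⟨a1, a2⟩ := hφ (φ - ψ)
  obtain ⟨b1, b2⟩ := hψ (φ - ψ)
  rw [inner_grad_eq_integral] at a2 b2
  have hle : (∫ x, Real.exp (-φ.fn x) * (φ - ψ).fn x)
      ≤ ∫ x, Real.exp (-ψ.fn x) * (φ - ψ).fn x := by
    refine integral_mono_ae a1 b1 ?_
    filter_upwards [H1.coeFn_sub φ ψ] with x hx
    rw [hx]
    rcases le_total (φ.fn x) (ψ.fn x) with h | h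
    · exact mul_le_mul_of_nonpos_right (Real.exp_le_exp.2 (by linarith)) (by linarith)
    · exact mul_le_mul_of_nonneg_right (Real.exp_le_exp.2 (by linarith)) (by linarith)
  have hg : (φ - ψ).grad = 0 := by
    have h1 : δ ^ 2 * inner ℝ (φ - ψ).grad (φ - ψ).grad ≤ 0 := by
      have : inner ℝ (φ - ψ).grad (φ - ψ).grad
          = inner ℝ φ.grad (φ - ψ).grad - inner ℝ ψ.grad (φ - ψ).grad := by
        rw [← inner_sub_left]; rfl
      rw [this]; linarith
    rw [real_inner_self_eq_norm_sq] at h1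
    have h2 : ‖(φ - ψ).grad‖ ^ 2 ≤ 0 := nonpos_of_mul_nonpos_right h1 (by positivity)
    exact norm_eq_zero.1 (pow_eq_zero_iff two_ne_zero |>.1 (le_antisymm h2 (sq_nonneg _)))
  obtain ⟨K, -, hP⟩ := exists_norm_sub_mean_le
  have h3 := hP (φ - ψ)
  rw [hg, norm_zero, mul_zero, norm_le_zero_iff, sub_eq_zero] at h3
  -- The two solutions differ by a constant, which vanishes because both densities have mass `1`.
  set m := ∫ x, (φ - ψ).fn x with hm
  have e : ∀ᵐ x, φ.fn x = ψ.fn x + m := by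
    have h4 : (φ - ψ).fn =ᵐ[volume] fun _ => m := by
      rw [h3]
      filter_upwards [H1.coeFn_smul m H1.one, coeFn_one] with x h1 h2
      rw [h1, h2, mul_one]
    filter_upwards [h4, H1.coeFn_sub φ ψ] with x h1 h2
    linarith
  have i1 := (hφ.integrable_and_integral_eq_one hρ).2
  have i2 := (hψ.integrable_and_integral_eq_one hρ).2
  have e' : (fun x => Real.exp (-φ.fn x)) =ᵐ[volume]
      fun x => Real.exp (-m) * Real.exp (-ψ.fn x) := by
    filter_upwards [e] with x hx
    rw [hx, ← Real.exp_add]; ring_nf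
  rw [integral_congr_ae e', integral_const_mul, i2, mul_one, Real.exp_eq_one_iff, neg_eq_zero] at i1
  rw [i1, zero_smul] at h3
  exact sub_eq_zero.1 h3

theorem existsUnique_isWeakSolution {δ : ℝ} (hδ : 0 < δ) {ρ : Hneg1} (hρ : ρ.mass = 1) :
    ∃! φ : H1, IsWeakSolution δ ρ φ := by
  obtain ⟨φ, h1, h2⟩ := exists_isMin_freeEnergy hδ hρ
  have h := isWeakSolution_of_isMin h1 h2
  exact ⟨φ, h, fun ψ hψ => hψ.unique hδ hρ h⟩

/-- Testing with the solution itself, `∫ e^{-φ} φ ≤ ∫ (1 - e^{-φ}) = 0` has a good sign. -/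
theorem exists_energy_bound : ∃ K : ℝ, 0 < K ∧ ∀ ρ : Hneg1, ρ.mass = 1 → ∀ δ : ℝ, 0 < δ →
    ∀ φ : H1, IsWeakSolution δ ρ φ →
      δ ^ 2 * ‖φ.grad‖ ^ 2 + |∫ x, φ.fn x| ≤ K / δ ^ 2 * ‖ρ - Hneg1.one‖ ^ 2 := by
  obtain ⟨K, hK, hC⟩ := exists_abs_sub_mean_le
  refine ⟨K ^ 2, by positivity, fun ρ hρ δ hδ φ hφ => ?_⟩
  obtain ⟨h1, h2⟩ := hφ.integrable_and_integral_eq_one hρ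
  have hm : 0 ≤ ∫ x, φ.fn x := by
    have := exp_neg_mean_le h1
    rw [h2, Real.exp_le_one_iff] at this
    linarith
  obtain ⟨h3, h4⟩ := hφ φ
  have h5 : ∫ x, Real.exp (-φ.fn x) * φ.fn x ≤ 0 := by
    have e : ∫ x, (1 - Real.exp (-φ.fn x)) = 0 := by
      rw [integral_sub (integrable_const _) h1, h2]; simp
    rw [← e]
    refine integral_mono h3 ((integrable_const _).sub h1) fun x => ?_
    have a1 := Real.add_one_le_exp (φ.fn x)
    have a2 : Real.exp (-φ.fn x) * Real.exp (φ.fn x) = 1 := by rw [← Real.exp_add]; simp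
    have a3 := mul_le_mul_of_nonneg_left a1 (Real.exp_pos (-φ.fn x)).le
    simp only []
    nlinarith
  rw [inner_grad_eq_integral, real_inner_self_eq_norm_sq] at h4
  have h6 := (abs_le.1 (hC ρ hρ φ)).1
  rw [abs_of_nonneg hm]
  set C := K * ‖ρ - Hneg1.one‖
  have h7 : δ ^ 2 * ‖φ.grad‖ ^ 2 + ∫ x, φ.fn x ≤ C * ‖φ.grad‖ := by linarith
  have h8 : C * ‖φ.grad‖ ≤ C ^ 2 / (2 * δ ^ 2) + δ ^ 2 / 2 * ‖φ.grad‖ ^ 2 := by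
    have := le_half_sq_sub hδ C ‖φ.grad‖
    linarith
  have h9 : K ^ 2 / δ ^ 2 * ‖ρ - Hneg1.one‖ ^ 2 = 2 * (C ^ 2 / (2 * δ ^ 2)) := by
    simp only [C]; field_simp
  rw [h9]
  nlinarith

/-! ### Lebesgue norms of the Boltzmann density -/

theorem inner_grad_ofSmooth_ofSmooth {f g : T2 → ℝ} (hf : IsSmooth f) (hg : IsSmooth g) :
    inner ℝ (H1.ofSmooth f hf).grad (H1.ofSmooth g hg).grad
      = (∫ x, pderiv 0 f x * pderiv 0 g x) + ∫ x, pderiv 1 f x * pderiv 1 g x := by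
  rw [inner_grad_ofSmooth]
  congr 1 <;> apply integral_congr_ae
  · filter_upwards [coeFn_grad_ofSmooth_apply hf 0] with x hx
    rw [hx]
  · filter_upwards [coeFn_grad_ofSmooth_apply hf 1] with x hx
    rw [hx]

/-- The gradient of a decreasing function of `f` points against the gradient of `f`. -/
theorem inner_grad_ofSmooth_comp_nonpos {F F' : ℝ → ℝ} (hF : ContDiff ℝ ∞ F)
    (hF' : ∀ y, HasDerivAt F (F' y) y) (h0 : ∀ y, F' y ≤ 0) {f : T2 → ℝ} (hf : IsSmooth f) :
    inner ℝ (H1.ofSmooth f hf).grad (H1.ofSmooth _ (IsSmooth.comp hF hf)).grad ≤ 0 := by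
  have h : ∀ i, ∫ x, pderiv i f x * pderiv i (fun x => F (f x)) x ≤ 0 := fun i =>
    integral_nonpos fun x => by
      simp only [pderiv_comp hF' hf]
      have := mul_nonpos_of_nonpos_of_nonneg (h0 (f x)) (sq_nonneg (pderiv i f x))
      simp only [Pi.zero_apply]
      nlinarith
  rw [inner_grad_ofSmooth_ofSmooth]
  linarith [h 0, h 1]

theorem norm_grad_ofSmooth_comp_le {F F' : ℝ → ℝ} (hF : ContDiff ℝ ∞ F)
    (hF' : ∀ y, HasDerivAt F (F' y) y) {D : ℝ} (hD : ∀ y, |F' y| ≤ D) {f : T2 → ℝ}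
    (hf : IsSmooth f) :
    ‖(H1.ofSmooth _ (IsSmooth.comp hF hf)).grad‖ ≤ D * ‖(H1.ofSmooth f hf).grad‖ := by
  have hs := IsSmooth.comp hF hf
  have hD0 : 0 ≤ D := (abs_nonneg _).trans (hD 0)
  have h : ∀ i, ∫ x, pderiv i (fun x => F (f x)) x * pderiv i (fun x => F (f x)) x
      ≤ D ^ 2 * ∫ x, pderiv i f x * pderiv i f x := by
    intro i
    rw [← integral_const_mul]
    refine integral_mono (integrable_of_continuous
      ((hs.pderiv i).continuous.mul (hs.pderiv i).continuous)) (integrable_of_continuous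
      (continuous_const.mul ((hf.pderiv i).continuous.mul (hf.pderiv i).continuous))) fun x => ?_
    simp only [pderiv_comp hF' hf]
    have h1 : F' (f x) ^ 2 ≤ D ^ 2 := sq_le_sq' (abs_le.1 (hD _)).1 (abs_le.1 (hD _)).2
    have := mul_le_mul_of_nonneg_right h1 (sq_nonneg (pderiv i f x))
    nlinarith
  refine le_of_sq_le_sq ?_ (by positivity)
  rw [mul_pow, ← real_inner_self_eq_norm_sq, ← real_inner_self_eq_norm_sq,
    inner_grad_ofSmooth_ofSmooth, inner_grad_ofSmooth_ofSmooth]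
  linarith [h 0, h 1]

/-- Testing the equation with a bounded decreasing function of the solution. As composition is not
available in `H¹`, the test functions are those of smooth approximations of the solution. -/
theorem integral_exp_neg_mul_le {δ : ℝ} {ρ : Hneg1} (hρ : ρ.mass = 1) {φ : H1}
    (h : IsWeakSolution δ ρ φ) {r : T2 → ℝ} (hr : Integrable r volume) (hrep : ρ.IsRepresentedBy r)
    {F F' : ℝ → ℝ} (hF : ContDiff ℝ ∞ F) (hF' : ∀ y, HasDerivAt F (F' y) y) (h0 : ∀ y, F' y ≤ 0)
    {B D : ℝ} (hB : ∀ y, |F y| ≤ B) (hD : ∀ y, |F' y| ≤ D) :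
    ∫ x, Real.exp (-φ.fn x) * F (φ.fn x) ≤ ∫ x, r x * F (φ.fn x) := by
  obtain ⟨hn, -⟩ := h.integrable_and_integral_eq_one hρ
  have hD0 : 0 ≤ D := (abs_nonneg _).trans (hD 0)
  obtain ⟨v, hv, hvlim⟩ := mem_closure_iff_seq_limit.1 (denseRange_trigH1 φ)
  choose c hc using hv
  have h1 : Filter.Tendsto (fun k => trigH1 (c k)) Filter.atTop (nhds φ) :=
    hvlim.congr fun k => (hc k).symm
  have h3 : Filter.Tendsto (fun k => fnL (trigH1 (c k))) Filter.atTop (nhds φ.fn) :=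
    (fnL.continuous.tendsto φ).comp h1
  have hg : Filter.Tendsto (fun k => (trigH1 (c k)).grad) Filter.atTop (nhds φ.grad) :=
    (gradL.continuous.tendsto φ).comp h1
  obtain ⟨ns, hns, h4⟩ := exists_seq_tendsto_ae_of_tendsto h3
  have h5 : ∀ᵐ x, Filter.Tendsto (fun k => trig (c (ns k)) x) Filter.atTop (nhds (φ.fn x)) := by
    have a2 : ∀ᵐ x, ∀ k, fnL (trigH1 (c k)) x = trig (c k) x :=
      ae_all_iff.2 fun k => coeFn_fn_ofSmooth (trig_isSmooth (c k))
    filter_upwards [h4, a2] with x b1 b2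
    simpa only [b2] using b1
  have hdom : ∀ g : T2 → ℝ, Integrable g volume →
      Filter.Tendsto (fun k => ∫ x, g x * F (trig (c (ns k)) x)) Filter.atTop
        (nhds (∫ x, g x * F (φ.fn x))) := by
    intro g hgi
    refine tendsto_integral_of_dominated_convergence (fun x => |g x| * B) (fun k =>
      (integrable_mul_of_continuous hgi
        (hF.continuous.comp (trig _).continuous)).aestronglyMeasurable)
      (hgi.abs.mul_const B) (fun k => Filter.Eventually.of_forall fun x => ?_) ?_
    · rw [Real.norm_eq_abs, abs_mul]
      exact mul_le_mul_of_nonneg_left (hB _) (abs_nonneg _)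
    · filter_upwards [h5] with x hx
      exact ((hF.continuous.tendsto _).comp hx).const_mul (g x)
  have hk : ∀ k, (∫ x, Real.exp (-φ.fn x) * F (trig (c k) x)) - ∫ x, r x * F (trig (c k) x)
      ≤ δ ^ 2 * (‖φ.grad - (trigH1 (c k)).grad‖ * (D * ‖(trigH1 (c k)).grad‖)) := by
    intro k
    have hf := trig_isSmooth (c k)
    have hs := IsSmooth.comp hF hf
    obtain ⟨-, e1⟩ := h (H1.ofSmooth _ hs)
    have e2 : ∫ x, Real.exp (-φ.fn x) * (H1.ofSmooth _ hs).fn x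
        = ∫ x, Real.exp (-φ.fn x) * F (trig (c k) x) := by
      apply integral_congr_ae
      filter_upwards [coeFn_fn_ofSmooth hs] with x hx
      rw [hx]
    rw [e2, hrep _ hs, inner_grad_eq_integral] at e1
    rw [← e1]
    refine mul_le_mul_of_nonneg_left ?_ (sq_nonneg δ)
    have e3 : inner ℝ φ.grad (H1.ofSmooth _ hs).grad
        = inner ℝ (φ.grad - (trigH1 (c k)).grad) (H1.ofSmooth _ hs).grad
          + inner ℝ (trigH1 (c k)).grad (H1.ofSmooth _ hs).grad := by
      rw [← inner_add_left, sub_add_cancel]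
    have e4 : inner ℝ (trigH1 (c k)).grad (H1.ofSmooth _ hs).grad ≤ 0 :=
      inner_grad_ofSmooth_comp_nonpos hF hF' h0 hf
    have e5 : ‖(H1.ofSmooth _ hs).grad‖ ≤ D * ‖(trigH1 (c k)).grad‖ :=
      norm_grad_ofSmooth_comp_le hF hF' hD hf
    have e6 := (real_inner_le_norm (φ.grad - (trigH1 (c k)).grad) (H1.ofSmooth _ hs).grad).trans
      (mul_le_mul_of_nonneg_left e5 (norm_nonneg _))
    linarith
  have hlim0 : Filter.Tendsto (fun k => δ ^ 2 * (‖φ.grad - (trigH1 (c k)).grad‖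
      * (D * ‖(trigH1 (c k)).grad‖))) Filter.atTop (nhds 0) := by
    have a := (((hg.const_sub φ.grad).norm).mul (hg.norm.const_mul D)).const_mul (δ ^ 2)
    simpa using a
  have := le_of_tendsto_of_tendsto' ((hdom _ hn).sub (hdom _ hr))
    (hlim0.comp hns.tendsto_atTop) fun k => hk (ns k)
  linarith

section Power

variable {ε s : ℝ}

theorem contDiff_exp_add_rpow (hε : 0 < ε) : ContDiff ℝ ∞ fun y : ℝ => (Real.exp y + ε) ^ (-s) :=
  ContDiff.rpow_const_of_ne (Real.contDiff_exp.add contDiff_const) fun y => by positivity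

theorem hasDerivAt_exp_add_rpow (hε : 0 < ε) (y : ℝ) :
    HasDerivAt (fun y : ℝ => (Real.exp y + ε) ^ (-s))
      (Real.exp y * (-s) * (Real.exp y + ε) ^ (-s - 1)) y :=
  ((Real.hasDerivAt_exp y).add_const ε).rpow_const (Or.inl (by positivity))

theorem exp_add_rpow_le (hε : 0 < ε) (hs : 0 ≤ s) (y : ℝ) :
    (Real.exp y + ε) ^ (-s) ≤ ε ^ (-s) :=
  Real.rpow_le_rpow_of_nonpos hε (by linarith [Real.exp_pos y]) (by linarith)

theorem abs_deriv_exp_add_rpow_le (hε : 0 < ε) (hs : 0 ≤ s) (y : ℝ) :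
    |Real.exp y * (-s) * (Real.exp y + ε) ^ (-s - 1)| ≤ s * ε ^ (-s) := by
  have hp : 0 < Real.exp y + ε := by positivity
  have h1 : Real.exp y * (Real.exp y + ε) ^ (-s - 1) ≤ (Real.exp y + ε) ^ (-s) := by
    rw [Real.rpow_sub_one hp.ne', ← mul_div_assoc, div_le_iff₀ hp, mul_comm]
    exact mul_le_mul_of_nonneg_left (by linarith) (by positivity)
  have h2 : 0 ≤ Real.exp y * (Real.exp y + ε) ^ (-s - 1) := by positivity
  have e : Real.exp y * (-s) * (Real.exp y + ε) ^ (-s - 1)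
      = -(s * (Real.exp y * (Real.exp y + ε) ^ (-s - 1))) := by ring
  rw [e, abs_neg, abs_of_nonneg (mul_nonneg hs h2)]
  exact mul_le_mul_of_nonneg_left (h1.trans (exp_add_rpow_le hε hs y)) hs

end Power

/-- The bound for the truncated density `1 / (e^φ + ε) ≤ e^{-φ}`: the power `q - 1` of this density
is a bounded decreasing function of `φ`, which is used as a test function. -/
theorem eLpNorm_truncated_le {δ : ℝ} {ρ : Hneg1} (hρ : ρ.mass = 1) {φ : H1}
    (h : IsWeakSolution δ ρ φ) {p : ℝ≥0∞} (hp1 : 1 < p) (hp : p ≠ ⊤) {r : T2 → ℝ}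
    (hr : MemLp r p volume) (hrep : ρ.IsRepresentedBy r) {ε : ℝ} (hε : 0 < ε) :
    eLpNorm (fun x => (Real.exp (φ.fn x) + ε)⁻¹) p volume ≤ eLpNorm r p volume := by
  set q := p.toReal with hq
  have hq1 : 1 < q := by
    rw [hq, ← ENNReal.toReal_one]
    exact (ENNReal.toReal_lt_toReal (by simp) hp).2 hp1
  have hrint : Integrable r volume := hr.integrable hp1.le
  obtain ⟨hn, -⟩ := h.integrable_and_integral_eq_one hρ
  set σ : T2 → ℝ := fun x => (Real.exp (φ.fn x) + ε)⁻¹ with hσ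
  have hσ0 : ∀ x, 0 < σ x := fun x => by simp only [hσ]; positivity
  have hσle : ∀ x, σ x ≤ ε⁻¹ := fun x => by
    simp only [hσ]
    exact inv_anti₀ hε (by linarith [Real.exp_pos (φ.fn x)])
  have hσn : ∀ x, σ x ≤ Real.exp (-φ.fn x) := fun x => by
    rw [Real.exp_neg]
    exact inv_anti₀ (Real.exp_pos _) (by linarith)
  have hσm : AEStronglyMeasurable σ volume := by
    have hc : Continuous fun y : ℝ => (Real.exp y + ε)⁻¹ :=
      (Real.continuous_exp.add continuous_const).inv₀ fun y =>
        (show 0 < Real.exp y + ε by positivity).ne'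
    exact hc.comp_aestronglyMeasurable (Lp.aestronglyMeasurable φ.fn)
  have hσp : ∀ p, MemLp σ p volume := fun p =>
    MemLp.of_bound hσm ε⁻¹ (Filter.Eventually.of_forall fun x => by
      rw [Real.norm_eq_abs, abs_of_pos (hσ0 x)]; exact hσle x)
  have hFσ : ∀ x, (Real.exp (φ.fn x) + ε) ^ (-(q - 1)) = σ x ^ (q - 1) := fun x => by
    have : 0 ≤ Real.exp (φ.fn x) + ε := by positivity
    simp only [hσ]
    rw [Real.rpow_neg this, Real.inv_rpow this]
  have hs : 0 ≤ q - 1 := by linarith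
  have htest := integral_exp_neg_mul_le hρ h hrint hrep (contDiff_exp_add_rpow (s := q - 1) hε)
    (hasDerivAt_exp_add_rpow hε) (fun y => by
      have : 0 ≤ Real.exp y * (q - 1) * (Real.exp y + ε) ^ (-(q - 1) - 1) :=
        mul_nonneg (mul_nonneg (Real.exp_pos y).le hs) (by positivity)
      nlinarith)
    (B := ε ^ (-(q - 1))) (fun y => by
      rw [abs_of_pos (by positivity)]; exact exp_add_rpow_le hε hs y)
    (abs_deriv_exp_add_rpow_le hε hs)
  simp only [hFσ] at htest
  have hpow : ∀ t : ℝ, 0 ≤ t → ∀ x, |σ x ^ t| ≤ ε⁻¹ ^ t := fun t ht x => by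
    rw [abs_of_pos (Real.rpow_pos_of_pos (hσ0 x) _)]
    exact Real.rpow_le_rpow (hσ0 x).le (hσle x) ht
  have hpowm : ∀ t : ℝ, 0 ≤ t → AEStronglyMeasurable (fun x => σ x ^ t) volume := fun t ht =>
    (Real.continuous_rpow_const ht).comp_aestronglyMeasurable hσm
  have hpowp : ∀ t : ℝ, 0 ≤ t → ∀ p, MemLp (fun x => σ x ^ t) p volume := fun t ht p =>
    MemLp.of_bound (hpowm t ht) _ (Filter.Eventually.of_forall (hpow t ht))
  have hmul : ∀ g : T2 → ℝ, Integrable g volume →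
      Integrable fun x => g x * σ x ^ (q - 1) := fun g hg =>
    hg.mul_bdd (hpowm _ hs) (Filter.Eventually.of_forall (hpow _ hs))
  set X := ∫ x, σ x ^ q with hX
  have hX0 : 0 ≤ X := integral_nonneg fun x => Real.rpow_nonneg (hσ0 x).le _
  have h1 : X ≤ ∫ x, Real.exp (-φ.fn x) * σ x ^ (q - 1) := by
    refine integral_mono ((hpowp q (by linarith) 1).integrable le_rfl) (hmul _ hn) fun x => ?_
    have e : σ x ^ q = σ x * σ x ^ (q - 1) := by
      rw [mul_comm]; exact rpow_sub_one_mul (hσ0 x) q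
    simp only []
    rw [e]
    exact mul_le_mul_of_nonneg_right (hσn x) (Real.rpow_nonneg (hσ0 x).le _)
  have h2 : ∫ x, r x * σ x ^ (q - 1) ≤ ∫ x, |r x| * σ x ^ (q - 1) :=
    integral_mono (hmul _ hrint) (hmul _ hrint.abs) fun x =>
      mul_le_mul_of_nonneg_right (le_abs_self _) (Real.rpow_nonneg (hσ0 x).le _)
  have hconj : q.HolderConjugate (q / (q - 1)) := Real.HolderConjugate.conjExponent hq1
  have h3 : ∫ x, |r x| * σ x ^ (q - 1) ≤ (∫ x, |r x| ^ q) ^ (1 / q) * X ^ (1 / (q / (q - 1))) := by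
    have := integral_mul_le_Lp_mul_Lq_of_nonneg (μ := (volume : Measure T2)) hconj
      (f := fun x => |r x|) (g := fun x => σ x ^ (q - 1))
      (Filter.Eventually.of_forall fun x => abs_nonneg _)
      (Filter.Eventually.of_forall fun x => Real.rpow_nonneg (hσ0 x).le _)
      (by rw [hq, ENNReal.ofReal_toReal hp]; exact hr.abs) (hpowp _ hs _)
    refine this.trans (le_of_eq ?_)
    have e : ∀ x, (σ x ^ (q - 1)) ^ (q / (q - 1)) = σ x ^ q := fun x => by
      rw [← Real.rpow_mul (hσ0 x).le, mul_div_cancel₀ _ (by linarith)]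
    simp only [e, hX]
  have h4 : X ^ q⁻¹ ≤ (∫ x, |r x| ^ q) ^ q⁻¹ := by
    have hR : 0 ≤ ∫ x, |r x| ^ q := integral_nonneg fun x => Real.rpow_nonneg (abs_nonneg _) _
    rcases hX0.eq_or_lt with hz | hz
    · rw [← hz, Real.zero_rpow (inv_ne_zero (by linarith))]
      exact Real.rpow_nonneg hR _
    · have h5 : X ≤ (∫ x, |r x| ^ q) ^ (1 / q) * X ^ (1 / (q / (q - 1))) := by linarith
      have h6 : X ^ q⁻¹ * X ^ (1 / (q / (q - 1))) = X := by
        rw [← Real.rpow_add hz]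
        have : q⁻¹ + 1 / (q / (q - 1)) = 1 := by
          have : q - 1 ≠ 0 := by linarith
          have : q ≠ 0 := by linarith
          field_simp; ring
        rw [this, Real.rpow_one]
      rw [one_div q] at h5
      refine le_of_mul_le_mul_right (h6.le.trans h5) (Real.rpow_pos_of_pos hz _)
  have hp0 : p ≠ 0 := (zero_lt_one.trans hp1).ne'
  rw [(hσp p).eLpNorm_eq_integral_rpow_norm hp0 hp, hr.eLpNorm_eq_integral_rpow_norm hp0 hp]
  refine ENNReal.ofReal_le_ofReal ?_
  have e : ∀ x, ‖σ x‖ = σ x := fun x => by rw [Real.norm_eq_abs, abs_of_pos (hσ0 x)]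
  simp only [e, Real.norm_eq_abs]
  exact h4

/-- By Chebyshev's inequality `|{|f| ≥ a}| ≤ (M / a)ᵏ`, which tends to `0` for `a > M`. -/
theorem eLpNorm_top_le_of_forall_nat {f : T2 → ℝ} (hf : AEStronglyMeasurable f volume) {M : ℝ≥0∞}
    (h : ∀ k : ℕ, 2 ≤ k → eLpNorm f k volume ≤ M) : eLpNorm f ⊤ volume ≤ M := by
  rw [eLpNorm_exponent_top]
  refine le_of_forall_gt_imp_ge_of_dense fun a ha => ?_
  rcases eq_or_ne a ⊤ with rfl | hat
  · exact le_top
  have ha0 : a ≠ 0 := (bot_lt_iff_ne_bot.1 (lt_of_le_of_lt bot_le ha))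
  refine essSup_le_of_ae_le a ?_
  have hz : volume {x : T2 | a ≤ ‖f x‖ₑ} = 0 := by
    have h1 : ∀ k : ℕ, 2 ≤ k → volume {x : T2 | a ≤ ‖f x‖ₑ} ≤ (a⁻¹ * M) ^ k := by
      intro k hk
      have h2 := meas_ge_le_mul_pow_eLpNorm_enorm (volume : Measure T2) (p := k)
        (by norm_cast; omega) (by simp) hf ha0 (fun h => absurd h hat)
      simp only [ENNReal.toReal_natCast, ENNReal.rpow_natCast] at h2
      rw [mul_pow]
      exact h2.trans (mul_le_mul_right (pow_le_pow_left' (h k hk) k) _)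
    have h3 : a⁻¹ * M < 1 := by
      rw [mul_comm, ← div_eq_mul_inv]
      exact ENNReal.div_lt_of_lt_mul (by simpa using ha)
    have h4 := ENNReal.tendsto_pow_atTop_nhds_zero_of_lt_one h3
    refine le_antisymm (ge_of_tendsto h4 ?_) bot_le
    filter_upwards [Filter.eventually_ge_atTop 2] with k hk using h1 k hk
  filter_upwards [measure_eq_zero_iff_ae_notMem.1 hz] with x hx
  exact (not_le.1 hx).le

theorem Hneg1.IsRepresentedBy.mass_eq {ρ : Hneg1} {r : T2 → ℝ} (h : ρ.IsRepresentedBy r) :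
    ρ.mass = ∫ x, r x := by
  have := h (fun _ => 1) (isSmooth_const 1)
  simpa [Hneg1.mass] using this

/-- The truncation is removed by Fatou's lemma. The exponent `1` is the conservation of mass. -/
theorem eLpNorm_exp_neg_le {p : ℝ≥0∞} (hp1 : 1 ≤ p) {ρ : Hneg1} {r : T2 → ℝ} (hρ : ρ.mass = 1)
    (hr : MemLp r p volume) (hrep : ρ.IsRepresentedBy r) {δ : ℝ} {φ : H1}
    (h : IsWeakSolution δ ρ φ) :
    eLpNorm (fun x => Real.exp (-φ.fn x)) p volume ≤ eLpNorm r p volume := by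
  have hfin : ∀ p : ℝ≥0∞, 1 < p → p ≠ ⊤ → MemLp r p volume →
      eLpNorm (fun x => Real.exp (-φ.fn x)) p volume ≤ eLpNorm r p volume := by
    intro p hp1 hp hr
    have h1 : ∀ x, Filter.Tendsto (fun k : ℕ => (Real.exp (φ.fn x) + 1 / ((k : ℝ) + 1))⁻¹)
        Filter.atTop (nhds (Real.exp (-φ.fn x))) := fun x => by
      rw [Real.exp_neg]
      refine Filter.Tendsto.inv₀ ?_ (Real.exp_pos _).ne'
      simpa using tendsto_one_div_add_atTop_nhds_zero_nat.const_add (Real.exp (φ.fn x))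
    refine (Lp.eLpNorm_lim_le_liminf_eLpNorm (fun k => ?_) _
      (Filter.Eventually.of_forall h1)).trans ?_
    · have hc : Continuous fun y : ℝ => (Real.exp y + 1 / ((k : ℝ) + 1))⁻¹ :=
        (Real.continuous_exp.add continuous_const).inv₀ fun y =>
          (show 0 < Real.exp y + 1 / ((k : ℝ) + 1) by positivity).ne'
      exact hc.comp_aestronglyMeasurable (Lp.aestronglyMeasurable φ.fn)
    · exact Filter.liminf_le_of_frequently_le' (Filter.Frequently.of_forall fun k =>
        eLpNorm_truncated_le hρ h hp1 hp hr hrep (by positivity))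
  rcases eq_or_ne p ⊤ with rfl | hp
  · refine eLpNorm_top_le_of_forall_nat (aestronglyMeasurable_exp_neg φ) fun k hk => ?_
    have hk1 : (1 : ℝ≥0∞) < k := by exact_mod_cast hk
    exact (hfin k hk1 (by simp) (hr.mono_exponent le_top)).trans
      (eLpNorm_le_eLpNorm_of_exponent_le le_top hr.aestronglyMeasurable)
  rcases hp1.eq_or_lt with rfl | hp1
  · obtain ⟨hn, hn1⟩ := h.integrable_and_integral_eq_one hρ
    have e : eLpNorm (fun x => Real.exp (-φ.fn x)) 1 volume = 1 := by
      rw [eLpNorm_one_eq_lintegral_enorm]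
      have : ∀ x, ‖Real.exp (-φ.fn x)‖ₑ = ENNReal.ofReal (Real.exp (-φ.fn x)) := fun x =>
        Real.enorm_of_nonneg (Real.exp_pos _).le
      simp only [this]
      rw [← ofReal_integral_eq_lintegral_ofReal hn
        (Filter.Eventually.of_forall fun x => (Real.exp_pos _).le), hn1, ENNReal.ofReal_one]
    rw [e, ← ENNReal.ofReal_toReal hr.eLpNorm_ne_top]
    refine ENNReal.one_le_ofReal.2 ?_
    refine (hρ.symm.trans hrep.mass_eq).le.trans ?_
    refine (le_abs_self _).trans ((norm_integral_le_integral_norm r).trans ?_)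
    exact integral_norm_le_eLpNorm le_rfl hr
  · exact hfin p hp1 hp hr

/-! ### Second derivatives and the sup norm -/

/-- Adding a constant does not change the weak Hessian. -/
theorem IsWeakHessian.add_const {u v : T2 → ℝ} {H : T2 → Mat2} (h : IsWeakHessian u H)
    (hu : Integrable u volume) (m : ℝ) (hv : v =ᵐ[volume] fun x => u x + m) :
    IsWeakHessian v H := by
  intro i j η hη
  have hs := (hη.pderiv j).pderiv i
  rw [← h i j η hη]
  have e : (fun x => v x * pderiv i (pderiv j η) x) =ᵐ[volume]
      fun x => u x * pderiv i (pderiv j η) x + m * pderiv i (pderiv j η) x := by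
    filter_upwards [hv] with x hx
    rw [hx, add_mul]
  rw [integral_congr_ae e, integral_add (integrable_mul_of_continuous hu hs.continuous)
    ((integrable_of_continuous hs.continuous).const_mul m), integral_const_mul,
    integral_pderiv (hη.pderiv j) i, mul_zero, add_zero]

/-- `Lᵖ ⊆ H⁻¹`, since a mean-zero function in `Lᵖ` is `-ΔU` for some `U ∈ H¹`. -/
theorem exists_isRepresentedBy {p : ℝ≥0∞} (hp1 : 1 < p) (hp : p ≠ ⊤) {r : T2 → ℝ}
    (hr : MemLp r p volume) (hr1 : ∫ x, r x = 1) : ∃ ρ : Hneg1, ρ.IsRepresentedBy r := by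
  have : Fact (1 ≤ p) := ⟨hp1.le⟩
  obtain ⟨K, -, h⟩ := exists_poisson_solution hp1 hp
  have hrint : Integrable r volume := hr.integrable hp1.le
  have hm : MemLp (fun x => r x - 1) p volume := hr.sub (memLp_const 1)
  have hg := hm.coeFn_toLp
  obtain ⟨-, U, -, -, -, -, -, -, hU⟩ := h (hm.toLp _) (by
    rw [integral_congr_ae hg, integral_sub hrint (integrable_const _), hr1]; simp)
  refine ⟨Hneg1.one + innerSL ℝ U.grad ∘L gradL, fun η hη => ?_⟩
  rw [add_apply, ContinuousLinearMap.comp_apply, innerSL_apply_apply, gradL_apply, hU η hη,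
    Hneg1.one_apply, integral_congr_ae (coeFn_fn_ofSmooth hη)]
  have e : (fun x => hm.toLp _ x * η x) =ᵐ[volume] fun x => r x * η x - η x := by
    filter_upwards [hg] with x hx
    rw [hx]; ring
  rw [integral_congr_ae e, integral_sub (integrable_mul_of_continuous hrint hη.continuous)
    (integrable_of_continuous hη.continuous)]
  ring

/-- Gradients are determined by their pairings with gradients of smooth functions. -/
theorem grad_eq_of_inner_eq {u v : H1} (h : ∀ (η : T2 → ℝ) (hη : IsSmooth η),
    inner ℝ u.grad (H1.ofSmooth η hη).grad = inner ℝ v.grad (H1.ofSmooth η hη).grad) :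
    u.grad = v.grad := by
  have key := H1.eq_of_eq_on_smooth (F := fun w => inner ℝ u.grad (gradL w))
    (G := fun w => inner ℝ v.grad (gradL w)) (by fun_prop) (by fun_prop) h (u - v)
  simp only [gradL_apply, H1.grad_sub] at key
  rw [← sub_eq_zero, ← inner_self_eq_zero (𝕜 := ℝ), inner_sub_left, key, sub_self]

/-- If `e^{-(u + m)}` has mass `1` then the constant `m` is controlled by the bounded function
`u`. -/
theorem abs_le_of_integral_exp_eq_one {u : C(T2, ℝ)} {m : ℝ}
    (h : ∫ x, Real.exp (-(u x + m)) = 1) : |m| ≤ ‖u‖ := by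
  have hu : ∀ x, |u x| ≤ ‖u‖ := fun x => u.norm_coe_le_norm x
  have hc : Continuous fun x => Real.exp (-(u x + m)) := by fun_prop
  have h1 : ∫ _x : T2, Real.exp (-(‖u‖ + m)) ≤ ∫ x, Real.exp (-(u x + m)) :=
    integral_mono (integrable_const _) (integrable_of_continuous hc) fun x =>
      Real.exp_le_exp.2 (by linarith [(abs_le.1 (hu x)).2])
  have h2 : ∫ x, Real.exp (-(u x + m)) ≤ ∫ _x : T2, Real.exp (-(-‖u‖ + m)) :=
    integral_mono (integrable_of_continuous hc) (integrable_const _) fun x =>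
      Real.exp_le_exp.2 (by linarith [(abs_le.1 (hu x)).1])
  rw [h, integral_const, probReal_univ, one_smul] at h1 h2
  rw [Real.exp_le_one_iff] at h1
  rw [Real.one_le_exp_iff] at h2
  exact abs_le.2 ⟨by linarith, by linarith⟩

/-- The solution differs by a constant from the solution of the Poisson equation with right-hand
side `(e^{-φ} - r) / δ²`, which is in `Lᵖ` by the bound on the density. -/
theorem exists_regularity_bound {p : ℝ≥0∞} (hp1 : 1 < p) (hp : p ≠ ⊤) : ∃ K : ℝ, 0 < K ∧
    ∀ r : T2 → ℝ, MemLp r p volume → ∫ x, r x = 1 →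
      ∀ ρ : Hneg1, ρ.IsRepresentedBy r → ∀ δ : ℝ, 0 < δ → ∀ φ : H1, IsWeakSolution δ ρ φ →
        (∃ H : T2 → Mat2, MemLp H p volume ∧ IsWeakHessian φ.fn H ∧
          eLpNorm H p volume ≤ ENNReal.ofReal (K / δ ^ 2) * eLpNorm r p volume) ∧
        eLpNorm φ.fn ⊤ volume ≤ ENNReal.ofReal (K / δ ^ 2) * eLpNorm r p volume := by
  have : Fact (1 ≤ p) := ⟨hp1.le⟩
  obtain ⟨K, hK, hpoisson⟩ := exists_poisson_solution hp1 hp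
  refine ⟨4 * K, by positivity, fun r hr hr1 ρ hrep δ hδ φ h => ?_⟩
  have hρ : ρ.mass = 1 := hrep.mass_eq.trans hr1
  have hrint : Integrable r volume := hr.integrable hp1.le
  obtain ⟨hn, hn1⟩ := h.integrable_and_integral_eq_one hρ
  have hle := eLpNorm_exp_neg_le hp1.le hρ hr hrep h
  have hnp : MemLp (fun x => Real.exp (-φ.fn x)) p volume :=
    ⟨aestronglyMeasurable_exp_neg φ, hle.trans_lt hr.eLpNorm_lt_top⟩
  set R := (eLpNorm r p volume).toReal with hR
  set g : Lp ℝ p (volume : Measure T2) := (δ ^ 2)⁻¹ • (hnp.toLp _ - hr.toLp r) with hg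
  have hgx : g =ᵐ[volume] fun x => (δ ^ 2)⁻¹ * (Real.exp (-φ.fn x) - r x) := by
    filter_upwards [Lp.coeFn_smul (δ ^ 2)⁻¹ (hnp.toLp _ - hr.toLp r),
      Lp.coeFn_sub (hnp.toLp _) (hr.toLp r), hnp.coeFn_toLp, hr.coeFn_toLp] with x h1 h2 h3 h4
    rw [hg, h1, Pi.smul_apply, h2, Pi.sub_apply, h3, h4, smul_eq_mul]
  have hgR : ‖g‖ ≤ 2 * R / δ ^ 2 := by
    have h1 : ‖hnp.toLp _‖ ≤ R := by
      rw [Lp.norm_toLp]; exact ENNReal.toReal_mono hr.eLpNorm_ne_top hle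
    have h2 : ‖hr.toLp r‖ = R := Lp.norm_toLp r hr
    rw [hg, norm_smul, Real.norm_eq_abs, abs_of_pos (by positivity), div_eq_inv_mul]
    refine mul_le_mul_of_nonneg_left ((norm_sub_le _ _).trans ?_) (by positivity)
    linarith
  obtain ⟨u, U, H, hUu, hu, -, hH, hhess, hweak⟩ := hpoisson g (by
    rw [integral_congr_ae hgx, integral_const_mul, integral_sub hn hrint, hn1, hr1]; simp)
  have hgrad : φ.grad = U.grad := by
    refine grad_eq_of_inner_eq fun η hη => ?_
    rw [hweak η hη]
    obtain ⟨-, h1⟩ := h (H1.ofSmooth η hη)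
    have e1 : ∫ x, Real.exp (-φ.fn x) * (H1.ofSmooth η hη).fn x
        = ∫ x, Real.exp (-φ.fn x) * η x := by
      apply integral_congr_ae
      filter_upwards [coeFn_fn_ofSmooth hη] with x hx
      rw [hx]
    have e2 : ∫ x, g x * η x
        = ∫ x, (δ ^ 2)⁻¹ * (Real.exp (-φ.fn x) * η x - r x * η x) := by
      apply integral_congr_ae
      filter_upwards [hgx] with x hx
      rw [hx]; ring
    rw [inner_grad_eq_integral, e1, hrep η hη] at h1
    rw [e2, integral_const_mul, integral_sub (integrable_mul_of_continuous hn hη.continuous)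
      (integrable_mul_of_continuous hrint hη.continuous), ← h1]
    field_simp
  obtain ⟨m, hφm⟩ : ∃ m : ℝ, φ.fn =ᵐ[volume] fun x => u x + m := by
    obtain ⟨_, -, hP⟩ := exists_norm_sub_mean_le
    have h3 := hP (φ - U)
    rw [H1.grad_sub, hgrad, sub_self, norm_zero, mul_zero, norm_le_zero_iff, sub_eq_zero] at h3
    set m := ∫ x, (φ - U).fn x
    have h4 : (φ - U).fn =ᵐ[volume] (m • H1.one).fn := by rw [← h3]
    refine ⟨m, ?_⟩
    filter_upwards [h4, H1.coeFn_sub φ U, H1.coeFn_smul m H1.one, coeFn_one, hUu]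
      with x a1 a2 a3 a4 a5
    rw [a2, a3, a4, a5] at a1
    linarith
  have hm : |m| ≤ ‖u‖ := by
    refine abs_le_of_integral_exp_eq_one ((integral_congr_ae ?_).trans hn1)
    filter_upwards [hφm] with x hx
    rw [hx]
  have hR0 : 0 ≤ R := ENNReal.toReal_nonneg
  have hKg : K * ‖g‖ ≤ 2 * K / δ ^ 2 * R := by
    refine (mul_le_mul_of_nonneg_left hgR hK.le).trans (le_of_eq ?_)
    ring
  have hfinal : ∀ b : ℝ, b ≤ 2 * (K * ‖g‖) →
      ENNReal.ofReal b ≤ ENNReal.ofReal (4 * K / δ ^ 2) * eLpNorm r p volume := by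
    intro b hb
    rw [← ENNReal.ofReal_toReal hr.eLpNorm_ne_top, ← ENNReal.ofReal_mul (by positivity)]
    refine ENNReal.ofReal_le_ofReal (hb.trans ?_)
    have e : 4 * K / δ ^ 2 * R = 2 * (2 * K / δ ^ 2 * R) := by ring
    rw [← hR, e]
    linarith
  have hKg0 : 0 ≤ K * ‖g‖ := by positivity
  refine ⟨⟨H, Lp.memLp H, hhess.add_const (integrable_of_continuous u.continuous) m hφm, ?_⟩, ?_⟩
  · rw [← ENNReal.ofReal_toReal (Lp.memLp H).eLpNorm_ne_top, ← Lp.norm_def]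
    exact hfinal _ (by linarith)
  · refine (eLpNormEssSup_le_of_ae_bound (C := 2 * ‖u‖) ?_).trans (hfinal _ (by linarith))
    filter_upwards [hφm] with x hx
    rw [hx, Real.norm_eq_abs]
    have := abs_add_le (u x) m
    have h2 : |u x| ≤ ‖u‖ := u.norm_coe_le_norm x
    linarith

end PoissonBoltzmann

end

theorem proposition3p2 :
    -- existence and uniqueness
    (∀ ρ : PoissonBoltzmann.Hneg1, ρ.mass = 1 → ∀ δ : ℝ, 0 < δ →
      ∃! φ : PoissonBoltzmann.H1, PoissonBoltzmann.IsWeakSolution δ ρ φ) ∧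
    -- the solution has unit mass
    (∀ ρ : PoissonBoltzmann.Hneg1, ρ.mass = 1 → ∀ δ : ℝ, 0 < δ →
      ∀ φ : PoissonBoltzmann.H1, PoissonBoltzmann.IsWeakSolution δ ρ φ →
        Integrable (fun x => Real.exp (-φ.fn x)) ∧ ∫ x, Real.exp (-φ.fn x) = 1) ∧
    -- energy estimate
    (∃ K : ℝ, 0 < K ∧ ∀ ρ : PoissonBoltzmann.Hneg1, ρ.mass = 1 → ∀ δ : ℝ, 0 < δ →
      ∀ φ : PoissonBoltzmann.H1, PoissonBoltzmann.IsWeakSolution δ ρ φ →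
        δ ^ 2 * ‖φ.grad‖ ^ 2 + |∫ x, φ.fn x|
          ≤ K / δ ^ 2 * ‖ρ - PoissonBoltzmann.Hneg1.one‖ ^ 2) ∧
    -- Lebesgue norms of the Boltzmann density
    (∀ p : ℝ≥0∞, 1 ≤ p → ∀ (ρ : PoissonBoltzmann.Hneg1) (r : PoissonBoltzmann.T2 → ℝ),
      ρ.mass = 1 → MemLp r p volume → ρ.IsRepresentedBy r → ∀ δ : ℝ, 0 < δ →
      ∀ φ : PoissonBoltzmann.H1, PoissonBoltzmann.IsWeakSolution δ ρ φ →
        eLpNorm (fun x => Real.exp (-φ.fn x)) p volume ≤ eLpNorm r p volume) ∧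
    -- second derivatives and sup norm
    (∀ p : ℝ≥0∞, 1 < p → p < ⊤ → ∃ K : ℝ, 0 < K ∧
      ∀ r : PoissonBoltzmann.T2 → ℝ, MemLp r p volume → ∫ x, r x = 1 →
        (∃ ρ : PoissonBoltzmann.Hneg1, ρ.IsRepresentedBy r) ∧
        ∀ ρ : PoissonBoltzmann.Hneg1, ρ.IsRepresentedBy r → ∀ δ : ℝ, 0 < δ →
        ∀ φ : PoissonBoltzmann.H1, PoissonBoltzmann.IsWeakSolution δ ρ φ →
          (∃ H : PoissonBoltzmann.T2 → PoissonBoltzmann.Mat2, MemLp H p volume ∧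
            PoissonBoltzmann.IsWeakHessian φ.fn H ∧
            eLpNorm H p volume ≤ ENNReal.ofReal (K / δ ^ 2) * eLpNorm r p volume) ∧
          eLpNorm φ.fn ⊤ volume ≤ ENNReal.ofReal (K / δ ^ 2) * eLpNorm r p volume) := by
  refine ⟨fun ρ hρ δ hδ => PoissonBoltzmann.existsUnique_isWeakSolution hδ hρ,
    fun ρ hρ δ _ φ hφ => hφ.integrable_and_integral_eq_one hρ,
    PoissonBoltzmann.exists_energy_bound,
    fun p hp ρ r hρ hr hrep δ _ φ hφ => PoissonBoltzmann.eLpNorm_exp_neg_le hp hρ hr hrep hφ,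
    fun p hp1 hp => ?_⟩
  obtain ⟨K, hK, h⟩ := PoissonBoltzmann.exists_regularity_bound hp1 hp.ne
  exact ⟨K, hK, fun r hr hr1 =>
    ⟨PoissonBoltzmann.exists_isRepresentedBy hp1 hp.ne hr hr1, h r hr hr1⟩⟩
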